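/- \textbf{Setting.} Let $\mathsf{L}_\omega$ be the language of arithmetic in all finite types ($0$ is the type of natural numbers, $\sigma\to\tau$ that of maps from type $\sigma$ to type $\tau$, $1=0\to 0$, $2=1\to 0$), with prime formulas $s=_0t$ and $s<_0t$, constants $0,1,+,\times$ of types $0$ and $0\to 0\to 0$, the combinators $\Pi_{\sigma,\tau},\Sigma_{\rho,\sigma,\tau}$ and recursors $\mathbf{R}_\sigma$; equality at higher types is defined pointwise from $=_0$. $\mathsf{RCA}_0^\omega$ is the classical theory with the axioms of discretely ordered commutative semirings for $0,1,+,\times,<$, the defining axioms of $\Pi$, $\Sigma$ and $\mathbf{R}_0$, the axiom of extensionality $x=_\rho y\to\varphi(x)=_\tau\varphi(y)$ for all types $\rho,\tau$, induction for quantifier-free formulas, and the choice schema $\forall x^1\exists y^0A(x,y)\to\exists Y^2\forall x^1A(x,Y(x))$ for quantifier-free $A$ (parameters of all types are allowed in both schemas). $\mathsf{ACA}_0^\omega$ is $\mathsf{RCA}_0^\omega$ plus $(\mu^2)$: there is $\mu^2$ such that for all $f^1$, $\mu(f)$ is the least zero of $f$ if $f$ has a zero, and $\mu(f)=0$ otherwise.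 Real numbers are, in $\mathsf{L}_\omega$, coded sequences of rationals $(q_n)$ with $|q_n-q_{n+i}|<2^{-n}$ for all $n,i$, two such sequences $(q_n),(r_n)$ being equal reals if $|q_n-r_n|\le 2^{-n+1}$ for all $n$. A function between sets of reals is an object of type $1\to1$ that maps reals (of its domain) to reals, and equal reals to equal reals. Write $I=[0,1]$ and $\mathbb{R}^+=\{x\in\mathbb{R}:x>0\}$. \textbf{Weak compactness.} $\mathsf{WHBU}_0$ is the sentence: for all $\Psi:I\to\mathbb{R}^+$ and $\varepsilon>0$ there are $y_0,\dots,y_n\in I$ with $\sum_{i=0}^n|J_i'|\ge 1-\varepsilon$, where $J_i=(y_i-\Psi(y_i),y_i+\Psi(y_i))$, $J_i'=J_i\setminus\bigcup_{j<i}J_j$, and $|J_i'|$ is the total length of the finite union of intervals $J'_i$. \textbf{Integrals.} A gauge is a function $\delta:\mathbb{R}\to\mathbb{R}^+$. A tagged partition is $P=(t_i,I_i)_{i\le k}$ with $I_i=[x_i,x_{i+1}]$, $0=x_0<x_1<\dots<x_{k+1}=1$ and $t_i\in I_i$; its Riemann sum is $S(f,P)=\sum_{i\le k}f(t_i)|I_i|$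 and its mesh is $\max_{i\le k}|I_i|$. For $\eta>0$ and a gauge $\delta$, $P$ is $\eta$-$\delta$-fine if the lengths of those $I_i$ with $I_i\subseteq[t_i-\delta(t_i),t_i+\delta(t_i)]$ add up to at least $1-\eta$. Let $f:I\to\mathbb{R}$ and $A\in\mathbb{R}$. \begin{itemize} \item $f$ is R-integrable with R-integral $A$ if for every $\varepsilon>0$ there is $d>0$ such that $|S(f,P)-A|<\varepsilon$ for every tagged partition $P$ of mesh at most $d$. \item $f$ is L-integrable with L-integral $A$ if $f$ is bounded on $I$ and for every $\varepsilon>0$ there are $\eta>0$ and a gauge $\delta$ such that $|S(f,P)-A|<\varepsilon$ for every $\eta$-$\delta$-fine tagged partition $P$. \end{itemize} \textbf{Theorem.} $\mathsf{ACA}_0^\omega$ proves that each of the following two statements is equivalent to $\mathsf{WHBU}_0$. \begin{enumerate} \item[(i)] (Uniqueness) If a bounded function is L-integrable on $[0,1]$, then its L-integral is unique: if $A$ and $B$ are L-integrals of $f$, then $A=_{\mathbb R}B$. \item[(ii)] (Consistency) If $f$ is R-integrable on $[0,1]$ with R-integral $A$, then $f$ is L-integrable there, and the two integrals are equal: every L-integral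 of $f$ equals $A$. \end{enumerate} -/

import Mathlib

/-!
The language of higher-order arithmetic, a classical natural deduction calculus for it, the
theories `RCA₀^ω` and `ACA₀^ω`, and the sentences of this language that express weak compactness
of the unit interval, and uniqueness and consistency of the restricted gauge integral.
Everything that is said about real numbers below is said *inside* the formal language: a quantifier
over reals is a formal quantifier over objects of type `0 → 0`.
-/

namespace HOA

/-! ### Syntax -/

/-- The finite types. -/
inductive Ty : Type
  | nat : Ty
  | arr : Ty → Ty → Ty

scoped infixr:60 " ⇾ " => Ty.arr

/-- The type `0` of natural numbers. -/
abbrev ty0 : Ty := Ty.nat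
/-- The type `1` of functions from numbers to numbers. -/
abbrev ty1 : Ty := ty0 ⇾ ty0
/-- The type `2`. -/
abbrev ty2 : Ty := ty1 ⇾ ty0

/-- The constants of the language. -/
inductive Const : Ty → Type
  | zero : Const ty0
  | one : Const ty0
  | add : Const (ty0 ⇾ ty0 ⇾ ty0)
  | mul : Const (ty0 ⇾ ty0 ⇾ ty0)
  /-- the combinator `Π` -/
  | P (σ τ : Ty) : Const (σ ⇾ τ ⇾ σ)
  /-- the combinator `Σ` -/
  | S (ρ σ τ : Ty) : Const ((ρ ⇾ σ ⇾ τ) ⇾ (ρ ⇾ σ) ⇾ ρ ⇾ τ)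
  /-- the recursor -/
  | R (σ : Ty) : Const ((ty0 ⇾ σ ⇾ σ) ⇾ σ ⇾ ty0 ⇾ σ)

/-- The family of variables `V` with one new variable of type `σ`. -/
inductive Ext (V : Ty → Type) (σ : Ty) : Ty → Type
  | new : Ext V σ σ
  | old {τ : Ty} : V τ → Ext V σ τ

/-- Terms with free variables in `V`. -/
inductive Tm (V : Ty → Type) : Ty → Type
  | var {σ : Ty} : V σ → Tm V σ
  | cst {σ : Ty} : Const σ → Tm V σ
  | app {σ τ : Ty} : Tm V (σ ⇾ τ) → Tm V σ → Tm V τ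

/-- Formulas with free variables in `V`; the variable bound by `all σ φ` is `Ext.new`. The prime
formulas are equations and inequalities between terms of type `0`. -/
inductive Fm : (Ty → Type) → Type 1
  | bot {V : Ty → Type} : Fm V
  | eq {V : Ty → Type} : Tm V ty0 → Tm V ty0 → Fm V
  | lt {V : Ty → Type} : Tm V ty0 → Tm V ty0 → Fm V
  | imp {V : Ty → Type} : Fm V → Fm V → Fm V
  | all {V : Ty → Type} (σ : Ty) : Fm (Ext V σ) → Fm V

/-- Sentences: formulas without free variables. -/
abbrev Sentence : Type 1 := Fm (fun _ => Empty)

section Substitution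

variable {V W : Ty → Type}

/-- Renaming of variables in a term. -/
def Tm.map (f : ∀ σ, V σ → W σ) : {σ : Ty} → Tm V σ → Tm W σ
  | _, .var v => .var (f _ v)
  | _, .cst c => .cst c
  | _, .app s t => .app (s.map f) (t.map f)

/-- Simultaneous substitution in a term. -/
def Tm.subst (f : ∀ σ, V σ → Tm W σ) : {σ : Ty} → Tm V σ → Tm W σ
  | _, .var v => f _ v
  | _, .cst c => .cst c
  | _, .app s t => .app (s.subst f) (t.subst f)

/-- A renaming, extended by the identity to a new variable. -/
def Ext.map (f : ∀ σ, V σ → W σ) {ρ : Ty} : ∀ σ, Ext V ρ σ → Ext W ρ σ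
  | _, .new => .new
  | _, .old v => .old (f _ v)

/-- A substitution, extended by the identity to a new variable. -/
def Ext.lift (f : ∀ σ, V σ → Tm W σ) {ρ : Ty} : ∀ σ, Ext V ρ σ → Tm (Ext W ρ) σ
  | _, .new => .var .new
  | _, .old v => (f _ v).map (fun _ => .old)

/-- A substitution, extended by a value for a new variable. -/
def Ext.cons {ρ : Ty} (t : Tm W ρ) (f : ∀ σ, V σ → Tm W σ) : ∀ σ, Ext V ρ σ → Tm W σ
  | _, .new => t
  | _, .old v => f _ v

/-- Renaming of free variables in a formula. -/
def Fm.map : {V W : Ty → Type} → (∀ σ, V σ → W σ) → Fm V → Fm W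
  | _, _, _, .bot => .bot
  | _, _, f, .eq s t => .eq (s.map f) (t.map f)
  | _, _, f, .lt s t => .lt (s.map f) (t.map f)
  | _, _, f, .imp φ ψ => .imp (φ.map f) (ψ.map f)
  | _, _, f, .all σ φ => .all σ (φ.map (Ext.map f))

/-- Simultaneous (capture-free) substitution in a formula. -/
def Fm.subst : {V W : Ty → Type} → (∀ σ, V σ → Tm W σ) → Fm V → Fm W
  | _, _, _, .bot => .bot
  | _, _, f, .eq s t => .eq (s.subst f) (t.subst f)
  | _, _, f, .lt s t => .lt (s.subst f) (t.subst f)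
  | _, _, f, .imp φ ψ => .imp (φ.subst f) (ψ.subst f)
  | _, _, f, .all σ φ => .all σ (φ.subst (Ext.lift f))

/-- The instance `φ(t)` of a formula `φ(x)`. -/
def Fm.inst {σ : Ty} (φ : Fm (Ext V σ)) (t : Tm V σ) : Fm V :=
  φ.subst (Ext.cons t (fun _ => .var))

end Substitution

/-! ### Provability -/

/-- Derivability of a formula from a set of formulas with free variables in `V`, in classical
natural deduction with equality. -/
inductive Prf : {V : Ty → Type} → Set (Fm V) → Fm V → Prop
  | hyp {V : Ty → Type} {H : Set (Fm V)} {φ : Fm V} : φ ∈ H → Prf H φ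
  | impI {V : Ty → Type} {H : Set (Fm V)} {φ ψ : Fm V} :
      Prf (insert φ H) ψ → Prf H (.imp φ ψ)
  | impE {V : Ty → Type} {H : Set (Fm V)} {φ ψ : Fm V} :
      Prf H (.imp φ ψ) → Prf H φ → Prf H ψ
  | raa {V : Ty → Type} {H : Set (Fm V)} {φ : Fm V} :
      Prf (insert (.imp φ .bot) H) .bot → Prf H φ
  | allI {V : Ty → Type} {H : Set (Fm V)} {σ : Ty} {φ : Fm (Ext V σ)} :
      Prf ((Fm.map (fun _ => .old)) '' H) φ → Prf H (.all σ φ)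
  | allE {V : Ty → Type} {H : Set (Fm V)} {σ : Ty} {φ : Fm (Ext V σ)} (t : Tm V σ) :
      Prf H (.all σ φ) → Prf H (φ.inst t)
  | eqRefl {V : Ty → Type} {H : Set (Fm V)} (t : Tm V ty0) : Prf H (.eq t t)
  | eqSubst {V : Ty → Type} {H : Set (Fm V)} {s t : Tm V ty0} (φ : Fm (Ext V ty0)) :
      Prf H (.eq s t) → Prf H (φ.inst s) → Prf H (φ.inst t)

/-- The theory `T` proves the sentence `φ`. -/
def Proves (T : Set Sentence) (φ : Sentence) : Prop := Prf T φ

scoped infix:25 " ⊩ " => Proves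

/-! ### Abbreviations -/

section Abbreviations

variable {V W : Ty → Type}

/-- Negation. -/
def Fm.neg (φ : Fm V) : Fm V := .imp φ .bot
/-- Conjunction. -/
def Fm.and (φ ψ : Fm V) : Fm V := .neg (.imp φ (.neg ψ))
/-- Disjunction. -/
def Fm.or (φ ψ : Fm V) : Fm V := .imp (.neg φ) ψ
/-- Equivalence. -/
def Fm.iff (φ ψ : Fm V) : Fm V := .and (.imp φ ψ) (.imp ψ φ)

scoped infixr:30 " ⟹ " => Fm.imp
scoped infixr:35 " ⩓ " => Fm.and
scoped infixr:33 " ⩔ " => Fm.or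
scoped infix:28 " ⟺ " => Fm.iff
scoped prefix:max "∼" => Fm.neg

/-- `All σ fun x => φ` is the formula `∀ x^σ, φ`. -/
def All (σ : Ty) (φ : Tm (Ext V σ) σ → Fm (Ext V σ)) : Fm V := .all σ (φ (.var .new))
/-- `Ex σ fun x => φ` is the formula `∃ x^σ, φ`. -/
def Ex (σ : Ty) (φ : Tm (Ext V σ) σ → Fm (Ext V σ)) : Fm V := ∼(All σ fun x => ∼(φ x))

/-- `W` arises from `V` by adding finitely many new variables. -/
class Lift (V W : Ty → Type) where
  /-- the inclusion of `V` in `W` -/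
  lift : ∀ σ, V σ → W σ

instance Lift.refl : Lift V V := ⟨fun _ v => v⟩
instance Lift.step {σ : Ty} [Lift V W] : Lift V (Ext W σ) := ⟨fun _ v => .old (Lift.lift _ v)⟩

/-- A term, seen in the scope of further quantifiers. -/
def Tm.up [Lift V W] {σ : Ty} (t : Tm V σ) : Tm W σ := t.map Lift.lift

scoped postfix:max "↟" => Tm.up
scoped infixl:90 " ⬝ " => Tm.app

instance : Zero (Tm V ty0) := ⟨.cst .zero⟩
instance : One (Tm V ty0) := ⟨.cst .one⟩
instance : Add (Tm V ty0) := ⟨fun s t => .cst .add ⬝ s ⬝ t⟩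
instance : Mul (Tm V ty0) := ⟨fun s t => .cst .mul ⬝ s ⬝ t⟩

/-- `s ≤ t` at type `0`. -/
def Fm.le (s t : Tm V ty0) : Fm V := ∼(Fm.lt t s)

/-- Equality at all types, defined from equality at type `0`. -/
def eqAt : (σ : Ty) → {V : Ty → Type} → Tm V σ → Tm V σ → Fm V
  | .nat, _, s, t => .eq s t
  | .arr σ τ, _, s, t => All σ fun z => eqAt τ (s↟ ⬝ z) (t↟ ⬝ z)

end Abbreviations

/-! ### The theories -/

/-- Quantifier-free formulas. -/
def Fm.QF : {V : Ty → Type} → Fm V → Prop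
  | _, .bot => True
  | _, .eq _ _ => True
  | _, .lt _ _ => True
  | _, .imp φ ψ => φ.QF ∧ ψ.QF
  | _, .all _ _ => False

/-- Variables of the types in a list. -/
def ctx : List Ty → Ty → Type
  | [] => fun _ => Empty
  | σ :: Γ => Ext (ctx Γ) σ

/-- The universal closure. -/
def closure : (Γ : List Ty) → Fm (ctx Γ) → Sentence
  | [], φ => φ
  | σ :: Γ, φ => closure Γ (.all σ φ)

/-- The axioms for `0, 1, +, ×, <`: those of (discretely) ordered commutative semi-rings. -/
inductive BasicAxiom : Sentence → Prop
  | add_assoc : BasicAxiom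
      (All ty0 fun x => All ty0 fun y => All ty0 fun z => .eq (x↟ + y↟ + z) (x↟ + (y↟ + z)))
  | add_comm : BasicAxiom (All ty0 fun x => All ty0 fun y => .eq (x↟ + y) (y + x↟))
  | add_zero : BasicAxiom (All ty0 fun x => .eq (x + 0) x)
  | mul_assoc : BasicAxiom
      (All ty0 fun x => All ty0 fun y => All ty0 fun z => .eq (x↟ * y↟ * z) (x↟ * (y↟ * z)))
  | mul_comm : BasicAxiom (All ty0 fun x => All ty0 fun y => .eq (x↟ * y) (y * x↟))
  | mul_one : BasicAxiom (All ty0 fun x => .eq (x * 1) x)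
  | mul_zero : BasicAxiom (All ty0 fun x => .eq (x * 0) 0)
  | mul_add : BasicAxiom
      (All ty0 fun x => All ty0 fun y => All ty0 fun z => .eq (x↟ * (y↟ + z)) (x↟ * y↟ + x↟ * z))
  | lt_irrefl : BasicAxiom (All ty0 fun x => ∼(.lt x x))
  | lt_trans : BasicAxiom
      (All ty0 fun x => All ty0 fun y => All ty0 fun z => .lt x↟ y↟ ⟹ .lt y↟ z ⟹ .lt x↟ z)
  | lt_total : BasicAxiom (All ty0 fun x => All ty0 fun y => .lt x↟ y ⩔ .eq x↟ y ⩔ .lt y x↟)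
  | add_lt_add : BasicAxiom
      (All ty0 fun x => All ty0 fun y => All ty0 fun z => .lt x↟ y↟ ⟹ .lt (x↟ + z) (y↟ + z))
  | mul_lt_mul : BasicAxiom
      (All ty0 fun x => All ty0 fun y => All ty0 fun z =>
        .lt 0 z ⟹ .lt x↟ y↟ ⟹ .lt (x↟ * z) (y↟ * z))
  | zero_lt_one : BasicAxiom (.lt 0 1)
  | not_lt_zero : BasicAxiom (All ty0 fun x => ∼(.lt x 0))
  | lt_add_one : BasicAxiom
      (All ty0 fun x => All ty0 fun y => .lt x↟ (y + 1) ⟹ .lt x↟ y ⩔ .eq x↟ y)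

/-- The axioms of `RCA₀^ω`. -/
inductive RCAAxiom : Sentence → Prop
  | basic {φ : Sentence} : BasicAxiom φ → RCAAxiom φ
  /-- `Π x y = x` -/
  | combP (σ τ : Ty) : RCAAxiom
      (All σ fun x => All τ fun y => eqAt σ (.cst (.P σ τ) ⬝ x↟ ⬝ y) x↟)
  /-- `Σ x y z = x z (y z)` -/
  | combS (ρ σ τ : Ty) : RCAAxiom
      (All (ρ ⇾ σ ⇾ τ) fun x => All (ρ ⇾ σ) fun y => All ρ fun z =>
        eqAt τ (.cst (.S ρ σ τ) ⬝ x↟ ⬝ y↟ ⬝ z) (x↟ ⬝ z ⬝ (y↟ ⬝ z)))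
  /-- `R₀ f m 0 = m` -/
  | recZero : RCAAxiom
      (All (ty0 ⇾ ty0 ⇾ ty0) fun f => All ty0 fun m => .eq (.cst (.R ty0) ⬝ f↟ ⬝ m ⬝ 0) m)
  /-- `R₀ f m (n + 1) = f n (R₀ f m n)` -/
  | recSucc : RCAAxiom
      (All (ty0 ⇾ ty0 ⇾ ty0) fun f => All ty0 fun m => All ty0 fun n =>
        .eq (.cst (.R ty0) ⬝ f↟ ⬝ m↟ ⬝ (n + 1)) (f↟ ⬝ n ⬝ (.cst (.R ty0) ⬝ f↟ ⬝ m↟ ⬝ n)))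
  /-- the axiom of extensionality -/
  | ext (ρ τ : Ty) : RCAAxiom
      (All ρ fun x => All ρ fun y => All (ρ ⇾ τ) fun F =>
        eqAt ρ x↟ y↟ ⟹ eqAt τ (F ⬝ x↟) (F ⬝ y↟))
  /-- induction for quantifier-free formulas `A(n)`, with parameters of any types -/
  | ind (Γ : List Ty) (A : Fm (Ext (ctx Γ) ty0)) : A.QF → RCAAxiom
      (closure Γ (A.inst 0 ⟹
        .all ty0 (A ⟹ A.subst (Ext.cons (.var .new + 1) (fun _ v => .var (.old v)))) ⟹
        .all ty0 A))
  /-- `QF-AC^{1,0}`: `∀ x^1 ∃ y^0 A(x, y) → ∃ Y^2 ∀ x^1 A(x, Y x)` for quantifier-free `A`, with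
  parameters of any types -/
  | qfac (Γ : List Ty) (A : Fm (Ext (Ext (ctx Γ) ty1) ty0)) : A.QF → RCAAxiom
      (closure Γ ((All ty1 fun _ => Ex ty0 fun _ => A) ⟹
        Ex ty2 fun Y => All ty1 fun x =>
          A.subst (Ext.cons (Y↟ ⬝ x) (Ext.cons x (fun _ v => .var (.old (.old v)))))))

/-- The base theory `RCA₀^ω`. -/
def RCA₀ω : Set Sentence := {φ | RCAAxiom φ}

/-- The axiom `(μ²)`: there is a functional `μ` such that `μ f` is the least zero of `f` if `f` has
a zero, and `μ f = 0` otherwise. -/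
def muAxiom : Sentence :=
  Ex ty2 fun μ => All ty1 fun f =>
    ((Ex ty0 fun n => .eq (f↟ ⬝ n) 0) ⟹
      .eq (f ⬝ (μ↟ ⬝ f)) 0 ⩓ All ty0 fun i => .lt i (μ↟ ⬝ f↟) ⟹ ∼(.eq (f↟ ⬝ i) 0)) ⩓
    ((All ty0 fun n => ∼(.eq (f↟ ⬝ n) 0)) ⟹ .eq (μ↟ ⬝ f) 0)

/-- The theory `ACA₀^ω`, i.e. `RCA₀^ω + (μ²)`. -/
def ACA₀ω : Set Sentence := insert muAxiom RCA₀ω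

/-! ### Rational numbers -/

section Rationals

variable {V : Ty → Type}

/-- A triple of terms, standing for the rational number `(pos - neg) / den` (with `den > 0`). -/
structure Frac (V : Ty → Type) where
  /-- positive part of the numerator -/
  pos : Tm V ty0
  /-- negative part of the numerator -/
  neg : Tm V ty0
  /-- denominator -/
  den : Tm V ty0

/-- The numeral `2`. -/
def two : Tm V ty0 := 1 + 1

/-- The term `2 ^ n`, i.e. the iteration of `x ↦ x + x`, starting with `1`. -/
def pow2 (n : Tm V ty0) : Tm V ty0 :=
  .cst (.R ty0) ⬝
    (.cst (.P ty1 ty0) ⬝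
      (.cst (.S ty0 ty0 ty0) ⬝ .cst .add ⬝
        (.cst (.S ty0 ty1 ty0) ⬝ .cst (.P ty0 ty1) ⬝ .cst (.P ty0 ty0)))) ⬝ 1 ⬝ n

namespace Frac

/-- A natural number as a rational. -/
def ofNat (a : Tm V ty0) : Frac V := ⟨a, 0, 1⟩
/-- `2 ^ (-n)`. -/
def powNeg (n : Tm V ty0) : Frac V := ⟨1, 0, pow2 n⟩

instance : Neg (Frac V) := ⟨fun F => ⟨F.neg, F.pos, F.den⟩⟩
instance : Add (Frac V) :=
  ⟨fun F G => ⟨F.pos * G.den + G.pos * F.den, F.neg * G.den + G.neg * F.den, F.den * G.den⟩⟩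
instance : Mul (Frac V) :=
  ⟨fun F G => ⟨F.pos * G.pos + F.neg * G.neg, F.pos * G.neg + F.neg * G.pos, F.den * G.den⟩⟩

/-- `2 ^ (-n + 1)`. -/
def powNegSucc (n : Tm V ty0) : Frac V := ⟨two, 0, pow2 n⟩

/-- `F < G`. -/
def lt (F G : Frac V) : Fm V :=
  .lt (F.pos * G.den + G.neg * F.den) (G.pos * F.den + F.neg * G.den)
/-- `F ≤ G`. -/
def le (F G : Frac V) : Fm V := ∼(lt G F)
/-- `F` and `G` are the same triple. -/
def same (F G : Frac V) : Fm V := .eq F.pos G.pos ⩓ .eq F.neg G.neg ⩓ .eq F.den G.den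

/-- A triple of terms, seen in the scope of further quantifiers. -/
def up {W : Ty → Type} [Lift V W] (F : Frac V) : Frac W := ⟨F.pos↟, F.neg↟, F.den↟⟩

end Frac

/-- Universal quantification over triples of numbers. -/
def AllFrac (φ : Frac (Ext (Ext (Ext V ty0) ty0) ty0) → Fm (Ext (Ext (Ext V ty0) ty0) ty0)) :
    Fm V :=
  All ty0 fun p => All ty0 fun q => All ty0 fun d => φ ⟨p↟, q↟, d⟩

/-- Existential quantification over triples of numbers. -/
def ExFrac (φ : Frac (Ext (Ext (Ext V ty0) ty0) ty0) → Fm (Ext (Ext (Ext V ty0) ty0) ty0)) :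
    Fm V :=
  Ex ty0 fun p => Ex ty0 fun q => Ex ty0 fun d => φ ⟨p↟, q↟, d⟩

/-- The number `c` codes the rational `F`. Every number `c` is the Cantor code of a unique pair
`(n, d)`, i.e. `2 c = (n + d) (n + d + 1) + 2 d`, and codes the rational `(n / 2) / (d + 1)` if `n`
is even and `- ((n + 1) / 2) / (d + 1)` if `n` is odd. -/
def codes (c : Tm V ty0) (F : Frac V) : Fm V :=
  Ex ty0 fun n => Ex ty0 fun d =>
    .eq (two * c↟) ((n↟ + d) * (n↟ + d + 1) + two * d) ⩓
    .eq F.den↟ (d + 1) ⩓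
    ((.eq n↟ (two * F.pos↟) ⩓ .eq F.neg↟ 0) ⩔ (.eq (n↟ + 1) (two * F.neg↟) ⩓ .eq F.pos↟ 0))

end Rationals

/-! ### Real numbers -/

section Reals

variable {V : Ty → Type}

/-- `x^1` represents a real: a sequence of rationals `q` with `|q n - q (n + i)| < 2 ^ (-n)`. -/
def isReal (x : Tm V ty1) : Fm V :=
  All ty0 fun n => All ty0 fun i => AllFrac fun F => AllFrac fun G =>
    codes (x↟ ⬝ n↟) F.up ⟹ codes (x↟ ⬝ (n↟ + i↟)) G ⟹
      (F.up + -G).lt (.powNeg n↟) ⩓ (G + -F.up).lt (.powNeg n↟)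

/-- `x =_ℝ y`, i.e. `|q n - r n| ≤ 2 ^ (-n + 1)` for all `n`. -/
def realEq (x y : Tm V ty1) : Fm V :=
  All ty0 fun n => AllFrac fun F => AllFrac fun G =>
    codes (x↟ ⬝ n↟) F.up ⟹ codes (y↟ ⬝ n↟) G ⟹
      (F.up + -G).le (.powNegSucc n↟) ⩓ (G + -F.up).le (.powNegSucc n↟)

/-- `∀ x ∈ ℝ, φ`. -/
def AllReal (φ : Tm (Ext V ty1) ty1 → Fm (Ext V ty1)) : Fm V :=
  All ty1 fun x => isReal x ⟹ φ x
/-- `∃ x ∈ ℝ, φ`. -/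
def ExReal (φ : Tm (Ext V ty1) ty1 → Fm (Ext V ty1)) : Fm V :=
  Ex ty1 fun x => isReal x ⩓ φ x

/-- Polynomial expressions in reals (terms of type `1`) and natural numbers. -/
inductive RExp (V : Ty → Type) : Type
  | real : Tm V ty1 → RExp V
  | nat : Tm V ty0 → RExp V
  | add : RExp V → RExp V → RExp V
  | neg : RExp V → RExp V
  | mul : RExp V → RExp V → RExp V

namespace RExp

instance : Zero (RExp V) := ⟨.nat 0⟩
instance : One (RExp V) := ⟨.nat 1⟩
instance : Add (RExp V) := ⟨.add⟩
instance : Neg (RExp V) := ⟨.neg⟩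
instance : Sub (RExp V) := ⟨fun a b => .add a (.neg b)⟩
instance : Mul (RExp V) := ⟨.mul⟩

/-- `F` is the `n`-th rational approximation of the expression: the value of the expression if every
real in it is replaced by its `n`-th approximation. The renaming `f` carries the variables of the
expression to those of `n` and `F`. -/
def approx : RExp V → {W : Ty → Type} → (∀ σ, V σ → W σ) → Tm W ty0 → Frac W → Fm W
  | .real x, _, f, n, F => codes (x.map f ⬝ n) F
  | .nat a, _, f, _, F => F.same (.ofNat (a.map f))
  | .neg a, _, f, n, F => a.approx f n (-F)
  | .add a b, _, f, n, F => ExFrac fun G => ExFrac fun H =>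
      a.approx (fun σ v => Lift.lift σ (f σ v)) n↟ G.up ⩓
      b.approx (fun σ v => Lift.lift σ (f σ v)) n↟ H ⩓ F.up.same (G.up + H)
  | .mul a b, _, f, n, F => ExFrac fun G => ExFrac fun H =>
      a.approx (fun σ v => Lift.lift σ (f σ v)) n↟ G.up ⩓
      b.approx (fun σ v => Lift.lift σ (f σ v)) n↟ H ⩓ F.up.same (G.up * H)

/-- `a <_ℝ b`: for some `k`, eventually `a n + 2 ^ (-k) < b n` for the rational approximations
`a n` and `b n` of `a` and `b`. -/
def lt (a b : RExp V) : Fm V :=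
  Ex ty0 fun k => Ex ty0 fun m => All ty0 fun n => .le m↟ n ⟹
    AllFrac fun F => AllFrac fun G =>
      a.approx Lift.lift n↟ F.up ⟹ b.approx Lift.lift n↟ G ⟹ (F.up + .powNeg k↟).lt G

/-- `a ≤_ℝ b`. -/
def le (a b : RExp V) : Fm V := ∼(lt b a)
/-- `a =_ℝ b`. -/
def equal (a b : RExp V) : Fm V := le a b ⩓ le b a

end RExp

/-- `x ∈ I`, where `I` is the interval `[0,1]`. -/
def inI (x : Tm V ty1) : Fm V := RExp.le 0 (.real x) ⩓ (RExp.real x).le 1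

/-- `f : I → ℝ`. -/
def isFunI (f : Tm V (ty1 ⇾ ty1)) : Fm V :=
  (AllReal fun x => inI x ⟹ isReal (f↟ ⬝ x)) ⩓
  AllReal fun x => AllReal fun y => inI x↟ ⟹ inI y ⟹ realEq x↟ y ⟹ realEq (f↟ ⬝ x↟) (f↟ ⬝ y)

/-- `Ψ : I → ℝ⁺`. -/
def isPosFunI (Ψ : Tm V (ty1 ⇾ ty1)) : Fm V :=
  isFunI Ψ ⩓ AllReal fun x => inI x ⟹ RExp.lt 0 (.real (Ψ↟ ⬝ x))

/-- `δ` is a gauge, i.e. a function `δ : ℝ → ℝ⁺`. -/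
def isGauge (δ : Tm V (ty1 ⇾ ty1)) : Fm V :=
  (AllReal fun x => isReal (δ↟ ⬝ x)) ⩓
  (AllReal fun x => AllReal fun y => realEq x↟ y ⟹ realEq (δ↟ ⬝ x↟) (δ↟ ⬝ y)) ⩓
  AllReal fun x => RExp.lt 0 (.real (δ↟ ⬝ x))

/-- `f` is bounded on `I`. -/
def isBddI (f : Tm V (ty1 ⇾ ty1)) : Fm V :=
  Ex ty0 fun b => AllReal fun x => inI x ⟹
    (RExp.real (f↟ ⬝ x)).le (.nat b↟) ⩓ (-RExp.real (f↟ ⬝ x)).le (.nat b↟)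

/-- `|a - b| < e`. -/
def absSubLt (a b e : RExp V) : Fm V := (a - b).lt e ⩓ (b - a).lt e

/-! ### Weak compactness -/

/-- `z ∈ J_y = (y - Ψ y, y + Ψ y)`. -/
def inJ (Ψ : Tm V (ty1 ⇾ ty1)) (y z : Tm V ty1) : Fm V :=
  (RExp.real y - .real (Ψ ⬝ y)).lt (.real z) ⩓ (RExp.real z).lt (.real y + .real (Ψ ⬝ y))

/-- `z ∈ J_i'`, where `J_i' = J_i \ ⋃_{j < i} J_j` and `J_i = J_{y i}`. -/
def inJ' (Ψ : Tm V (ty1 ⇾ ty1)) (y : Tm V (ty0 ⇾ ty1)) (i : Tm V ty0) (z : Tm V ty1) : Fm V :=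
  inJ Ψ (y ⬝ i) z ⩓ All ty0 fun j => .lt j i↟ ⟹ ∼(inJ Ψ↟ (y↟ ⬝ j) z↟)

/-- `ℓ = |J_i'|`, the length of the finite union of intervals `J_i'`: there are points
`c 0 ≤ ⋯ ≤ c m` such that `J_i' ⊆ [c 0, c m]`, each open interval `(c j, c (j + 1))` is contained in
`J_i'` or disjoint from it, and `ℓ` is the sum of the lengths of those contained in `J_i'` (with
partial sums `s j`). -/
def isLengthJ' (Ψ : Tm V (ty1 ⇾ ty1)) (y : Tm V (ty0 ⇾ ty1)) (i : Tm V ty0) (l : Tm V ty1) :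
    Fm V :=
  Ex ty0 fun m => Ex (ty0 ⇾ ty1) fun c => Ex (ty0 ⇾ ty1) fun s =>
    (All ty0 fun j => .le j m↟ ⟹ isReal (c↟ ⬝ j) ⩓ isReal (s↟ ⬝ j)) ⩓
    (All ty0 fun j => .lt j m↟ ⟹ (RExp.real (c↟ ⬝ j)).le (.real (c↟ ⬝ (j + 1)))) ⩓
    (AllReal fun z => inJ' Ψ↟ y↟ i↟ z ⟹
      (RExp.real (c↟ ⬝ 0)).le (.real z) ⩓ (RExp.real z).le (.real (c↟ ⬝ m↟))) ⩓
    (RExp.real (s ⬝ 0)).equal 0 ⩓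
    (All ty0 fun j => .lt j m↟ ⟹
      ((AllReal fun z =>
          (RExp.real (c↟ ⬝ j↟)).lt (.real z) ⟹ (RExp.real z).lt (.real (c↟ ⬝ (j↟ + 1))) ⟹
            inJ' Ψ↟ y↟ i↟ z) ⩓
        (RExp.real (s↟ ⬝ (j + 1))).equal
          (.real (s↟ ⬝ j) + (.real (c↟ ⬝ (j + 1)) - .real (c↟ ⬝ j)))) ⩔
      ((AllReal fun z =>
          (RExp.real (c↟ ⬝ j↟)).lt (.real z) ⟹ (RExp.real z).lt (.real (c↟ ⬝ (j↟ + 1))) ⟹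
            ∼(inJ' Ψ↟ y↟ i↟ z)) ⩓
        (RExp.real (s↟ ⬝ (j + 1))).equal (.real (s↟ ⬝ j)))) ⩓
    (RExp.real l↟).equal (.real (s ⬝ m↟))

/-- `S = a 0 + ⋯ + a k` for a sequence of reals `a`, with partial sums `s i`. -/
def isSum (k : Tm V ty0) (a : Tm V (ty0 ⇾ ty1)) (S : Tm V ty1) : Fm V :=
  Ex (ty0 ⇾ ty1) fun s =>
    (All ty0 fun i => .le i (k↟ + 1) ⟹ isReal (s↟ ⬝ i)) ⩓
    (RExp.real (s ⬝ 0)).equal 0 ⩓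
    (All ty0 fun i => .le i k↟ ⟹
      (RExp.real (s↟ ⬝ (i + 1))).equal (.real (s↟ ⬝ i) + .real (a↟ ⬝ i))) ⩓
    (RExp.real S↟).equal (.real (s ⬝ (k↟ + 1)))

/-- Weak compactness without measure: for all `Ψ : I → ℝ⁺` and `ε > 0` there are `y 0, …, y n ∈ I`
with `∑ |J_i'| ≥ 1 - ε`. -/
def WHBU₀ : Sentence :=
  All (ty1 ⇾ ty1) fun Ψ => isPosFunI Ψ ⟹
    AllReal fun ε => RExp.lt 0 (.real ε) ⟹
      Ex ty0 fun n => Ex (ty0 ⇾ ty1) fun y =>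
        (All ty0 fun i => .le i n↟ ⟹ isReal (y↟ ⬝ i) ⩓ inI (y↟ ⬝ i)) ⩓
        Ex (ty0 ⇾ ty1) fun l =>
          (All ty0 fun i => .le i n↟ ⟹ isReal (l↟ ⬝ i) ⩓ isLengthJ' Ψ↟ y↟ i (l↟ ⬝ i)) ⩓
          ExReal fun S => isSum n↟ l↟ S ⩓ (1 - RExp.real ε↟).le (.real S)

/-! ### Integrals -/

/-- The tagged partition `(t_i, [x_i, x_{i+1}])_{i ≤ k}`, as a triple of terms. -/
structure TP (V : Ty → Type) where
  /-- index of the last interval -/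
  k : Tm V ty0
  /-- tags -/
  t : Tm V (ty0 ⇾ ty1)
  /-- end points -/
  x : Tm V (ty0 ⇾ ty1)

/-- A triple of terms, seen in the scope of further quantifiers. -/
def TP.up {W : Ty → Type} [Lift V W] (P : TP V) : TP W := ⟨P.k↟, P.t↟, P.x↟⟩

/-- `P` is a tagged partition of `I`: `0 = x_0 < x_1 < ⋯ < x_{k+1} = 1` and
`x_i ≤ t_i ≤ x_{i+1}` for `i ≤ k`. -/
def TP.isTP (P : TP V) : Fm V :=
  (All ty0 fun i => .le i (P.k↟ + 1) ⟹ isReal (P.x↟ ⬝ i)) ⩓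
  (RExp.real (P.x ⬝ 0)).equal 0 ⩓
  (RExp.real (P.x ⬝ (P.k + 1))).equal 1 ⩓
  (All ty0 fun i => .le i P.k↟ ⟹
    isReal (P.t↟ ⬝ i) ⩓
    (RExp.real (P.x↟ ⬝ i)).lt (.real (P.x↟ ⬝ (i + 1))) ⩓
    (RExp.real (P.x↟ ⬝ i)).le (.real (P.t↟ ⬝ i)) ⩓
    (RExp.real (P.t↟ ⬝ i)).le (.real (P.x↟ ⬝ (i + 1))))

/-- `∀ P ∈ tp, φ`. -/
def AllTP (φ : TP (Ext (Ext (Ext V ty0) (ty0 ⇾ ty1)) (ty0 ⇾ ty1)) →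
    Fm (Ext (Ext (Ext V ty0) (ty0 ⇾ ty1)) (ty0 ⇾ ty1))) : Fm V :=
  All ty0 fun k => All (ty0 ⇾ ty1) fun t => All (ty0 ⇾ ty1) fun x =>
    TP.isTP ⟨k↟, t↟, x⟩ ⟹ φ ⟨k↟, t↟, x⟩

/-- The length `|I_i|` of the `i`-th interval of `P`. -/
def TP.len (P : TP V) (i : Tm V ty0) : RExp V := .real (P.x ⬝ (i + 1)) - .real (P.x ⬝ i)

/-- `I_i ⊆ [t_i - δ(t_i), t_i + δ(t_i)]`. -/
def TP.fineAt (P : TP V) (δ : Tm V (ty1 ⇾ ty1)) (i : Tm V ty0) : Fm V :=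
  (RExp.real (P.t ⬝ i) - .real (δ ⬝ (P.t ⬝ i))).le (.real (P.x ⬝ i)) ⩓
  (RExp.real (P.x ⬝ (i + 1))).le (.real (P.t ⬝ i) + .real (δ ⬝ (P.t ⬝ i)))

/-- `S` is the sum of the lengths of those intervals `I_i` of `P` for which
`I_i ⊆ [t_i - δ(t_i), t_i + δ(t_i)]`, with partial sums `s i`. -/
def TP.isFineLength (P : TP V) (δ : Tm V (ty1 ⇾ ty1)) (S : Tm V ty1) : Fm V :=
  Ex (ty0 ⇾ ty1) fun s =>
    (All ty0 fun i => .le i (P.k↟ + 1) ⟹ isReal (s↟ ⬝ i)) ⩓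
    (RExp.real (s ⬝ 0)).equal 0 ⩓
    (All ty0 fun i => .le i P.k↟ ⟹
      (P.up.fineAt δ↟ i ⟹
        (RExp.real (s↟ ⬝ (i + 1))).equal (.real (s↟ ⬝ i) + P.up.len i)) ⩓
      (∼(P.up.fineAt δ↟ i) ⟹
        (RExp.real (s↟ ⬝ (i + 1))).equal (.real (s↟ ⬝ i)))) ⩓
    (RExp.real S↟).equal (.real (s ⬝ (P.k↟ + 1)))

/-- `P` is `ε`-`δ`-fine. -/
def TP.isFine (P : TP V) (ε : Tm V ty1) (δ : Tm V (ty1 ⇾ ty1)) : Fm V :=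
  ExReal fun S => P.up.isFineLength δ↟ S ⩓ (1 - RExp.real ε↟).le (.real S)

/-- `S` is the Riemann sum `∑_{i ≤ k} f(t_i) |I_i|`, with partial sums `s i`. -/
def TP.isRiemannSum (P : TP V) (f : Tm V (ty1 ⇾ ty1)) (S : Tm V ty1) : Fm V :=
  Ex (ty0 ⇾ ty1) fun s =>
    (All ty0 fun i => .le i (P.k↟ + 1) ⟹ isReal (s↟ ⬝ i)) ⩓
    (RExp.real (s ⬝ 0)).equal 0 ⩓
    (All ty0 fun i => .le i P.k↟ ⟹
      (RExp.real (s↟ ⬝ (i + 1))).equal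
        (.real (s↟ ⬝ i) + .real (f↟ ⬝ (P.t↟ ⬝ i)) * P.up.len i)) ⩓
    (RExp.real S↟).equal (.real (s ⬝ (P.k↟ + 1)))

/-- `|S(f, P) - A| < ε`. -/
def TP.isClose (P : TP V) (f : Tm V (ty1 ⇾ ty1)) (A ε : Tm V ty1) : Fm V :=
  ExReal fun S => P.up.isRiemannSum f↟ S ⩓ absSubLt (.real S) (.real A↟) (.real ε↟)

/-- The mesh of `P` is at most `d`. -/
def TP.meshLe (P : TP V) (d : Tm V ty1) : Fm V :=
  All ty0 fun i => .le i P.k↟ ⟹ (P.up.len i).le (.real d↟)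

/-- The function `f : I → ℝ` is Riemann integrable, with Riemann integral `A`. -/
def isRInt (f : Tm V (ty1 ⇾ ty1)) (A : Tm V ty1) : Fm V :=
  isFunI f ⩓ AllReal fun ε => RExp.lt 0 (.real ε) ⟹
    ExReal fun d => RExp.lt 0 (.real d) ⩓
      AllTP fun P => P.meshLe d↟ ⟹ P.isClose f↟ A↟ ε↟

/-- The bounded function `f : I → ℝ` is L-integrable, with L-integral `A`: for each `ε > 0` there
are `η > 0` and a gauge `δ` such that `|S(f, P) - A| < ε` for each `η`-`δ`-fine `P`. -/
def isLInt (f : Tm V (ty1 ⇾ ty1)) (A : Tm V ty1) : Fm V :=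
  isFunI f ⩓ isBddI f ⩓ AllReal fun ε => RExp.lt 0 (.real ε) ⟹
    ExReal fun η => RExp.lt 0 (.real η) ⩓
      Ex (ty1 ⇾ ty1) fun δ => isGauge δ ⩓
        AllTP fun P => P.isFine η↟ δ↟ ⟹ P.isClose f↟ A↟ ε↟

end Reals

/-- Uniqueness: if a bounded function is L-integrable on `I`, then the L-integral is unique. -/
def Uniqueness : Sentence :=
  All (ty1 ⇾ ty1) fun f => AllReal fun A => AllReal fun B =>
    isLInt f↟ A↟ ⟹ isLInt f↟ B ⟹ realEq A↟ B

/-- Consistency: if a function is Riemann integrable on `I`, then it is L-integrable there, and the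
two integrals are equal (i.e. each of its L-integrals equals its Riemann integral). -/
def Consistency : Sentence :=
  All (ty1 ⇾ ty1) fun f => AllReal fun A => isRInt f↟ A ⟹
    (ExReal fun B => isLInt f↟ B) ⩓ AllReal fun B => isLInt f↟ B ⟹ realEq B A↟

end HOA

/-! By Gödel's completeness theorem it suffices to show that in every extensional model of `ACA₀ω`
the sentence `WHBU₀` holds exactly when `Uniqueness` does, and exactly when `Consistency` does. The
completeness theorem is proved by Henkin's method (`proves_of_holds`); extensionality of the theory
makes application well defined on terms modulo provable equality.

A model may have nonstandard numbers, so analysis is redone inside it. From its numbers one builds a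
field of rationals and a field of reals, the latter from those Cauchy sequences that are objects of
the model. A map is called internal if it sends families represented by objects of the model to
families of the same kind. Combinators give closure under abstraction and application.
Quantifier-free choice gives characteristic functions, the functional `μ` gives closure under number
quantifiers, and the induction axiom becomes induction for internal predicates. With this calculus
finite sums, maxima and sorting of sequences of nonstandard length are available, and the three
sentences turn into the statements `WeakCompactness`, `UniqueIntegral` and `ConsistentIntegral`
about internal functions.

The core of the argument is that both properties of the integral amount to the existence of an
`η`-`δ`-fine partition for every gauge `δ` and every `η > 0`. If there is none for some `δ` and `η`,
then every real is vacuously an L-integral of the zero function, which violates uniqueness as well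
as consistency. If there is one for the gauge obtained from `Ψ`, its tags serve as the centres `y
i`, since the interior of a fine interval lies in the interval `J` around its tag
(`weakCompactness_of_exists_fine`).

Conversely, apply weak compactness to the minimum of `δ` and `η / 4`. Drop the intervals contained
in others, sort the remaining centres, and cut `[0,1]` at the centres and at suitable endpoints
between them, so that each cell meeting the union is covered by a `J` centred at one of its own
ends; that end becomes the tag (`exists_partition_of_chain`, `WeakCompactness.exists_fine`). All
lengths are compared by `sum_length_le`.

A partition that is fine for two gauges at once gives uniqueness. For consistency, a Riemann
integrable function is bounded, and with the constant gauge `d / 2` and `η = d` every fine partition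
has mesh at most `d` (`RInt.bddI`, `RInt.lInt`); hence the Riemann integral is an L-integral, and
uniqueness does the rest. -/

namespace HOA

/-! ### Laws of substitution and finite support of formulas. -/

section SubstitutionLemmas

variable {U V W : Ty → Type}

theorem Tm.map_eq_subst (f : ∀ σ, V σ → W σ) {σ : Ty} (t : Tm V σ) :
    t.map f = t.subst (fun σ v => .var (f σ v)) := by
  induction t with
  | var v => rfl
  | cst c => rfl
  | app s t hs ht => simp [Tm.map, Tm.subst, hs, ht]

theorem Tm.subst_subst (f : ∀ σ, U σ → Tm V σ) (g : ∀ σ, V σ → Tm W σ) {σ : Ty} (t : Tm U σ) :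
    (t.subst f).subst g = t.subst (fun σ v => (f σ v).subst g) := by
  induction t with
  | var v => rfl
  | cst c => rfl
  | app s t hs ht => simp [Tm.subst, hs, ht]

theorem Tm.subst_var {σ : Ty} (t : Tm V σ) : t.subst (fun _ => .var) = t := by
  induction t with
  | var v => rfl
  | cst c => rfl
  | app s t hs ht => simp [Tm.subst, hs, ht]

theorem Ext.lift_var_map (f : ∀ σ, V σ → W σ) {ρ : Ty} :
    Ext.lift (ρ := ρ) (fun σ v => .var (f σ v)) = fun σ v => Tm.var (Ext.map f σ v) := by
  funext σ v
  cases v <;> rfl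

theorem Ext.lift_var {ρ : Ty} :
    Ext.lift (ρ := ρ) (fun σ (v : V σ) => .var v) = fun _ v => Tm.var v := by
  funext σ v
  cases v <;> rfl

theorem Ext.lift_subst_lift (f : ∀ σ, U σ → Tm V σ) (g : ∀ σ, V σ → Tm W σ) {ρ : Ty} :
    (fun σ v => (Ext.lift (ρ := ρ) f σ v).subst (Ext.lift g)) =
      Ext.lift (fun σ v => (f σ v).subst g) := by
  funext σ v
  cases v with
  | new => rfl
  | old v => simp only [Ext.lift, Tm.map_eq_subst, Tm.subst_subst, Tm.subst]

theorem Fm.map_eq_subst {V W : Ty → Type} (f : ∀ σ, V σ → W σ) (φ : Fm V) :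
    φ.map f = φ.subst (fun σ v => .var (f σ v)) := by
  induction φ generalizing W with
  | bot => rfl
  | eq s t => simp [Fm.map, Fm.subst, Tm.map_eq_subst]
  | lt s t => simp [Fm.map, Fm.subst, Tm.map_eq_subst]
  | imp φ ψ hφ hψ => simp [Fm.map, Fm.subst, hφ, hψ]
  | all σ φ h => simp [Fm.map, Fm.subst, h, Ext.lift_var_map]

theorem Fm.subst_subst {U V W : Ty → Type} (f : ∀ σ, U σ → Tm V σ) (g : ∀ σ, V σ → Tm W σ)
    (φ : Fm U) : (φ.subst f).subst g = φ.subst (fun σ v => (f σ v).subst g) := by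
  induction φ generalizing V W with
  | bot => rfl
  | eq s t => simp [Fm.subst, Tm.subst_subst]
  | lt s t => simp [Fm.subst, Tm.subst_subst]
  | imp φ ψ hφ hψ => simp [Fm.subst, hφ, hψ]
  | all σ φ h => simp [Fm.subst, h, Ext.lift_subst_lift]

theorem Fm.subst_var {V : Ty → Type} (φ : Fm V) : φ.subst (fun _ => .var) = φ := by
  induction φ with
  | bot => rfl
  | eq s t => simp [Fm.subst, Tm.subst_var]
  | lt s t => simp [Fm.subst, Tm.subst_var]
  | imp φ ψ hφ hψ => simp [Fm.subst, hφ, hψ]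
  | all σ φ h => simp [Fm.subst, Ext.lift_var, h]

theorem Ext.lift_subst_cons (f : ∀ σ, V σ → Tm W σ) {ρ : Ty} (t : Tm W ρ) :
    (fun σ v => (Ext.lift (ρ := ρ) f σ v).subst (Ext.cons t (fun _ => .var))) = Ext.cons t f := by
  funext σ v
  cases v with
  | new => rfl
  | old v =>
    simp only [Ext.lift, Tm.map_eq_subst, Tm.subst_subst]
    exact Tm.subst_var _

theorem Fm.subst_lift_inst (f : ∀ σ, V σ → Tm W σ) {ρ : Ty} (φ : Fm (Ext V ρ)) (t : Tm W ρ) :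
    (φ.subst (Ext.lift f)).inst t = φ.subst (Ext.cons t f) := by
  rw [Fm.inst, Fm.subst_subst, Ext.lift_subst_cons]

theorem Ext.cons_subst (f : ∀ σ, V σ → Tm W σ) {ρ : Ty} (t : Tm V ρ) :
    (fun σ v => (Ext.cons t (fun _ => .var) σ v).subst f) = Ext.cons (t.subst f) f := by
  funext σ v
  cases v <;> rfl

theorem Fm.inst_subst (f : ∀ σ, V σ → Tm W σ) {ρ : Ty} (φ : Fm (Ext V ρ)) (t : Tm V ρ) :
    (φ.inst t).subst f = (φ.subst (Ext.lift f)).inst (t.subst f) := by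
  rw [Fm.subst_lift_inst, Fm.inst, Fm.subst_subst, Ext.cons_subst]

theorem Fm.map_old_subst_lift (f : ∀ σ, V σ → Tm W σ) {ρ : Ty} (φ : Fm V) :
    (φ.map (fun _ => .old)).subst (Ext.lift (ρ := ρ) f) = (φ.subst f).map (fun _ => .old) := by
  simp only [Fm.map_eq_subst, Fm.subst_subst]
  congr 1
  funext σ v
  simp [Tm.subst, Ext.lift, Tm.map_eq_subst]

/-- A formula depends on finitely many variables only. -/
theorem Tm.exists_finite_support {σ : Ty} (t : Tm V σ) : ∃ s : Set (Σ σ, V σ), s.Finite ∧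
    ∀ (W : Ty → Type) (f g : ∀ σ, V σ → Tm W σ), (∀ σ v, ⟨σ, v⟩ ∈ s → f σ v = g σ v) →
      t.subst f = t.subst g := by
  induction t with
  | var v => exact ⟨{⟨_, v⟩}, Set.finite_singleton _, fun W f g h => h _ _ rfl⟩
  | cst c => exact ⟨∅, Set.finite_empty, fun _ _ _ _ => rfl⟩
  | app s t hs ht =>
    obtain ⟨a, ha, ha'⟩ := hs
    obtain ⟨b, hb, hb'⟩ := ht
    refine ⟨a ∪ b, ha.union hb, fun W f g h => ?_⟩
    simp only [Tm.subst]
    rw [ha' W f g fun σ v hv => h σ v (.inl hv), hb' W f g fun σ v hv => h σ v (.inr hv)]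

/-- The support of `∀ x, φ` is the preimage of that of `φ` under `Ext.old`. Finite supports
guarantee fresh variables in the Henkin construction. -/
theorem Fm.exists_finite_support {V : Ty → Type} (φ : Fm V) : ∃ s : Set (Σ σ, V σ), s.Finite ∧
    ∀ (W : Ty → Type) (f g : ∀ σ, V σ → Tm W σ), (∀ σ v, ⟨σ, v⟩ ∈ s → f σ v = g σ v) →
      φ.subst f = φ.subst g := by
  induction φ with
  | bot => exact ⟨∅, Set.finite_empty, fun _ _ _ _ => rfl⟩
  | eq s t =>
    obtain ⟨a, ha, ha'⟩ := s.exists_finite_support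
    obtain ⟨b, hb, hb'⟩ := t.exists_finite_support
    refine ⟨a ∪ b, ha.union hb, fun W f g h => ?_⟩
    simp only [Fm.subst]
    rw [ha' W f g fun σ v hv => h σ v (.inl hv), hb' W f g fun σ v hv => h σ v (.inr hv)]
  | lt s t =>
    obtain ⟨a, ha, ha'⟩ := s.exists_finite_support
    obtain ⟨b, hb, hb'⟩ := t.exists_finite_support
    refine ⟨a ∪ b, ha.union hb, fun W f g h => ?_⟩
    simp only [Fm.subst]
    rw [ha' W f g fun σ v hv => h σ v (.inl hv), hb' W f g fun σ v hv => h σ v (.inr hv)]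
  | imp φ ψ hφ hψ =>
    obtain ⟨a, ha, ha'⟩ := hφ
    obtain ⟨b, hb, hb'⟩ := hψ
    refine ⟨a ∪ b, ha.union hb, fun W f g h => ?_⟩
    simp only [Fm.subst]
    rw [ha' W f g fun σ v hv => h σ v (.inl hv), hb' W f g fun σ v hv => h σ v (.inr hv)]
  | @all V ρ φ h =>
    obtain ⟨a, ha, ha'⟩ := h
    have hinj : Function.Injective
        (fun x : Σ σ, V σ => (⟨x.1, .old x.2⟩ : Σ σ, Ext V ρ σ)) := by
      rintro ⟨σ, v⟩ ⟨τ, w⟩ h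
      simp only [Sigma.mk.injEq] at h
      obtain ⟨rfl, h⟩ := h
      simpa using h
    refine ⟨_, ha.preimage hinj.injOn, fun W f g hfg => ?_⟩
    simp only [Fm.subst]
    rw [ha' _ (Ext.lift f) (Ext.lift g)]
    intro σ v hv
    cases v with
    | new => rfl
    | old v => simp only [Ext.lift]; rw [hfg σ v hv]

end SubstitutionLemmas

/-! ### Countability of the set of formulas. -/

section Countability

/-- A numerical code of a type. -/
def Ty.code : Ty → ℕ
  | .nat => 0
  | .arr σ τ => Nat.pair σ.code τ.code + 1

theorem Ty.code_injective : Function.Injective Ty.code := by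
  intro σ
  induction σ with
  | nat => intro τ h; cases τ <;> simp_all [Ty.code]
  | arr σ₁ σ₂ h₁ h₂ =>
    intro τ h
    cases τ with
    | nat => simp [Ty.code] at h
    | arr τ₁ τ₂ =>
      simp only [Ty.code, Nat.add_right_cancel_iff, Nat.pair_eq_pair] at h
      rw [h₁ h.1, h₂ h.2]

instance : Countable Ty := Ty.code_injective.countable

instance : Countable (Σ σ, Const σ) := by
  have : Function.Surjective (fun x : Fin 4 ⊕ (Ty × Ty) ⊕ (Ty × Ty × Ty) ⊕ Ty =>
      match x with
      | .inl 0 => (⟨_, .zero⟩ : Σ σ, Const σ)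
      | .inl 1 => ⟨_, .one⟩
      | .inl 2 => ⟨_, .add⟩
      | .inl 3 => ⟨_, .mul⟩
      | .inr (.inl (σ, τ)) => ⟨_, .P σ τ⟩
      | .inr (.inr (.inl (ρ, σ, τ))) => ⟨_, .S ρ σ τ⟩
      | .inr (.inr (.inr σ)) => ⟨_, .R σ⟩) := by
    rintro ⟨_, c⟩
    cases c with
    | zero => exact ⟨.inl 0, rfl⟩
    | one => exact ⟨.inl 1, rfl⟩
    | add => exact ⟨.inl 2, rfl⟩
    | mul => exact ⟨.inl 3, rfl⟩
    | P σ τ => exact ⟨.inr (.inl (σ, τ)), rfl⟩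
    | S ρ σ τ => exact ⟨.inr (.inr (.inl (ρ, σ, τ))), rfl⟩
    | R σ => exact ⟨.inr (.inr (.inr σ)), rfl⟩
  exact this.countable

variable {V : Ty → Type}

/-- A numerical code of a term, given codes of the constants and the variables. -/
def Tm.code (c : (Σ σ, Const σ) → ℕ) (e : ∀ σ, V σ → ℕ) : {σ : Ty} → Tm V σ → ℕ
  | _, .var v => Nat.pair 0 (e _ v)
  | _, .cst k => Nat.pair 1 (c ⟨_, k⟩)
  | _, .app (σ := σ) s t => Nat.pair 2 (Nat.pair σ.code (Nat.pair (s.code c e) (t.code c e)))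

theorem Tm.code_injective {c : (Σ σ, Const σ) → ℕ} (hc : Function.Injective c)
    {e : ∀ σ, V σ → ℕ} (he : ∀ σ, Function.Injective (e σ)) {σ : Ty} :
    Function.Injective (Tm.code c e (σ := σ)) := by
  intro s
  induction s with
  | var v => intro t h; cases t <;> simp_all [Tm.code]; exact he _ h
  | cst k =>
    intro t h
    cases t <;> simp_all [Tm.code]
    simpa using hc h
  | app s₁ s₂ h₁ h₂ =>
    intro t h
    cases t with
    | var v => simp [Tm.code] at h
    | cst v => simp [Tm.code] at h
    | app t₁ t₂ =>
      simp only [Tm.code, Nat.pair_eq_pair, true_and] at h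
      obtain ⟨h, h', h''⟩ := h
      obtain rfl := Ty.code_injective h
      rw [h₁ h', h₂ h'']

/-- Codes of the variables in the scope of a quantifier. -/
def Ext.code (e : ∀ σ, V σ → ℕ) {ρ : Ty} : ∀ σ, Ext V ρ σ → ℕ
  | _, .new => 0
  | _, .old v => e _ v + 1

theorem Ext.code_injective {e : ∀ σ, V σ → ℕ} (he : ∀ σ, Function.Injective (e σ)) {ρ : Ty}
    (σ : Ty) : Function.Injective (Ext.code e (ρ := ρ) σ) := by
  intro v w h
  cases v <;> cases w <;> simp_all [Ext.code]
  exact he _ h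

/-- A numerical code of a formula, given codes of the constants and the variables. -/
def Fm.code (c : (Σ σ, Const σ) → ℕ) : {V : Ty → Type} → (∀ σ, V σ → ℕ) → Fm V → ℕ
  | _, _, .bot => Nat.pair 0 0
  | _, e, .eq s t => Nat.pair 1 (Nat.pair (s.code c e) (t.code c e))
  | _, e, .lt s t => Nat.pair 2 (Nat.pair (s.code c e) (t.code c e))
  | _, e, .imp φ ψ => Nat.pair 3 (Nat.pair (φ.code c e) (ψ.code c e))
  | _, e, .all σ φ => Nat.pair 4 (Nat.pair σ.code (φ.code c (Ext.code e)))

theorem Fm.code_injective {c : (Σ σ, Const σ) → ℕ} (hc : Function.Injective c)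
    {V : Ty → Type} {e : ∀ σ, V σ → ℕ} (he : ∀ σ, Function.Injective (e σ)) :
    Function.Injective (Fm.code c e) := by
  intro φ
  induction φ with
  | bot => intro ψ h; cases ψ <;> simp_all [Fm.code]
  | eq s t =>
    intro ψ h
    cases ψ <;> simp_all [Fm.code]
    exact ⟨Tm.code_injective hc he h.1, Tm.code_injective hc he h.2⟩
  | lt s t =>
    intro ψ h
    cases ψ <;> simp_all [Fm.code]
    exact ⟨Tm.code_injective hc he h.1, Tm.code_injective hc he h.2⟩
  | imp φ₁ φ₂ h₁ h₂ =>
    intro ψ h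
    cases ψ <;> simp [Fm.code] at h
    rw [h₁ he h.1, h₂ he h.2]
  | all σ φ ih =>
    intro ψ h
    cases ψ with
    | all τ ψ =>
      simp only [Fm.code, Nat.pair_eq_pair, true_and] at h
      obtain rfl := Ty.code_injective h.1
      rw [ih (Ext.code_injective he) h.2]
    | _ => simp [Fm.code] at h

instance [∀ σ, Countable (V σ)] : Countable (Fm V) := by
  obtain ⟨c, hc⟩ := exists_injective_nat (Σ σ, Const σ)
  choose e he using fun σ => exists_injective_nat (V σ)
  exact (Fm.code_injective hc he).countable

end Countability

/-! ### Structural properties of derivations. -/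

section Derivations

theorem Prf.weaken {V : Ty → Type} {H H' : Set (Fm V)} {φ : Fm V} (h : Prf H φ) (hH : H ⊆ H') :
    Prf H' φ := by
  induction h with
  | hyp h => exact .hyp (hH h)
  | impI _ ih => exact .impI (ih (Set.insert_subset_insert hH))
  | impE _ _ h₁ h₂ => exact .impE (h₁ hH) (h₂ hH)
  | raa _ ih => exact .raa (ih (Set.insert_subset_insert hH))
  | allI _ ih => exact .allI (ih (Set.image_mono hH))
  | allE t _ ih => exact .allE t (ih hH)
  | eqRefl t => exact .eqRefl t
  | eqSubst φ _ _ h₁ h₂ => exact .eqSubst φ (h₁ hH) (h₂ hH)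

/-- Used to turn a fresh variable into a bound one (`Prf.generalize`), and to carry a contradiction
back to the empty context by substituting closed terms. -/
theorem Prf.subst {V W : Ty → Type} {H : Set (Fm V)} {φ : Fm V} (h : Prf H φ)
    (f : ∀ σ, V σ → Tm W σ) : Prf (Fm.subst f '' H) (φ.subst f) := by
  induction h generalizing W with
  | hyp h => exact .hyp ⟨_, h, rfl⟩
  | impI _ ih => refine .impI ?_; simpa only [Set.image_insert_eq] using ih f
  | impE _ _ h₁ h₂ => exact .impE (h₁ f) (h₂ f)
  | raa _ ih =>
    have := ih f
    rw [Set.image_insert_eq] at this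
    exact .raa this
  | allI _ ih =>
    refine .allI ?_
    have := ih (Ext.lift f)
    rw [Set.image_image] at this ⊢
    simpa only [Fm.map_old_subst_lift] using this
  | allE t _ ih => rw [Fm.inst_subst]; exact .allE _ (ih f)
  | eqRefl t => exact .eqRefl _
  | eqSubst φ _ _ h₁ h₂ =>
    have h₂ := h₂ f
    rw [Fm.inst_subst] at h₂ ⊢
    exact .eqSubst _ (h₁ f) h₂

/-- A derivation uses finitely many hypotheses. Hence unions of chains of consistent sets are
consistent, as Zorn's lemma requires. -/
theorem Prf.exists_finite {V : Ty → Type} {H : Set (Fm V)} {φ : Fm V} (h : Prf H φ) :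
    ∃ F ⊆ H, F.Finite ∧ Prf F φ := by
  induction h with
  | hyp h => exact ⟨{_}, Set.singleton_subset_iff.2 h, Set.finite_singleton _, .hyp rfl⟩
  | @impI _ H φ ψ _ ih =>
    obtain ⟨F, hF, hf, h⟩ := ih
    exact ⟨F \ {φ}, by simpa [Set.insert_def, Set.sdiff_subset_iff] using hF, hf.sdiff,
      .impI (h.weaken (by simp))⟩
  | impE _ _ h₁ h₂ =>
    obtain ⟨F, hF, hf, h⟩ := h₁
    obtain ⟨G, hG, hg, h'⟩ := h₂
    exact ⟨F ∪ G, Set.union_subset hF hG, hf.union hg,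
      .impE (h.weaken Set.subset_union_left) (h'.weaken Set.subset_union_right)⟩
  | @raa _ H φ _ ih =>
    obtain ⟨F, hF, hf, h⟩ := ih
    exact ⟨F \ {.imp φ .bot}, by simpa [Set.insert_def, Set.sdiff_subset_iff] using hF, hf.sdiff,
      .raa (h.weaken (by simp))⟩
  | allI _ ih =>
    obtain ⟨F, hF, hf, h⟩ := ih
    obtain ⟨G, hG, hf', rfl⟩ := Set.exists_subset_image_finite_and.1 ⟨F, hF, hf, rfl⟩
    exact ⟨G, hG, hf', .allI h⟩
  | allE t _ ih =>
    obtain ⟨F, hF, hf, h⟩ := ih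
    exact ⟨F, hF, hf, .allE t h⟩
  | eqRefl t => exact ⟨∅, Set.empty_subset _, Set.finite_empty, .eqRefl t⟩
  | eqSubst φ _ _ h₁ h₂ =>
    obtain ⟨F, hF, hf, h⟩ := h₁
    obtain ⟨G, hG, hg, h'⟩ := h₂
    exact ⟨F ∪ G, Set.union_subset hF hG, hf.union hg,
      .eqSubst φ (h.weaken Set.subset_union_left) (h'.weaken Set.subset_union_right)⟩

end Derivations

end HOA

namespace HOA

/-! ### Extensional structures and truth. -/

section Semantics

/-- Extensional structures for the language of arithmetic in all finite types, in which equality is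
interpreted by equality. -/
class Struct (T : Ty → Type) where
  /-- application -/
  app : ∀ {σ τ : Ty}, T (σ ⇾ τ) → T σ → T τ
  /-- the interpretation of the constants -/
  cst : ∀ {σ : Ty}, Const σ → T σ
  /-- the interpretation of `<` -/
  lt : T ty0 → T ty0 → Prop
  ext : ∀ {σ τ : Ty} {f g : T (σ ⇾ τ)}, (∀ x, app f x = app g x) → f = g

scoped infixl:90 " ⊡ " => Struct.app

variable {T : Ty → Type} [Struct T] {V W : Ty → Type}

/-- The value of a term. -/
def Tm.val (e : ∀ σ, V σ → T σ) : {σ : Ty} → Tm V σ → T σ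
  | _, .var v => e _ v
  | _, .cst c => Struct.cst c
  | _, .app s t => s.val e ⊡ t.val e

/-- An assignment, extended by a value for a new variable. -/
def Ext.val {T : Ty → Type} {ρ : Ty} (m : T ρ) (e : ∀ σ, V σ → T σ) : ∀ σ, Ext V ρ σ → T σ
  | _, .new => m
  | _, .old v => e _ v

/-- Truth of a formula under an assignment. -/
def Fm.Sat (T : Ty → Type) [Struct T] : {V : Ty → Type} → Fm V → (∀ σ, V σ → T σ) → Prop
  | _, .bot, _ => False
  | _, .eq s t, e => s.val e = t.val e
  | _, .lt s t, e => Struct.lt (s.val e) (t.val e)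
  | _, .imp φ ψ, e => φ.Sat T e → ψ.Sat T e
  | _, .all σ φ, e => ∀ m : T σ, φ.Sat T (Ext.val m e)

/-- Truth of a sentence. -/
def Holds (T : Ty → Type) [Struct T] (φ : Sentence) : Prop := φ.Sat T (fun _ v => v.elim)

end Semantics

/-! ### Henkin sets and their term models. -/

section Completeness

variable {V W : Ty → Type}

theorem eqAt_subst (σ : Ty) {V W : Ty → Type} (f : ∀ σ, V σ → Tm W σ) (s t : Tm V σ) :
    (eqAt σ s t).subst f = eqAt σ (s.subst f) (t.subst f) := by
  induction σ generalizing V W with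
  | nat => rfl
  | arr σ τ _ ih =>
    simp only [eqAt, All, Fm.subst, ih, Tm.subst, Ext.lift, Tm.up, Tm.map_eq_subst,
      Tm.subst_subst]
    rfl

/-- Maximal consistent sets of formulas with witnesses for all existential statements. -/
structure IsHenkin (H : Set (Fm V)) : Prop where
  closed : ∀ {φ}, Prf H φ → φ ∈ H
  bot_notMem : .bot ∉ H
  total : ∀ φ, φ ∈ H ∨ ∼φ ∈ H
  henkin : ∀ {σ} {φ : Fm (Ext V σ)}, (∀ t, φ.inst t ∈ H) → .all σ φ ∈ H

namespace IsHenkin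

variable {H : Set (Fm V)} (hH : IsHenkin H)

include hH in
theorem imp_mem {φ ψ : Fm V} : (φ ⟹ ψ) ∈ H ↔ (φ ∈ H → ψ ∈ H) := by
  refine ⟨fun h h' => hH.closed (.impE (.hyp h) (.hyp h')), fun h => ?_⟩
  rcases hH.total φ with hφ | hφ
  · exact hH.closed (.impI (.hyp (.inr (h hφ))))
  · exact hH.closed (.impI (.raa (.impE (.hyp (.inr (.inr hφ))) (.hyp (.inr (.inl rfl))))))


include hH in
theorem all_mem {σ : Ty} {φ : Fm (Ext V σ)} : .all σ φ ∈ H ↔ ∀ t, φ.inst t ∈ H :=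
  ⟨fun h t => hH.closed (.allE t (.hyp h)), hH.henkin⟩

include hH in
theorem eqAt_arr_mem {σ τ : Ty} {s t : Tm V (σ ⇾ τ)} :
    eqAt (σ ⇾ τ) s t ∈ H ↔ ∀ u, eqAt τ (s ⬝ u) (t ⬝ u) ∈ H := by
  rw [eqAt, All, hH.all_mem]
  refine forall_congr' fun u => ?_
  rw [Fm.inst, eqAt_subst]
  simp only [Tm.subst, Tm.up, Tm.map_eq_subst, Tm.subst_subst]
  change eqAt τ (s.subst (fun _ => .var) ⬝ u) (t.subst (fun _ => .var) ⬝ u) ∈ H ↔ _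
  rw [Tm.subst_var, Tm.subst_var]

include hH in
theorem eq_subst_mem {s t : Tm V ty0} (φ : Fm (Ext V ty0)) (h : .eq s t ∈ H)
    (h' : φ.inst s ∈ H) : φ.inst t ∈ H :=
  hH.closed (.eqSubst φ (.hyp h) (.hyp h'))

theorem inst_old {ρ σ : Ty} (s : Tm V σ) (t : Tm V ρ) :
    (s.map (fun _ => .old)).subst (Ext.cons t (fun _ => .var)) = s := by
  rw [Tm.map_eq_subst, Tm.subst_subst]
  exact Tm.subst_var s

include hH in
theorem eqAt_refl_mem {σ : Ty} (s : Tm V σ) : eqAt σ s s ∈ H := by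
  induction σ with
  | nat => exact hH.closed (.eqRefl s)
  | arr σ τ _ ih => exact hH.eqAt_arr_mem.2 fun u => ih _

include hH in
theorem eqAt_symm_mem {σ : Ty} {s t : Tm V σ} (h : eqAt σ s t ∈ H) : eqAt σ t s ∈ H := by
  induction σ with
  | nat =>
    have := hH.eq_subst_mem (.eq (.var .new) (s.map (fun _ => .old))) h
    simp only [Fm.inst, Fm.subst, inst_old] at this
    exact this (hH.closed (.eqRefl s))
  | arr σ τ _ ih => exact hH.eqAt_arr_mem.2 fun u => ih (hH.eqAt_arr_mem.1 h u)

include hH in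
theorem eqAt_trans_mem {σ : Ty} {s t u : Tm V σ} (h : eqAt σ s t ∈ H) (h' : eqAt σ t u ∈ H) :
    eqAt σ s u ∈ H := by
  induction σ with
  | nat =>
    have := hH.eq_subst_mem (.eq (s.map (fun _ => .old)) (.var .new)) h'
    simp only [Fm.inst, Fm.subst, inst_old] at this
    exact this h
  | arr σ τ _ ih =>
    exact hH.eqAt_arr_mem.2 fun v => ih (hH.eqAt_arr_mem.1 h v) (hH.eqAt_arr_mem.1 h' v)

include hH in
theorem lt_mem_congr {s s' t t' : Tm V ty0} (h : .eq s s' ∈ H) (h' : .eq t t' ∈ H)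
    (hst : .lt s t ∈ H) : .lt s' t' ∈ H := by
  have h₁ := hH.eq_subst_mem (.lt (.var .new) (t.map (fun _ => .old))) h
  have h₂ := hH.eq_subst_mem (.lt (s'.map (fun _ => .old)) (.var .new)) h'
  simp only [Fm.inst, Fm.subst, inst_old] at h₁ h₂
  exact h₂ (h₁ hst)

/-- Provable equality of terms. -/
def setoid (hH : IsHenkin H) (σ : Ty) : Setoid (Tm V σ) where
  r s t := eqAt σ s t ∈ H
  iseqv := ⟨hH.eqAt_refl_mem, hH.eqAt_symm_mem, hH.eqAt_trans_mem⟩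

/-- The axiom of extensionality. -/
def _root_.HOA.extAxiom (ρ τ : Ty) : Sentence :=
  All ρ fun x => All ρ fun y => All (ρ ⇾ τ) fun F =>
    eqAt ρ x↟ y↟ ⟹ eqAt τ (F ⬝ x↟) (F ⬝ y↟)

/-- The instances of a sentence in a larger context. -/
def _root_.HOA.Fm.embed (V : Ty → Type) (φ : Sentence) : Fm V := φ.subst (fun _ v => v.elim)

-- The function can be exchanged by the definition of equality at arrow types, its argument by the
-- axiom of extensionality. Application is therefore well defined on classes of terms.
include hH in
theorem app_mem_congr (hext : ∀ ρ τ, (extAxiom ρ τ).embed V ∈ H) {σ τ : Ty}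
    {s s' : Tm V (σ ⇾ τ)} {t t' : Tm V σ} (h : eqAt _ s s' ∈ H) (h' : eqAt _ t t' ∈ H) :
    eqAt _ (s ⬝ t) (s' ⬝ t') ∈ H := by
  refine hH.eqAt_trans_mem ?_ (hH.eqAt_arr_mem.1 h t')
  have := hext σ τ
  simp only [extAxiom, Fm.embed, All, Fm.subst] at this
  have := hH.all_mem.1 (hH.all_mem.1 (hH.all_mem.1 this t) t') s
  simp only [Fm.inst, Fm.subst, eqAt_subst] at this
  rw [hH.imp_mem] at this
  have e₁ : (((t.map (fun _ => .old)).map (fun _ => .old)).subst (Ext.lift (ρ := σ ⇾ τ)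
      (Ext.cons t' (fun _ => .var)))).subst (Ext.cons s (fun _ => .var)) = t := by
    simp only [Tm.map_eq_subst, Tm.subst_subst]
    exact Tm.subst_var t
  have e₂ : (t'.map (fun _ => .old)).subst (Ext.cons s (fun _ => .var)) = t' := inst_old _ _
  have e₃ := this (by convert h' using 2; exacts [e₁, e₂])
  convert e₃ using 2
  exacts [congrArg _ e₁.symm, congrArg _ e₂.symm]

/-- The carriers of the term model. -/
def Carrier (hH : IsHenkin H) (σ : Ty) : Type := Quotient (hH.setoid σ)

/-- The term model. -/
@[reducible] def termModel (hext : ∀ ρ τ, (extAxiom ρ τ).embed V ∈ H) : Struct hH.Carrier where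
  app := Quotient.map₂ (sa := hH.setoid _) (sb := hH.setoid _) (sc := hH.setoid _) .app
    fun _ _ h _ _ h' => hH.app_mem_congr hext h h'
  cst c := Quotient.mk (hH.setoid _) (.cst c)
  lt := Quotient.lift₂ (s₁ := hH.setoid _) (s₂ := hH.setoid _) (fun s t => .lt s t ∈ H)
    fun _ _ _ _ h h' => propext ⟨hH.lt_mem_congr h h',
      hH.lt_mem_congr (hH.eqAt_symm_mem h) (hH.eqAt_symm_mem h')⟩
  ext {σ τ f g} h := by
    induction f using Quotient.inductionOn with | _ s
    induction g using Quotient.inductionOn with | _ t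
    exact Quotient.sound (s := hH.setoid _)
      (hH.eqAt_arr_mem.2 fun u => Quotient.exact (s := hH.setoid _)
        (h (Quotient.mk (hH.setoid _) u)))

theorem val_termModel (hext : ∀ ρ τ, (extAxiom ρ τ).embed V ∈ H) (g : ∀ σ, W σ → Tm V σ)
    {σ : Ty} (t : Tm W σ) :
    letI := hH.termModel hext
    t.val (T := hH.Carrier) (fun σ v => Quotient.mk (hH.setoid σ) (g σ v)) =
      Quotient.mk (hH.setoid σ) (t.subst g) := by
  induction t with
  | var v => rfl
  | cst c => rfl
  | app s t hs ht => simp only [Tm.val, hs, ht]; rfl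

/-- The truth lemma. In the case of a quantifier, every element of the model is the class of a term,
so the claim is the Henkin property in the form `all_mem`. -/
theorem sat_termModel (hext : ∀ ρ τ, (extAxiom ρ τ).embed V ∈ H) {W : Ty → Type}
    (g : ∀ σ, W σ → Tm V σ) (φ : Fm W) :
    letI := hH.termModel hext
    φ.Sat hH.Carrier (fun σ v => Quotient.mk (hH.setoid σ) (g σ v)) ↔ φ.subst g ∈ H := by
  induction φ with
  | bot => exact ⟨False.elim, hH.bot_notMem⟩
  | eq s t =>
    simp only [Fm.Sat, val_termModel]
    exact ⟨fun h => Quotient.exact (s := hH.setoid _) h,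
      fun h => Quotient.sound (s := hH.setoid _) h⟩
  | lt s t =>
    simp only [Fm.Sat, val_termModel]
    rfl
  | imp φ ψ hφ hψ => simp only [Fm.Sat, Fm.subst, hH.imp_mem, hφ, hψ]
  | @all W σ φ ih =>
    have key (t : Tm V σ) : Ext.val (V := W) (T := hH.Carrier) (Quotient.mk (hH.setoid σ) t)
        (fun σ v => Quotient.mk (hH.setoid σ) (g σ v)) =
        fun τ v => Quotient.mk (hH.setoid τ) (Ext.cons t g τ v) := by
      funext τ v
      cases v <;> rfl
    simp only [Fm.Sat, Fm.subst, hH.all_mem, Fm.subst_lift_inst]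
    constructor
    · intro h t
      rw [← ih, ← key]
      exact h _
    · intro h m
      induction m using Quotient.inductionOn with | _ t
      rw [key, ih]
      exact h t

end IsHenkin

/-- The variables of the term model. -/
abbrev NatVar : Ty → Type := fun _ => ℕ

/-- There are closed terms of all types. -/
def closedTerm : (σ : Ty) → Tm (fun _ => Empty) σ
  | .nat => 0
  | .arr σ τ => .cst (.P τ σ) ⬝ closedTerm τ

/-- The variable `c` of type `σ` occurs neither in `H` nor in `ψ`, which is expressed by saying that
substitutions that differ only there have the same result. Replacing it by the new variable in the
derivation of `ψ(c)` prepares for `Prf.allI`. -/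
theorem Prf.generalize {H : Set (Fm NatVar)} {σ : Ty} {ψ : Fm (Ext NatVar σ)} {c : ℕ}
    (hψ : ∀ (W : Ty → Type) (f g : ∀ τ, Ext NatVar σ τ → Tm W τ),
      (∀ τ v, (∀ n : ℕ, (⟨τ, v⟩ : Σ τ, Ext NatVar σ τ) = ⟨τ, .old n⟩ → n < c) →
        f τ v = g τ v) → ψ.subst f = ψ.subst g)
    (hH : ∀ φ ∈ H, ∀ (W : Ty → Type) (f g : ∀ τ, ℕ → Tm W τ),
      (∀ τ (n : ℕ), ¬(τ = σ ∧ n = c) → f τ n = g τ n) →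
        φ.subst (V := NatVar) f = φ.subst (V := NatVar) g)
    (h : Prf H (ψ.inst (.var c))) : Prf H (.all σ ψ) := by
  classical
  -- The variable `c` of type `σ` becomes the new one, and all others are kept.
  let f : ∀ τ, ℕ → Tm (Ext NatVar σ) τ := fun τ n =>
    if h : τ = σ ∧ n = c then h.1 ▸ .var .new else .var (.old n)
  have h := h.subst (W := Ext NatVar σ) f
  refine .allI ?_
  have e₁ : Fm.subst (V := NatVar) f '' H = Fm.map (fun _ => .old) '' H := by
    refine Set.image_congr fun φ hφ => ?_
    rw [Fm.map_eq_subst]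
    refine hH φ hφ _ _ _ fun τ n hn => ?_
    simp only [f, dif_neg hn]
  have e₂ : (ψ.inst (.var c)).subst (V := NatVar) f = ψ := by
    rw [Fm.inst, Fm.subst_subst]
    conv_rhs => rw [← Fm.subst_var ψ]
    refine hψ _ _ _ fun τ v hv => ?_
    cases v with
    | new => simp [Ext.cons, Tm.subst, f]
    | old n =>
      have : ¬(τ = σ ∧ n = c) := fun h => (hv n rfl).ne h.2
      simp only [Ext.cons, Tm.subst, f, dif_neg this]
  rwa [e₁, e₂] at h

end Completeness
end HOA

namespace HOA

/-! ### Existence of Henkin sets, and the completeness theorem. -/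

section Completeness

instance {V : Ty → Type} [∀ σ, Countable (V σ)] {ρ σ : Ty} : Countable (Ext V ρ σ) := by
  choose e he using fun σ => exists_injective_nat (V σ)
  exact (Ext.code_injective he σ).countable

theorem Fm.embed_subst {V W : Ty → Type} (f : ∀ σ, V σ → Tm W σ) (φ : Sentence) :
    (φ.embed V).subst f = φ.embed W := by
  rw [Fm.embed, Fm.subst_subst]
  exact congrArg (fun g => φ.subst g) (by funext σ v; exact v.elim)

theorem Fm.embed_empty (φ : Sentence) : φ.embed (fun _ => Empty) = φ := by
  conv_rhs => rw [← Fm.subst_var φ]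
  exact congrArg (fun g => φ.subst g) (by funext σ v; exact v.elim)

/-- The variables of each type are numbers, so a finite support has a bound, beyond which every
variable is fresh. -/
theorem Fm.exists_bound {σ : Ty} (ψ : Fm (Ext NatVar σ)) : ∃ b : ℕ, ∀ (W : Ty → Type)
    (f g : ∀ τ, Ext NatVar σ τ → Tm W τ),
      (∀ τ v, (∀ n : ℕ, (⟨τ, v⟩ : Σ τ, Ext NatVar σ τ) = ⟨τ, .old n⟩ → n < b) →
        f τ v = g τ v) → ψ.subst f = ψ.subst g := by
  obtain ⟨s, hs, h⟩ := ψ.exists_finite_support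
  have hfin : {n : ℕ | ∃ τ, (⟨τ, .old n⟩ : Σ τ, Ext NatVar σ τ) ∈ s}.Finite := by
    refine (hs.image (fun x => match x with
      | ⟨_, .new⟩ => 0
      | ⟨_, .old n⟩ => n)).subset ?_
    rintro n ⟨τ, hn⟩
    exact ⟨_, hn, rfl⟩
  obtain ⟨b, hb⟩ := hfin.bddAbove
  refine ⟨b + 1, fun W f g hfg => h W f g fun τ v hv => hfg τ v fun n hn => ?_⟩
  rw [hn] at hv
  exact Nat.lt_succ_of_le (hb ⟨τ, hv⟩)

/-- Every consistent set of sentences is part of a maximal consistent set with witnesses. -/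
theorem exists_isHenkin {Th : Set Sentence} (hTh : ¬ Prf Th .bot) :
    ∃ H : Set (Fm NatVar), IsHenkin H ∧ ∀ φ ∈ Th, φ.embed NatVar ∈ H := by
  have : Nonempty (Σ σ, Fm (Ext NatVar σ)) := ⟨⟨ty0, .bot⟩⟩
  obtain ⟨e, he⟩ := exists_surjective_nat (Σ σ, Fm (Ext NatVar σ))
  choose b hb using fun n => (e n).2.exists_bound
  -- Strictly increasing, and at least `b m` for all `m ≤ n`: the witness `c n` is fresh for the
  -- `n`-th formula and for all earlier Henkin axioms.
  let c : ℕ → ℕ := fun n => n + ∑ m ∈ Finset.range (n + 1), b m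
  have hbc {m n : ℕ} (h : m ≤ n) : b m ≤ c n :=
    (Finset.single_le_sum (f := b) (fun _ _ => Nat.zero_le _)
      (Finset.mem_range.2 (Nat.lt_succ_of_le h))).trans (Nat.le_add_left _ _)
  have hcc {m n : ℕ} (h : m < n) : c m < c n := by
    have : ∑ k ∈ Finset.range (m + 1), b k ≤ ∑ k ∈ Finset.range (n + 1), b k :=
      Finset.sum_le_sum_of_subset (Finset.range_subset_range.2 (by omega))
    simp only [c]
    omega
  let χ : ℕ → Fm NatVar := fun n => (e n).2.inst (.var (c n)) ⟹ .all (e n).1 (e n).2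
  let H₀ : Set (Fm NatVar) := Fm.embed NatVar '' Th
  have hχ (n : ℕ) (W : Ty → Type) (f g : ∀ τ, ℕ → Tm W τ)
      (hfg : ∀ τ m, m ≤ c n → f τ m = g τ m) :
      (χ n).subst (V := NatVar) f = (χ n).subst (V := NatVar) g := by
    have h₁ : ((e n).2.inst (.var (c n))).subst (V := NatVar) f =
        ((e n).2.inst (.var (c n))).subst (V := NatVar) g := by
      simp only [Fm.inst, Fm.subst_subst]
      refine hb n _ _ _ fun τ v hv => ?_
      cases v with
      | new => exact hfg _ _ le_rfl
      | old m => exact hfg _ _ ((hv m rfl).le.trans (hbc le_rfl))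
    have h₂ : (e n).2.subst (Ext.lift (V := NatVar) f) =
        (e n).2.subst (Ext.lift (V := NatVar) g) := by
      refine hb n _ _ _ fun τ v hv => ?_
      cases v with
      | new => rfl
      | old m => simp only [Ext.lift]; rw [hfg _ _ ((hv m rfl).le.trans (hbc le_rfl))]
    simp only [χ, Fm.subst, h₁, h₂]
  -- If adding the Henkin axiom `χ n` gives a contradiction, then its negation is derivable, so `ψ(c
  -- n)` and the negation of `∀ x, ψ(x)` are; as `c n` is fresh, the former can be generalized, and
  -- a contradiction arises already without `χ n`.
  have hcon (n : ℕ) : ¬ Prf (H₀ ∪ χ '' Set.Iio n) .bot := by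
    induction n with
    | zero =>
      intro h
      -- Sentences are unchanged by substitution, so closed terms may replace all variables of the
      -- derivation.
      refine hTh ?_
      have := h.subst (W := fun _ => Empty) (fun σ _ => closedTerm σ)
      simpa [H₀, Set.image_image, Fm.embed_subst, Fm.embed_empty, Fm.subst] using this
    | succ n ih =>
      intro h
      have hn : Set.Iio (n + 1) = insert n (Set.Iio n) := by ext; simp
      rw [hn, Set.image_insert_eq, Set.union_insert] at h
      set G := H₀ ∪ χ '' Set.Iio n with hG
      have hneg : Prf G (∼(χ n)) := .impI h
      have h₁ : Prf G ((e n).2.inst (.var (c n))) := by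
        refine .raa (.impE (hneg.weaken (Set.subset_insert _ _)) (.impI (.raa ?_)))
        exact .impE (.hyp (.inr (.inr (.inl rfl)))) (.hyp (.inr (.inl rfl)))
      have h₂ : Prf G (.all (e n).1 (e n).2) := by
        refine Prf.generalize (c := c n) (fun W f g hfg => ?_) ?_ h₁
        · exact hb n W f g fun τ v hv => hfg τ v fun m hm => (hv m hm).trans_le (hbc le_rfl)
        · rintro φ (⟨φ, _, rfl⟩ | ⟨m, hm, rfl⟩) W f g hfg
          · rw [Fm.embed_subst, Fm.embed_subst]
          · refine hχ m W f g fun τ k hk => hfg τ k fun h => ?_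
            exact (hk.trans_lt (hcc hm)).ne h.2
      exact ih (.impE hneg (.impI (h₂.weaken (Set.subset_insert _ _))))
  have hcon' : ¬ Prf (H₀ ∪ Set.range χ) .bot := by
    intro h
    obtain ⟨F, hF, hfin, h⟩ := h.exists_finite
    suffices ∃ n, F ⊆ H₀ ∪ χ '' Set.Iio n from
      let ⟨n, hn⟩ := this
      hcon n (h.weaken hn)
    clear h
    induction F, hfin using Set.Finite.induction_on with
    | empty => exact ⟨0, Set.empty_subset _⟩
    | @insert φ F _ _ ih =>
      obtain ⟨n, hn⟩ := ih ((Set.subset_insert _ _).trans hF)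
      rcases hF (Set.mem_insert _ _) with h | ⟨m, rfl⟩
      · exact ⟨n, Set.insert_subset (.inl h) hn⟩
      · refine ⟨max n (m + 1), Set.insert_subset (.inr ⟨m, by simp, rfl⟩) (hn.trans ?_)⟩
        exact Set.union_subset_union_right _ (Set.image_mono (Set.Iio_subset_Iio (by simp)))
  obtain ⟨H, hH₀, hH⟩ := zorn_subset_nonempty {H : Set (Fm NatVar) | ¬ Prf H .bot} (by
    intro C hC hchain hne
    refine ⟨⋃₀ C, fun h => ?_, fun s hs => Set.subset_sUnion_of_mem hs⟩
    obtain ⟨F, hF, hfin, h⟩ := h.exists_finite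
    obtain ⟨s, hs, hFs⟩ := hchain.directedOn.exists_mem_subset_of_finite_of_subset_sUnion
      hne hfin hF
    exact hC hs (h.weaken hFs)) _ hcon'
  have hmax {φ : Fm NatVar} (h : ¬ Prf (insert φ H) .bot) : φ ∈ H :=
    hH.le_of_ge h (Set.subset_insert _ _) (Set.mem_insert _ _)
  have hclosed {φ : Fm NatVar} (h : Prf H φ) : φ ∈ H :=
    hmax fun h' => hH.prop (.impE (.impI h') h)
  refine ⟨H, ⟨hclosed, fun h => hH.prop (.hyp h), fun φ => ?_, fun {σ φ} h => ?_⟩,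
    fun φ hφ => hH₀ (.inl ⟨φ, hφ, rfl⟩)⟩
  · by_cases h : Prf (insert (∼φ) H) .bot
    · exact .inl (hclosed (.raa h))
    · exact .inr (hmax h)
  · obtain ⟨n, hn⟩ := he ⟨σ, φ⟩
    have hχn : ((e n).2.inst (.var (c n)) ⟹ .all (e n).1 (e n).2) ∈ H := hH₀ (.inr ⟨n, rfl⟩)
    generalize c n = k at hχn
    rw [hn] at hχn
    exact hclosed (.impE (.hyp hχn) (.hyp (h _)))

/-- Gödel's completeness theorem, for theories with the axiom of extensionality. -/
theorem proves_of_holds {Th : Set Sentence} (hext : ∀ ρ τ, extAxiom ρ τ ∈ Th) {φ : Sentence}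
    (h : ∀ (T : Ty → Type) [Struct T], (∀ ψ ∈ Th, Holds T ψ) → Holds T φ) : Th ⊩ φ := by
  by_contra hφ
  obtain ⟨H, hH, hTh⟩ := exists_isHenkin (Th := insert (∼φ) Th) fun h => hφ (.raa h)
  have hext' : ∀ ρ τ, (extAxiom ρ τ).embed NatVar ∈ H := fun ρ τ => hTh _ (.inr (hext ρ τ))
  let _ := hH.termModel hext'
  have key (ψ : Sentence) : Holds hH.Carrier ψ ↔ ψ.embed NatVar ∈ H := by
    rw [Fm.embed, ← hH.sat_termModel hext', Holds]
    have : (fun (σ : Ty) (v : Empty) => (v.elim : hH.Carrier σ)) =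
        fun σ v => Quotient.mk (hH.setoid σ) (v.elim : Tm NatVar σ) := by
      funext σ v
      exact v.elim
    rw [this]
  have h₁ := (key φ).1 (h hH.Carrier fun ψ hψ => (key ψ).2 (hTh _ (.inr hψ)))
  exact hH.bot_notMem (hH.closed (.impE (.hyp (hTh _ (.inl rfl))) (.hyp h₁)))

end Completeness

/-! ### Truth conditions of the abbreviations. -/

section Evaluation

variable {T : Ty → Type} [Struct T] {V W : Ty → Type}

theorem Tm.val_map (f : ∀ σ, V σ → W σ) (e : ∀ σ, W σ → T σ) {σ : Ty} (t : Tm V σ) :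
    (t.map f).val e = t.val (fun σ v => e σ (f σ v)) := by
  induction t with
  | var v => rfl
  | cst c => rfl
  | app s t hs ht => simp only [Tm.map, Tm.val, hs, ht]

@[simp] theorem Tm.val_up_refl (e : ∀ σ, V σ → T σ) {σ : Ty} (t : Tm V σ) :
    (t.up : Tm V σ).val e = t.val e :=
  Tm.val_map _ e t

@[simp] theorem Tm.val_up_step [Lift V W] {ρ : Ty} (m : T ρ) (e : ∀ σ, W σ → T σ) {σ : Ty}
    (t : Tm V σ) : (t.up : Tm (Ext W ρ) σ).val (Ext.val m e) = (t.up : Tm W σ).val e := by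
  rw [Tm.up, Tm.up, Tm.val_map, Tm.val_map]
  rfl

@[simp] theorem Tm.val_new {ρ : Ty} (m : T ρ) (e : ∀ σ, V σ → T σ) :
    (Tm.var (.new : Ext V ρ ρ)).val (Ext.val m e) = m := rfl

@[simp] theorem Tm.val_app (e : ∀ σ, V σ → T σ) {σ τ : Ty} (s : Tm V (σ ⇾ τ)) (t : Tm V σ) :
    (s ⬝ t).val e = s.val e ⊡ t.val e := rfl

@[simp] theorem Tm.val_cst (e : ∀ σ, V σ → T σ) {σ : Ty} (c : Const σ) :
    (Tm.cst c).val e = Struct.cst c := rfl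

@[simp] theorem sat_bot (e : ∀ σ, V σ → T σ) : Fm.bot.Sat T e ↔ False := Iff.rfl

@[simp] theorem sat_eq (e : ∀ σ, V σ → T σ) (s t : Tm V ty0) :
    (Fm.eq s t).Sat T e ↔ s.val e = t.val e := Iff.rfl

@[simp] theorem sat_lt (e : ∀ σ, V σ → T σ) (s t : Tm V ty0) :
    (Fm.lt s t).Sat T e ↔ Struct.lt (s.val e) (t.val e) := Iff.rfl

@[simp] theorem sat_imp (e : ∀ σ, V σ → T σ) (φ ψ : Fm V) :
    (φ ⟹ ψ).Sat T e ↔ (φ.Sat T e → ψ.Sat T e) := Iff.rfl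

@[simp] theorem sat_neg (e : ∀ σ, V σ → T σ) (φ : Fm V) : (∼φ).Sat T e ↔ ¬ φ.Sat T e := Iff.rfl

@[simp] theorem sat_and (e : ∀ σ, V σ → T σ) (φ ψ : Fm V) :
    (φ ⩓ ψ).Sat T e ↔ φ.Sat T e ∧ ψ.Sat T e := by
  simp [Fm.and]

@[simp] theorem sat_or (e : ∀ σ, V σ → T σ) (φ ψ : Fm V) :
    (φ ⩔ ψ).Sat T e ↔ φ.Sat T e ∨ ψ.Sat T e := by
  simp [Fm.or, or_iff_not_imp_left]

@[simp] theorem sat_iff (e : ∀ σ, V σ → T σ) (φ ψ : Fm V) :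
    (φ ⟺ ψ).Sat T e ↔ (φ.Sat T e ↔ ψ.Sat T e) := by
  simp [Fm.iff, iff_def]

@[simp] theorem sat_all (e : ∀ σ, V σ → T σ) {σ : Ty} (φ : Tm (Ext V σ) σ → Fm (Ext V σ)) :
    (All σ φ).Sat T e ↔ ∀ m, (φ (.var .new)).Sat T (Ext.val m e) := Iff.rfl

@[simp] theorem sat_ex (e : ∀ σ, V σ → T σ) {σ : Ty} (φ : Tm (Ext V σ) σ → Fm (Ext V σ)) :
    (Ex σ φ).Sat T e ↔ ∃ m, (φ (.var .new)).Sat T (Ext.val m e) := by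
  simp [Ex]

theorem sat_eqAt {σ : Ty} {V : Ty → Type} (e : ∀ σ, V σ → T σ) (s t : Tm V σ) :
    (eqAt σ s t).Sat T e ↔ s.val e = t.val e := by
  induction σ generalizing V with
  | nat => rfl
  | arr σ τ _ ih =>
    simp only [eqAt, sat_all, ih, Tm.val_app, Tm.val_up_step, Tm.val_up_refl, Tm.val_new]
    exact ⟨Struct.ext, fun h x => by rw [h]⟩

end Evaluation
end HOA

/-! ### Arithmetic and the calculus of internal maps in a model. -/

namespace HOA

/-- Extensional models of `ACA₀^ω`. -/
structure Model where
  /-- the carriers -/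
  T : Ty → Type
  /-- the structure -/
  str : Struct T
  holds : ∀ ψ ∈ ACA₀ω, Holds T ψ

namespace Model

instance (M : Model) : Struct M.T := M.str

/-- The numbers of a model. -/
abbrev N (M : Model) : Type := M.T ty0

variable {M : Model}

theorem holds_of_rca {ψ : Sentence} (h : RCAAxiom ψ) : Holds M.T ψ := M.holds _ (.inr h)

theorem holds_of_basic {ψ : Sentence} (h : BasicAxiom ψ) : Holds M.T ψ := holds_of_rca (.basic h)

instance : Zero M.N := ⟨Struct.cst .zero⟩
instance : One M.N := ⟨Struct.cst .one⟩
instance : Add M.N := ⟨fun x y => Struct.cst .add ⊡ x ⊡ y⟩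
instance : Mul M.N := ⟨fun x y => Struct.cst .mul ⊡ x ⊡ y⟩
instance : LT M.N := ⟨Struct.lt⟩

section
variable {V : Ty → Type} (e : ∀ σ, V σ → M.T σ)

@[simp] theorem val_zero : (0 : Tm V ty0).val e = 0 := rfl
@[simp] theorem val_one : (1 : Tm V ty0).val e = 1 := rfl
@[simp] theorem val_add (s t : Tm V ty0) : (s + t).val e = s.val e + t.val e := rfl
@[simp] theorem val_mul (s t : Tm V ty0) : (s * t).val e = s.val e * t.val e := rfl
@[simp] theorem struct_lt (x y : M.N) : Struct.lt x y ↔ x < y := Iff.rfl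

end

theorem lt_trichotomy' (x y : M.N) : x < y ∨ x = y ∨ y < x := by
  have := holds_of_basic (M := M) .lt_total
  simp [Holds] at this
  exact this x y

theorem lt_irrefl' (x : M.N) : ¬ x < x := by
  have := holds_of_basic (M := M) .lt_irrefl
  simp [Holds] at this
  exact this x

theorem lt_trans' {x y z : M.N} (h : x < y) (h' : y < z) : x < z := by
  have := holds_of_basic (M := M) .lt_trans
  simp [Holds] at this
  exact this x y z h h'

noncomputable instance : LinearOrder M.N where
  le x y := ¬ y < x
  lt x y := x < y
  le_refl := lt_irrefl'
  le_trans x y z h h' h'' := by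
    rcases lt_trichotomy' x y with h₁ | rfl | h₁
    · exact h' (lt_trans' h'' h₁)
    · exact h' h''
    · exact h h₁
  lt_iff_le_not_ge x y :=
    ⟨fun h => ⟨fun h' => lt_irrefl' _ (lt_trans' h h'), fun h' => h' h⟩, fun h => not_not.1 h.2⟩
  le_antisymm x y h h' := by
    rcases lt_trichotomy' x y with h₁ | rfl | h₁
    · exact (h' h₁).elim
    · rfl
    · exact (h h₁).elim
  le_total x y := by
    by_contra h
    push Not at h
    exact lt_irrefl' _ (lt_trans' h.1 h.2)
  toDecidableLE := Classical.decRel _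

instance : CommSemiring M.N where
  add_assoc := by
    have := holds_of_basic (M := M) .add_assoc
    simp [Holds] at this
    exact this
  add_comm := by
    have := holds_of_basic (M := M) .add_comm
    simp [Holds] at this
    exact this
  zero_add := by
    have := holds_of_basic (M := M) .add_zero
    have h := holds_of_basic (M := M) .add_comm
    simp [Holds] at this h
    intro x
    rw [h, this]
  add_zero := by
    have := holds_of_basic (M := M) .add_zero
    simp [Holds] at this
    exact this
  nsmul := nsmulRec
  mul_assoc := by
    have := holds_of_basic (M := M) .mul_assoc
    simp [Holds] at this
    exact this
  mul_comm := by
    have := holds_of_basic (M := M) .mul_comm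
    simp [Holds] at this
    exact this
  one_mul := by
    have := holds_of_basic (M := M) .mul_one
    have h := holds_of_basic (M := M) .mul_comm
    simp [Holds] at this h
    intro x
    rw [h, this]
  mul_one := by
    have := holds_of_basic (M := M) .mul_one
    simp [Holds] at this
    exact this
  zero_mul := by
    have := holds_of_basic (M := M) .mul_zero
    have h := holds_of_basic (M := M) .mul_comm
    simp [Holds] at this h
    intro x
    rw [h, this]
  mul_zero := by
    have := holds_of_basic (M := M) .mul_zero
    simp [Holds] at this
    exact this
  left_distrib := by
    have := holds_of_basic (M := M) .mul_add
    simp [Holds] at this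
    exact this
  right_distrib := by
    have := holds_of_basic (M := M) .mul_add
    have h := holds_of_basic (M := M) .mul_comm
    simp [Holds] at this h
    intro x y z
    rw [h, this, h z x, h z y]

theorem add_lt_add_right' {x y : M.N} (h : x < y) (z : M.N) : x + z < y + z := by
  have := holds_of_basic (M := M) .add_lt_add
  simp [Holds] at this
  exact this x y z h


theorem mul_lt_mul_right' {x y z : M.N} (h : x < y) (hz : 0 < z) : x * z < y * z := by
  have := holds_of_basic (M := M) .mul_lt_mul
  simp [Holds] at this
  exact this x y z hz h

theorem zero_lt_one' : (0 : M.N) < 1 := by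
  have := holds_of_basic (M := M) .zero_lt_one
  simpa [Holds] using this

theorem not_lt_zero' (x : M.N) : ¬ x < 0 := by
  have := holds_of_basic (M := M) .not_lt_zero
  simp [Holds] at this
  exact not_lt.2 (this x)

instance : IsStrictOrderedRing M.N where
  add_le_add_left x y h z := by
    rcases h.lt_or_eq with h | rfl
    · exact (add_lt_add_right' h z).le
    · exact le_rfl
  le_of_add_le_add_left x y z h := by
    by_contra h'
    have := add_lt_add_right' (not_le.1 h') x
    rw [add_comm z, add_comm y] at this
    exact this.not_ge h
  zero_le_one := zero_lt_one'.le
  exists_pair_ne := ⟨0, 1, zero_lt_one'.ne⟩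
  mul_lt_mul_of_pos_left a ha b c h := by
    rw [mul_comm a, mul_comm a]
    exact mul_lt_mul_right' h ha
  mul_lt_mul_of_pos_right a ha b c h := mul_lt_mul_right' h ha

theorem lt_add_one_iff' {x y : M.N} : x < y + 1 ↔ x ≤ y := by
  have := holds_of_basic (M := M) .lt_add_one
  simp [Holds] at this
  refine ⟨fun h => ?_, fun h => h.trans_lt (lt_add_of_pos_right _ zero_lt_one)⟩
  rcases this x y h with h | h
  · exact h.le
  · exact h.le

theorem zero_le' (x : M.N) : 0 ≤ x := not_lt.1 (not_lt_zero' x)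

/-! ### Combinators -/

theorem P_app {σ τ : Ty} (x : M.T σ) (y : M.T τ) : Struct.cst (.P σ τ) ⊡ x ⊡ y = x := by
  have := holds_of_rca (M := M) (.combP σ τ)
  simp [Holds, sat_eqAt] at this
  exact this x y

theorem S_app {ρ σ τ : Ty} (x : M.T (ρ ⇾ σ ⇾ τ)) (y : M.T (ρ ⇾ σ)) (z : M.T ρ) :
    Struct.cst (.S ρ σ τ) ⊡ x ⊡ y ⊡ z = x ⊡ z ⊡ (y ⊡ z) := by
  have := holds_of_rca (M := M) (.combS ρ σ τ)
  simp [Holds, sat_eqAt] at this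
  exact this x y z

theorem R_zero (f : M.T (ty0 ⇾ ty0 ⇾ ty0)) (m : M.N) : Struct.cst (.R ty0) ⊡ f ⊡ m ⊡ 0 = m := by
  have := holds_of_rca (M := M) .recZero
  simp [Holds] at this
  exact this f m

theorem R_succ (f : M.T (ty0 ⇾ ty0 ⇾ ty0)) (m n : M.N) :
    Struct.cst (.R ty0) ⊡ f ⊡ m ⊡ (n + 1) = f ⊡ n ⊡ (Struct.cst (.R ty0) ⊡ f ⊡ m ⊡ n) := by
  have := holds_of_rca (M := M) .recSucc
  simp [Holds] at this
  exact this f m n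

theorem exists_mu : ∃ μ : M.T ty2, ∀ f : M.T ty1,
    (∀ n, f ⊡ n = 0 → f ⊡ (μ ⊡ f) = 0 ∧ ∀ i < μ ⊡ f, f ⊡ i ≠ 0) ∧
      ((∀ n, f ⊡ n ≠ 0) → μ ⊡ f = 0) := by
  have := M.holds muAxiom (.inl rfl)
  simp [Holds, muAxiom] at this
  obtain ⟨μ, h⟩ := this
  exact ⟨μ, fun f => ⟨fun n hn => (h f).1 n hn, (h f).2⟩⟩

theorem _root_.HOA.val_subst {V W : Ty → Type} {T : Ty → Type} [Struct T]
    (f : ∀ σ, V σ → Tm W σ) (e : ∀ σ, W σ → T σ) {σ : Ty} (t : Tm V σ) :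
    (t.subst f).val e = t.val (fun σ v => (f σ v).val e) := by
  induction t with
  | var v => rfl
  | cst c => rfl
  | app s t hs ht => simp only [Tm.subst, Tm.val, hs, ht]

theorem _root_.HOA.sat_subst {V W : Ty → Type} {T : Ty → Type} [Struct T]
    (f : ∀ σ, V σ → Tm W σ) (e : ∀ σ, W σ → T σ) (φ : Fm V) :
    (φ.subst f).Sat T e ↔ φ.Sat T (fun σ v => (f σ v).val e) := by
  induction φ generalizing W with
  | bot => rfl
  | eq s t => simp only [Fm.subst, Fm.Sat, val_subst]
  | lt s t => simp only [Fm.subst, Fm.Sat, val_subst]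
  | imp φ ψ hφ hψ => simp only [Fm.subst, Fm.Sat, hφ, hψ]
  | all σ φ ih =>
    simp only [Fm.subst, Fm.Sat, ih]
    refine forall_congr' fun m => ?_
    have : (fun τ v => (Ext.lift f τ v).val (Ext.val m e)) =
        Ext.val m (fun σ v => (f σ v).val e) := by
      funext τ v
      cases v with
      | new => rfl
      | old v => simp only [Ext.lift, Tm.val_map]; rfl
    rw [this]

/-- The axiom of choice for a formula with one parameter of type `1`. -/
theorem exists_choice (A : Fm (Ext (Ext (ctx []) ty1) ty0)) (hA : A.QF)
    (h : ∀ x : M.T ty1, ∃ y : M.N, A.Sat M.T (Ext.val y (Ext.val x fun _ v => v.elim))) :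
    ∃ Y : M.T ty2, ∀ x, A.Sat M.T (Ext.val (Y ⊡ x) (Ext.val x fun _ v => v.elim)) := by
  have := holds_of_rca (M := M) (.qfac [] A hA)
  obtain ⟨Y, hY⟩ := (sat_ex _ _).1 (this fun x => (sat_ex _ _).2 (h x))
  refine ⟨Y, fun x => ?_⟩
  convert (sat_subst _ _ _).1 (hY x) using 1
  funext σ v
  cases v with
  | new => rfl
  | old v =>
    cases v with
    | new => rfl
    | old v => exact v.elim

/-- A single instance of the induction schema, with the characteristic function `F` as parameter,
covers all internal predicates. -/
theorem induction_zero (F : M.T ty1) (h₀ : F ⊡ 0 = 0) (h : ∀ n, F ⊡ n = 0 → F ⊡ (n + 1) = 0)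
    (n : M.N) : F ⊡ n = 0 := by
  have := holds_of_rca (M := M)
    (.ind [ty1] (.eq (.var (.old .new) ⬝ .var .new) 0) trivial)
  exact this F ((sat_subst _ _ _).2 h₀) (fun n hn => (sat_subst _ _ _).2 (h n hn)) n

/-! ### Internal maps -/

/-- Assignments of elements of a model to variables of given types. -/
abbrev Env (M : Model) : List Ty → Type
  | [] => Unit
  | σ :: Γ => M.T σ × Env M Γ

/-- A function of several variables that is represented by an object of the model. -/
def Rep (M : Model) : (Γ : List Ty) → {σ : Ty} → (Env M Γ → M.T σ) → Prop
  | [], _, _ => True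
  | ρ :: Γ, σ, f => ∃ F : Env M Γ → M.T (ρ ⇾ σ), Rep M Γ F ∧ ∀ p, f p = F p.2 ⊡ p.1

theorem Rep.const {Γ : List Ty} {σ : Ty} (m : M.T σ) : Rep M Γ (fun _ => m) := by
  induction Γ generalizing σ with
  | nil => trivial
  | cons ρ Γ ih => exact ⟨fun _ => Struct.cst (.P σ ρ) ⊡ m, ih _, fun p => (P_app _ _).symm⟩

/-- Combinatory completeness: `λ x, F x (G x)` is `Σ F G`, one variable at a time. -/
theorem Rep.app {Γ : List Ty} {σ τ : Ty} {f : Env M Γ → M.T (σ ⇾ τ)} {g : Env M Γ → M.T σ}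
    (hf : Rep M Γ f) (hg : Rep M Γ g) : Rep M Γ (fun p => f p ⊡ g p) := by
  induction Γ generalizing σ τ with
  | nil => trivial
  | cons ρ Γ ih =>
    obtain ⟨F, hF, hf⟩ := hf
    obtain ⟨G, hG, hg⟩ := hg
    refine ⟨fun p => Struct.cst (.S ρ σ τ) ⊡ F p ⊡ G p, ih (ih (.const _) hF) hG, fun p => ?_⟩
    rw [S_app, ← hf, ← hg]

theorem Rep.weaken {Γ : List Ty} {σ ρ : Ty} {f : Env M Γ → M.T σ} (hf : Rep M Γ f) :
    Rep M (ρ :: Γ) (fun p => f p.2) :=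
  ⟨fun p => Struct.cst (.P σ ρ) ⊡ f p, (Rep.const _).app hf, fun _ => (P_app _ _).symm⟩

theorem Rep.fst {Γ : List Ty} {ρ : Ty} : Rep M (ρ :: Γ) (fun p => p.1) :=
  ⟨fun _ => Struct.cst (.S ρ (ρ ⇾ ρ) ρ) ⊡ Struct.cst (.P ρ (ρ ⇾ ρ)) ⊡ Struct.cst (.P ρ ρ),
    .const _, fun p => by rw [S_app, P_app]⟩

/-- A type with a distinguished class of maps into it, from finite products of carriers of the
model. -/
class Dfl (M : Model) (X : Type) where
  /-- the distinguished maps -/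
  plot : (Γ : List Ty) → (Env M Γ → X) → Prop
  const : ∀ {Γ : List Ty} (x : X), plot Γ (fun _ => x)
  weaken : ∀ {Γ : List Ty} {ρ : Ty} {p : Env M Γ → X}, plot Γ p → plot (ρ :: Γ) (fun q => p q.2)

instance (σ : Ty) : Dfl M (M.T σ) := ⟨fun Γ => Rep M Γ, Rep.const, Rep.weaken⟩

instance {X Y : Type} [Dfl M X] [Dfl M Y] : Dfl M (X × Y) where
  plot Γ p := Dfl.plot (M := M) Γ (fun e => (p e).1) ∧ Dfl.plot (M := M) Γ (fun e => (p e).2)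
  const x := ⟨Dfl.const x.1, Dfl.const x.2⟩
  weaken h := ⟨Dfl.weaken h.1, Dfl.weaken h.2⟩

/-- The class of a predicate is given by the functions that vanish where the predicate is true. -/
instance : Dfl M Prop where
  plot Γ P := ∃ q : Env M Γ → M.N, Rep M Γ q ∧ ∀ e, P e ↔ q e = 0
  const P := by
    by_cases h : P
    · exact ⟨fun _ => 0, Rep.const _, fun _ => by simp [h]⟩
    · exact ⟨fun _ => 1, Rep.const _, fun _ => by simp [h]⟩
  weaken := fun ⟨q, hq, h⟩ => ⟨fun e => q e.2, hq.weaken, fun e => h e.2⟩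

variable {X Y Z : Type} [Dfl M X] [Dfl M Y] [Dfl M Z]

variable (M) in
/-- A map is internal if it respects the distinguished classes of maps. -/
@[fun_prop]
def Internal (f : X → Y) : Prop := ∀ Γ p, Dfl.plot (M := M) Γ p → Dfl.plot (M := M) Γ (fun e => f (p e))

@[fun_prop] theorem Internal.id : Internal M (fun x : X => x) := fun _ _ h => h

@[fun_prop] theorem Internal.const (y : Y) : Internal M (fun _ : X => y) :=
  fun _ _ _ => Dfl.const y

@[fun_prop] theorem Internal.comp {f : Y → Z} {g : X → Y} (hf : Internal M f)
    (hg : Internal M g) : Internal M (fun x => f (g x)) := fun Γ p h => hf Γ _ (hg Γ p h)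

@[fun_prop] theorem Internal.prodMk {f : X → Y} {g : X → Z} (hf : Internal M f)
    (hg : Internal M g) : Internal M (fun x => (f x, g x)) :=
  fun Γ p h => ⟨hf Γ p h, hg Γ p h⟩

@[fun_prop] theorem Internal.fst {f : X → Y × Z} (hf : Internal M f) :
    Internal M (fun x => (f x).1) := fun Γ p h => (hf Γ p h).1

@[fun_prop] theorem Internal.snd {f : X → Y × Z} (hf : Internal M f) :
    Internal M (fun x => (f x).2) := fun Γ p h => (hf Γ p h).2

@[fun_prop] theorem Internal.app {σ τ : Ty} {f : X → M.T (σ ⇾ τ)} {g : X → M.T σ}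
    (hf : Internal M f) (hg : Internal M g) : Internal M (fun x => f x ⊡ g x) :=
  fun Γ p h => (hf Γ p h).app (hg Γ p h)

instance (σ : Ty) : Nonempty (M.T σ) :=
  ⟨(closedTerm σ).val fun _ v => v.elim⟩

/-- The object of the model that represents a map. -/
noncomputable def lam {σ τ : Ty} (g : M.T σ → M.T τ) : M.T (σ ⇾ τ) :=
  Classical.epsilon fun F => ∀ x, F ⊡ x = g x

theorem lam_eq {σ τ : Ty} {g : M.T σ → M.T τ} {F : M.T (σ ⇾ τ)} (h : ∀ x, F ⊡ x = g x) :
    lam g = F :=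
  Struct.ext fun x => (Classical.epsilon_spec (p := fun F => ∀ x, F ⊡ x = g x) ⟨F, h⟩ x).trans
    (h x).symm

theorem lam_app {σ τ : Ty} {g : M.T σ → M.T τ} (hg : Internal M g) (x : M.T σ) :
    lam g ⊡ x = g x := by
  obtain ⟨F, -, hF⟩ := hg [σ] (fun e => e.1) Rep.fst
  rw [lam_eq (F := F ()) fun x => (hF (x, ())).symm]
  exact (hF (x, ())).symm

-- A family of functions is represented by representing its values in one more variable: `Rep` for
-- the longer context provides the object in which that variable has been abstracted.
@[fun_prop] theorem Internal.lam {σ τ : Ty} {f : X → M.T σ → M.T τ}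
    (hf : Internal M (fun p : X × M.T σ => f p.1 p.2)) : Internal M (fun x => lam (f x)) := by
  intro Γ p h
  obtain ⟨F, hF, hF'⟩ := hf (σ :: Γ) (fun e => (p e.2, e.1)) ⟨Dfl.weaken h, Rep.fst⟩
  refine (congrArg (Rep M Γ) (funext fun e => ?_)).mpr hF
  exact lam_eq fun x => (hF' (x, e)).symm

theorem Internal.right {f : X → Y → Z} (hf : Internal M (fun p : X × Y => f p.1 p.2)) (x : X) :
    Internal M (f x) := by
  have := hf.comp (Internal.prodMk (.const x) .id)
  exact this

@[fun_prop] theorem Internal.add {f g : X → M.N} (hf : Internal M f) (hg : Internal M g) :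
    Internal M (fun x => f x + g x) :=
  ((Internal.const (Struct.cst .add : M.T (ty0 ⇾ ty0 ⇾ ty0))).app hf).app hg

@[fun_prop] theorem Internal.mul {f g : X → M.N} (hf : Internal M f) (hg : Internal M g) :
    Internal M (fun x => f x * g x) :=
  ((Internal.const (Struct.cst .mul : M.T (ty0 ⇾ ty0 ⇾ ty0))).app hf).app hg

/-- Primitive recursion. -/
noncomputable def nrec (g : M.N → M.N → M.N) (m n : M.N) : M.N :=
  Struct.cst (.R ty0) ⊡ (Model.lam fun i => Model.lam fun a => g i a) ⊡ m ⊡ n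

@[fun_prop] theorem Internal.nrec {g : X → M.N → M.N → M.N} {m n : X → M.N}
    (hg : Internal M (fun p : X × M.N × M.N => g p.1 p.2.1 p.2.2)) (hm : Internal M m)
    (hn : Internal M n) : Internal M (fun x => nrec (g x) (m x) (n x)) := by
  unfold Model.nrec
  refine ((Internal.app (.const _) (.lam (.lam ?_))).app hm).app hn
  exact hg.comp (f := fun p : X × M.N × M.N => g p.1 p.2.1 p.2.2)
    (g := fun p : (X × M.N) × M.N => (p.1.1, p.1.2, p.2)) (by fun_prop)

@[simp] theorem nrec_zero (g : M.N → M.N → M.N) (m : M.N) : nrec g m 0 = m := R_zero _ _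

theorem nrec_succ {g : M.N → M.N → M.N} (hg : Internal M (fun p : M.N × M.N => g p.1 p.2))
    (m n : M.N) : nrec g m (n + 1) = g n (nrec g m n) := by
  rw [nrec, R_succ, lam_app (.lam hg), lam_app (hg.right n)]
  rfl

/-! ### Internal predicates -/

/-- Quantifier-free choice, applied to the formula that prescribes the value `0` if `A` holds and
`1` otherwise, yields a characteristic function. The choice schema has an argument of type `1`, so a
pair of numbers is passed as the first two values of a sequence. -/
theorem exists_char (R : M.N → M.N → Prop) (A : Fm (Ext (Ext (ctx []) ty1) ty0)) (hA : A.QF)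
    (h : ∀ (x : M.T ty1) (y : M.N),
      A.Sat M.T (Ext.val y (Ext.val x fun _ v => v.elim)) ↔ R (x ⊡ (0 : M.N)) (x ⊡ (1 : M.N))) :
    ∃ e : M.N → M.N → M.N, Internal M (fun p : M.N × M.N => e p.1 p.2) ∧
      ∀ x y, R x y ↔ e x y = 0 := by
  obtain ⟨Y, hY⟩ := exists_choice (M := M) (.imp A (.eq (.var .new) 0) ⩓
    .imp (.neg A) (.eq (.var .new) 1)) (by simp [Fm.QF, Fm.and, Fm.neg, hA]) (by
      intro x
      by_cases h' : R (x ⊡ (0 : M.N)) (x ⊡ (1 : M.N))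
      · exact ⟨0, (sat_and _ _ _).2 ⟨fun _ => rfl, fun h'' => (h'' ((h x _).2 h')).elim⟩⟩
      · exact ⟨1, (sat_and _ _ _).2 ⟨fun h'' => (h' ((h x _).1 h'')).elim, fun _ => rfl⟩⟩)
  -- This sequence has the value `x` at `0` and `y` at all positive arguments.
  have hint (x y : M.N) : Internal M (fun n => nrec (fun _ _ => y) x n) := by fun_prop
  refine ⟨fun x y => Y ⊡ lam (fun n => nrec (fun _ _ => y) x n), by fun_prop, fun x y => ?_⟩
  obtain ⟨h₁, h₂⟩ := (sat_and _ _ _).1 (hY (lam (fun n => nrec (fun _ _ => y) x n)))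
  rw [sat_imp, h] at h₁
  rw [sat_imp, sat_neg, h] at h₂
  rw [lam_app (hint _ _), lam_app (hint _ _), nrec_zero, ← zero_add (1 : M.N),
    nrec_succ (by fun_prop)] at h₁ h₂
  refine ⟨h₁, fun h => ?_⟩
  by_contra h'
  exact one_ne_zero ((h₂ h').symm.trans h)

theorem add_eq_zero_iff' {x y : M.N} : x + y = 0 ↔ x = 0 ∧ y = 0 :=
  add_eq_zero_iff_of_nonneg (zero_le' x) (zero_le' y)

@[fun_prop] theorem Internal.eq {f g : X → M.N} (hf : Internal M f) (hg : Internal M g) :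
    Internal M (fun x => f x = g x) := by
  obtain ⟨e, he, h⟩ := exists_char (M := M) (fun x y => x = y)
    (.eq (.var (.old .new) ⬝ 0) (.var (.old .new) ⬝ 1)) trivial fun _ _ => Iff.rfl
  intro Γ p hp
  exact ⟨_, he.comp (hf.prodMk hg) Γ p hp, fun _ => h _ _⟩

@[fun_prop] theorem Internal.lt {f g : X → M.N} (hf : Internal M f) (hg : Internal M g) :
    Internal M (fun x => f x < g x) := by
  obtain ⟨e, he, h⟩ := exists_char (M := M) (fun x y => x < y)
    (.lt (.var (.old .new) ⬝ 0) (.var (.old .new) ⬝ 1)) trivial fun _ _ => Iff.rfl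
  intro Γ p hp
  exact ⟨_, he.comp (hf.prodMk hg) Γ p hp, fun _ => h _ _⟩

-- If `q` vanishes exactly where `P` is true, then the negation of `P` is `0 < q`, and `<` has a
-- characteristic function.
@[fun_prop] theorem Internal.not {P : X → Prop} (hP : Internal M P) :
    Internal M (fun x => ¬ P x) := by
  intro Γ p hp
  obtain ⟨q, hq, h⟩ := hP Γ p hp
  obtain ⟨q', hq', h'⟩ := Internal.lt (X := M.N) (.const 0) .id Γ q hq
  exact ⟨q', hq', fun e => by simp only at h h' ⊢; rw [h, ← h', (zero_le' _).lt_iff_ne, ne_comm]⟩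

@[fun_prop] theorem Internal.and {P Q : X → Prop} (hP : Internal M P) (hQ : Internal M Q) :
    Internal M (fun x => P x ∧ Q x) := by
  intro Γ p hp
  obtain ⟨q, hq, h⟩ := hP Γ p hp
  obtain ⟨q', hq', h'⟩ := hQ Γ p hp
  exact ⟨_, Internal.add (X := M.N × M.N) (.fst .id) (.snd .id) Γ (fun e => (q e, q' e)) ⟨hq, hq'⟩,
    fun e => by simp only at h h' ⊢; rw [h, h', ← add_eq_zero_iff']⟩


@[fun_prop] theorem Internal.or {P Q : X → Prop} (hP : Internal M P) (hQ : Internal M Q) :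
    Internal M (fun x => P x ∨ Q x) := by
  simp only [or_iff_not_and_not]
  fun_prop

@[fun_prop] theorem Internal.imp {P Q : X → Prop} (hP : Internal M P) (hQ : Internal M Q) :
    Internal M (fun x => P x → Q x) := by
  simp only [imp_iff_not_or]
  fun_prop

-- Here `μ` eliminates a number quantifier: `F` has a zero if and only if `F (μ F) = 0`. All
-- arithmetical predicates thereby become internal, and subject to induction.
@[fun_prop] theorem Internal.exists {P : X → M.N → Prop}
    (hP : Internal M (fun p : X × M.N => P p.1 p.2)) : Internal M (fun x => ∃ n, P x n) := by
  obtain ⟨μ, hμ⟩ := exists_mu (M := M)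
  intro Γ p hp
  obtain ⟨q, ⟨F, hF, hF'⟩, h⟩ := hP (ty0 :: Γ) (fun e => (p e.2, e.1)) ⟨Dfl.weaken hp, Rep.fst⟩
  refine ⟨fun e => F e ⊡ (μ ⊡ F e), hF.app ((Rep.const μ).app hF), fun e => ?_⟩
  have h (n : M.N) : P (p e) n ↔ F e ⊡ n = 0 := by rw [← hF' (n, e), ← h]
  simp only [h]
  exact ⟨fun ⟨n, hn⟩ => ((hμ _).1 n hn).1, fun h => ⟨_, h⟩⟩

@[fun_prop] theorem Internal.forall {P : X → M.N → Prop}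
    (hP : Internal M (fun p : X × M.N => P p.1 p.2)) : Internal M (fun x => ∀ n, P x n) := by
  have := (Internal.exists (P := fun x n => ¬ P x n) hP.not).not
  simpa only [not_exists, not_not] using this

@[fun_prop] theorem Internal.le {f g : X → M.N} (hf : Internal M f) (hg : Internal M g) :
    Internal M (fun x => f x ≤ g x) := by
  simp only [← not_lt]
  fun_prop

open Classical in
/-- The least number with a given property, or `0`. -/
noncomputable def least (P : M.N → Prop) : M.N :=
  if h : ∃ n, P n ∧ ∀ i < n, ¬ P i then h.choose else 0

theorem least_eq {P : M.N → Prop} {n : M.N} (hn : P n) (h : ∀ i < n, ¬ P i) : least P = n := by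
  have h' : ∃ n, P n ∧ ∀ i < n, ¬ P i := ⟨n, hn, h⟩
  rw [least, dif_pos h']
  exact le_antisymm (not_lt.1 fun h'' => h'.choose_spec.2 _ h'' hn)
    (not_lt.1 fun h'' => h _ h'' h'.choose_spec.1)

theorem least_spec {P : M.N → Prop} (hP : Internal M P) (h : ∃ n, P n) :
    P (least P) ∧ ∀ i < least P, ¬ P i := by
  obtain ⟨μ, hμ⟩ := exists_mu (M := M)
  obtain ⟨q, ⟨F, hF, hF'⟩, hq⟩ := hP [ty0] (fun e => e.1) Rep.fst
  have hq (n : M.N) : P n ↔ F () ⊡ n = 0 := by rw [← hF' (n, ()), ← hq]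
  obtain ⟨n, hn⟩ := h
  have := (hμ (F ())).1 n ((hq n).1 hn)
  have h' : P (μ ⊡ F ()) ∧ ∀ i < μ ⊡ F (), ¬ P i := by simpa only [hq] using this
  rwa [least_eq h'.1 h'.2]

@[fun_prop] theorem Internal.least {P : X → M.N → Prop}
    (hP : Internal M (fun p : X × M.N => P p.1 p.2)) : Internal M (fun x => least (P x)) := by
  obtain ⟨μ, hμ⟩ := exists_mu (M := M)
  intro Γ p hp
  obtain ⟨q, ⟨F, hF, hF'⟩, h⟩ := hP (ty0 :: Γ) (fun e => (p e.2, e.1)) ⟨Dfl.weaken hp, Rep.fst⟩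
  have : (fun e => Model.least (P (p e))) = fun e => μ ⊡ F e := by
    funext e
    have h (n : M.N) : P (p e) n ↔ F e ⊡ n = 0 := by rw [← hF' (n, e), ← h]
    by_cases h' : ∃ n, P (p e) n
    · obtain ⟨n, hn⟩ := h'
      have := (hμ (F e)).1 n ((h n).1 hn)
      exact least_eq ((h _).2 this.1) fun i hi => by rw [h]; exact this.2 i hi
    -- If no number has the property, `μ` and `least` share the default value `0`.
    · rw [(hμ (F e)).2 fun n hn => h' ⟨n, (h n).2 hn⟩, Model.least, dif_neg]
      exact fun ⟨n, hn, _⟩ => h' ⟨n, hn⟩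
  exact (congrArg (Rep M Γ) this).mpr ((Rep.const μ).app hF)

/-- Functions with an internal graph are internal. -/
theorem Internal.of_graph {f : X → M.N} (hf : Internal M (fun p : X × M.N => p.2 = f p.1)) :
    Internal M f := by
  have : f = fun x => Model.least fun n => n = f x := by
    funext x
    exact (least_eq (P := fun n => n = f x) rfl fun i hi => hi.ne).symm
  rw [this]
  exact Internal.least (P := fun x n => n = f x) hf

/-- The principle of induction for internal predicates. -/
theorem induction {P : M.N → Prop} (hP : Internal M P) (h₀ : P 0) (h : ∀ n, P n → P (n + 1))
    (n : M.N) : P n := by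
  obtain ⟨q, ⟨F, hF, hF'⟩, hq⟩ := hP [ty0] (fun e => e.1) Rep.fst
  have hq (n : M.N) : P n ↔ F () ⊡ n = 0 := by rw [← hF' (n, ()), ← hq]
  simp only [hq] at *
  exact induction_zero _ h₀ h n

/-- Differences are not provided by the semiring axioms; they are obtained by induction. -/
theorem exists_add_of_le' {x y : M.N} (h : x ≤ y) : ∃ z, y = x + z := by
  revert h
  refine induction (P := fun y => x ≤ y → ∃ z, y = x + z) (by fun_prop) (fun h => ?_)
    (fun n ih h => ?_) y
  · exact ⟨0, by rw [add_zero]; exact le_antisymm (zero_le' _) h⟩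
  · rcases h.lt_or_eq with h | rfl
    · obtain ⟨z, hz⟩ := ih (lt_add_one_iff'.1 h)
      exact ⟨z + 1, by rw [hz, add_assoc]⟩
    · exact ⟨0, by rw [add_zero]⟩

instance : CanonicallyOrderedAdd M.N where
  exists_add_of_le h := exists_add_of_le' h
  le_add_self _ b := le_add_of_nonneg_left (zero_le' b)
  le_self_add _ b := le_add_of_nonneg_right (zero_le' b)

noncomputable instance : SuccOrder M.N :=
  SuccOrder.ofSuccLeIff (fun n => n + 1) fun {a b} => by
    rw [← not_lt, lt_add_one_iff', not_le]

noncomputable instance : SuccAddOrder M.N := ⟨fun _ => rfl⟩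

theorem eq_zero_or_eq_add_one (x : M.N) : x = 0 ∨ ∃ y, x = y + 1 := by
  rcases eq_or_ne x 0 with h | h
  · exact .inl h
  · obtain ⟨z, hz⟩ := exists_add_of_le' (Order.add_one_le_iff.2 (pos_iff_ne_zero.2 h))
    exact .inr ⟨z, by rw [hz, zero_add, add_comm]⟩

end Model
end HOA

namespace HOA

/-! ### The ordered field of fractions of an ordered semiring -/

section FractionField

set_option linter.unusedSectionVars false

variable (A : Type) [CommSemiring A] [LinearOrder A] [IsStrictOrderedRing A]
  [CanonicallyOrderedAdd A]

/-- Pairs with the same difference. -/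
def diffSetoid : Setoid (A × A) where
  r a b := a.1 + b.2 = b.1 + a.2
  iseqv := ⟨fun _ => rfl, fun h => h.symm, fun {a b c} h h' => by grind⟩

/-- The ring of differences. -/
def DiffRing : Type := Quotient (diffSetoid A)

variable {A}

namespace DiffRing

/-- The difference `a - b`. -/
def mk (a b : A) : DiffRing A := Quotient.mk (diffSetoid A) (a, b)

theorem mk_eq {a b c d : A} : mk a b = mk c d ↔ a + d = c + b :=
  ⟨fun h => Quotient.exact (s := diffSetoid A) h, fun h => Quotient.sound (s := diffSetoid A) h⟩

theorem ind {P : DiffRing A → Prop} (h : ∀ a b, P (mk a b)) (x : DiffRing A) : P x :=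
  Quotient.inductionOn x fun p => h p.1 p.2

instance : Zero (DiffRing A) := ⟨mk 0 0⟩
instance : One (DiffRing A) := ⟨mk 1 0⟩
instance : Neg (DiffRing A) :=
  ⟨Quotient.map (sa := diffSetoid A) (sb := diffSetoid A) (fun p => (p.2, p.1)) fun a b h => by
    change a.1 + b.2 = b.1 + a.2 at h
    change a.2 + b.1 = b.2 + a.1
    grind⟩
instance : Add (DiffRing A) :=
  ⟨Quotient.map₂ (sa := diffSetoid A) (sb := diffSetoid A) (sc := diffSetoid A)
    (fun p q => (p.1 + q.1, p.2 + q.2)) fun a b h c d h' => by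
      change a.1 + b.2 = b.1 + a.2 at h
      change c.1 + d.2 = d.1 + c.2 at h'
      change a.1 + c.1 + (b.2 + d.2) = b.1 + d.1 + (a.2 + c.2)
      grind⟩
instance : Mul (DiffRing A) :=
  ⟨Quotient.map₂ (sa := diffSetoid A) (sb := diffSetoid A) (sc := diffSetoid A)
    (fun p q => (p.1 * q.1 + p.2 * q.2, p.1 * q.2 + p.2 * q.1)) fun a b h c d h' => by
      change a.1 + b.2 = b.1 + a.2 at h
      change c.1 + d.2 = d.1 + c.2 at h'
      change a.1 * c.1 + a.2 * c.2 + (b.1 * d.2 + b.2 * d.1) =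
        b.1 * d.1 + b.2 * d.2 + (a.1 * c.2 + a.2 * c.1)
      grind⟩

theorem add_mk (a b c d : A) : mk a b + mk c d = mk (a + c) (b + d) := rfl
theorem mul_mk (a b c d : A) : mk a b * mk c d = mk (a * c + b * d) (a * d + b * c) := rfl
theorem neg_mk (a b : A) : -mk a b = mk b a := rfl
theorem zero_def : (0 : DiffRing A) = mk 0 0 := rfl
theorem one_def : (1 : DiffRing A) = mk 1 0 := rfl

instance : CommRing (DiffRing A) where
  add_assoc x y z := by
    induction x using ind; induction y using ind; induction z using ind
    simp only [add_mk, mk_eq]; ring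
  zero_add x := by induction x using ind; simp only [zero_def, add_mk, mk_eq]; ring
  add_zero x := by induction x using ind; simp only [zero_def, add_mk, mk_eq]; ring
  add_comm x y := by
    induction x using ind; induction y using ind
    simp only [add_mk, mk_eq]; ring
  nsmul := nsmulRec
  zsmul := zsmulRec
  neg_add_cancel x := by induction x using ind; simp only [neg_mk, zero_def, add_mk, mk_eq]; ring
  mul_assoc x y z := by
    induction x using ind; induction y using ind; induction z using ind
    simp only [mul_mk, mk_eq]; ring
  left_distrib x y z := by
    induction x using ind; induction y using ind; induction z using ind
    simp only [mul_mk, add_mk, mk_eq]; ring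
  right_distrib x y z := by
    induction x using ind; induction y using ind; induction z using ind
    simp only [mul_mk, add_mk, mk_eq]; ring
  mul_comm x y := by
    induction x using ind; induction y using ind
    simp only [mul_mk, mk_eq]; ring
  zero_mul x := by induction x using ind; simp only [zero_def, mul_mk, mk_eq]; ring
  mul_zero x := by induction x using ind; simp only [zero_def, mul_mk, mk_eq]; ring
  one_mul x := by induction x using ind; simp only [one_def, mul_mk, mk_eq]; ring
  mul_one x := by induction x using ind; simp only [one_def, mul_mk, mk_eq]; ring

/-- The embedding of the semiring. -/
def of : A →+* DiffRing A where
  toFun a := mk a 0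
  map_zero' := rfl
  map_one' := rfl
  map_add' a b := by rw [add_mk, add_zero]
  map_mul' a b := by rw [mul_mk]; simp

theorem of_injective : Function.Injective (of (A := A)) := by
  intro a b h
  simpa [of, mk_eq] using h

/-- Reduces the absence of zero divisors to the semiring, and gives every fraction a sign in
`FracField.exists_eq`. -/
theorem eq_of_or_eq_neg_of (x : DiffRing A) : ∃ a, x = of a ∨ x = -of a := by
  induction x using ind with | _ a b
  rcases le_total a b with h | h
  · obtain ⟨c, rfl⟩ := exists_add_of_le h
    exact ⟨c, .inr (by simp [of, neg_mk, mk_eq, add_comm])⟩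
  · obtain ⟨c, rfl⟩ := exists_add_of_le h
    exact ⟨c, .inl (by simp [of, mk_eq, add_comm])⟩

theorem of_eq_zero {a : A} : of a = 0 ↔ a = 0 := by
  rw [← map_zero of, of_injective.eq_iff]

instance : IsDomain (DiffRing A) := by
  have : Nontrivial (DiffRing A) :=
    ⟨0, 1, fun h => zero_ne_one (of_injective (a₁ := (0 : A)) (a₂ := 1) (by simpa using h))⟩
  have : NoZeroDivisors (DiffRing A) := ⟨fun {x y} h => by
    obtain ⟨a, ha⟩ := eq_of_or_eq_neg_of x
    obtain ⟨b, hb⟩ := eq_of_or_eq_neg_of y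
    have : of (a * b) = 0 := by
      rw [map_mul]
      rcases ha with rfl | rfl <;> rcases hb with rfl | rfl <;> simpa using h
    rw [of_eq_zero, mul_eq_zero] at this
    rcases this with rfl | rfl
    · exact .inl (by simpa using ha)
    · exact .inr (by simpa using hb)⟩
  exact NoZeroDivisors.to_isDomain _

end DiffRing

variable (A) in
/-- The field of fractions. -/
def FracField : Type := FractionRing (DiffRing A)

namespace FracField

noncomputable instance : Field (FracField A) := inferInstanceAs (Field (FractionRing _))

/-- The embedding of the ring of differences. -/
noncomputable def ofDiff : DiffRing A →+* FracField A :=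
  algebraMap (DiffRing A) (FractionRing (DiffRing A))

/-- The embedding of the semiring. -/
noncomputable def of : A →+* FracField A := ofDiff.comp DiffRing.of

theorem of_injective : Function.Injective (of (A := A)) :=
  (IsFractionRing.injective (DiffRing A) (FractionRing (DiffRing A))).comp DiffRing.of_injective

theorem of_eq_zero {a : A} : of a = 0 ↔ a = 0 := by
  rw [← map_zero of, of_injective.eq_iff]

theorem exists_eq (x : FracField A) : ∃ a b : A, b ≠ 0 ∧ (x = of a / of b ∨ x = -(of a / of b)) := by
  obtain ⟨y, z, hz, h⟩ : ∃ y z, z ∈ nonZeroDivisors (DiffRing A) ∧ ofDiff y / ofDiff z = x :=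
    IsFractionRing.div_surjective (A := DiffRing A) (K := FractionRing (DiffRing A)) x
  obtain ⟨a, ha⟩ := y.eq_of_or_eq_neg_of
  obtain ⟨b, hb⟩ := z.eq_of_or_eq_neg_of
  have hz : z ≠ 0 := nonZeroDivisors.ne_zero hz
  refine ⟨a, b, ?_, ?_⟩
  · rintro rfl
    simp at hb
    exact hz hb
  · subst h
    rcases ha with rfl | rfl <;> rcases hb with rfl | rfl <;>
      simp [of, neg_div, div_neg]

variable (A) in
/-- The fractions of elements of the semiring. -/
noncomputable def cone : RingCone (FracField A) where
  carrier := {x | ∃ a b : A, b ≠ 0 ∧ x * of b = of a}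
  mul_mem' := by
    rintro x y ⟨a, b, hb, h⟩ ⟨c, d, hd, h'⟩
    exact ⟨a * c, b * d, mul_ne_zero hb hd, by rw [map_mul, map_mul, ← h, ← h']; ring⟩
  one_mem' := ⟨1, 1, one_ne_zero, by simp⟩
  add_mem' := by
    rintro x y ⟨a, b, hb, h⟩ ⟨c, d, hd, h'⟩
    exact ⟨a * d + c * b, b * d, mul_ne_zero hb hd,
      by rw [map_add, map_mul, map_mul, map_mul, ← h, ← h']; ring⟩
  zero_mem' := ⟨0, 1, one_ne_zero, by simp⟩
  eq_zero_of_mem_of_neg_mem' := by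
    rintro x ⟨a, b, hb, h⟩ ⟨c, d, hd, h'⟩
    -- If `x = a / b` and `-x = c / d`, then `a d + c b = 0`; both summands vanish, because the
    -- semiring is canonically ordered.
    have : of (a * d + c * b) = 0 := by
      rw [map_add, map_mul, map_mul, ← h, ← h']; ring
    rw [of_eq_zero, add_eq_zero, mul_eq_zero] at this
    obtain rfl : a = 0 := this.1.resolve_right hd
    rw [map_zero, mul_eq_zero] at h
    exact h.resolve_right (of_eq_zero.not.2 hb)

instance : HasMemOrNegMem (cone A) where
  mem_or_neg_mem x := by
    obtain ⟨a, b, hb, h⟩ := exists_eq x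
    have := of_eq_zero.not.2 hb
    rcases h with rfl | rfl
    · exact .inl ⟨a, b, hb, by field_simp⟩
    · exact .inr ⟨a, b, hb, by field_simp⟩

variable (A) in
/-- The order of the field of fractions. -/
protected noncomputable def linearOrder : LinearOrder (FracField A) :=
  letI : DecidablePred (· ∈ cone A) := Classical.decPred _
  LinearOrder.mkOfAddGroupCone (cone A)

noncomputable instance : LinearOrder (FracField A) := FracField.linearOrder A

instance : IsStrictOrderedRing (FracField A) :=
  haveI : IsOrderedRing (FracField A) := .mkOfCone (cone A)
  IsOrderedRing.toIsStrictOrderedRing _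

instance : IsOrderedRing (FracField A) := inferInstance
instance : IsOrderedAddMonoid (FracField A) := inferInstance
instance : AddLeftMono (FracField A) := inferInstance
instance : AddRightMono (FracField A) := inferInstance
instance : AddLeftStrictMono (FracField A) := inferInstance
instance : AddRightStrictMono (FracField A) := inferInstance
instance : AddLeftReflectLT (FracField A) := inferInstance
instance : AddRightReflectLT (FracField A) := inferInstance
instance : AddRightReflectLE (FracField A) := inferInstance
instance : PosMulMono (FracField A) := inferInstance
instance : MulPosMono (FracField A) := inferInstance
instance : PosMulStrictMono (FracField A) := inferInstance
instance : MulPosStrictMono (FracField A) := inferInstance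
instance : PosMulReflectLT (FracField A) := inferInstance
instance : MulPosReflectLT (FracField A) := inferInstance
instance : ZeroLEOneClass (FracField A) := inferInstance
instance : CharZero (FracField A) := inferInstance
instance : NoZeroDivisors (FracField A) := inferInstance

theorem of_nonneg (a : A) : 0 ≤ of a := by
  change of a - 0 ∈ cone A
  exact ⟨a, 1, one_ne_zero, by simp⟩

theorem of_strictMono : StrictMono (of (A := A)) := by
  intro a b h
  obtain ⟨c, rfl⟩ := exists_add_of_le h.le
  have hc : c ≠ 0 := by
    rintro rfl
    simp at h
  rw [map_add]
  exact lt_add_of_pos_right _ ((of_nonneg c).lt_of_ne' (of_eq_zero.not.2 hc))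

end FracField
end FractionField
end HOA

namespace HOA
namespace Model

variable {M : Model} {X Y Z : Type} [Dfl M X] [Dfl M Y] [Dfl M Z]

/-! ### Codes of rational numbers -/

/-- The rational numbers of a model. -/
abbrev Q (M : Model) : Type := FracField M.N

/-- The number `c` codes the triple `(p, q, d)`. -/
def Codes (c p q d : M.N) : Prop := ∃ n e, 2 * c = (n + e) * (n + e + 1) + 2 * e ∧ d = e + 1 ∧
  ((n = 2 * p ∧ q = 0) ∨ (n + 1 = 2 * q ∧ p = 0))

theorem two_mul_cancel' {x y : M.N} (h : 2 * x = 2 * y) : x = y :=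
  mul_left_cancel₀ two_ne_zero h

theorem two_mul_ne_two_mul_add_one (x y : M.N) : 2 * x ≠ 2 * y + 1 := by
  intro h
  rcases le_or_gt x y with h' | h'
  · have : 2 * x ≤ 2 * y := by gcongr
    exact (h ▸ this).not_gt (lt_add_one _)
  · have : 2 * (y + 1) ≤ 2 * x := by
      have := Order.add_one_le_iff.2 h'
      gcongr
    rw [h, mul_add, mul_one] at this
    have h1 : 2 * y + 1 < 2 * y + 2 := by
      have : (1 : M.N) < 2 := one_lt_two
      gcongr
    exact this.not_gt h1

/-- Walk along the diagonals: `(n + 1, e)` is followed by `(n, e + 1)`, and `(0, e)` by `(e + 1,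
0)`. -/
theorem exists_pair (c : M.N) : ∃ n e : M.N, 2 * c = (n + e) * (n + e + 1) + 2 * e := by
  refine induction (P := fun c => ∃ n e : M.N, 2 * c = (n + e) * (n + e + 1) + 2 * e)
    (by fun_prop) ⟨0, 0, by simp⟩ ?_ c
  rintro c ⟨n, e, h⟩
  rcases eq_zero_or_eq_add_one n with rfl | ⟨n, rfl⟩
  · exact ⟨e + 1, 0, by rw [mul_add, h]; ring⟩
  · exact ⟨n, e + 1, by rw [mul_add, h]; ring⟩

/-- Codes on the diagonal `s` stay below the first code of the next diagonal, which is why the sum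
of a pair can be read off its code. -/
theorem pair_lt {s e s' e' : M.N} (he : e ≤ s) (h : s < s') :
    s * (s + 1) + 2 * e < s' * (s' + 1) + 2 * e' := by
  have h₁ := Order.add_one_le_iff.2 h
  calc s * (s + 1) + 2 * e ≤ s * (s + 1) + 2 * s := by gcongr
    _ < s * (s + 1) + 2 * s + 2 := lt_add_of_pos_right _ two_pos
    _ = (s + 1) * (s + 1 + 1) := by ring
    _ ≤ s' * (s' + 1) := by gcongr
    _ ≤ _ := le_self_add

theorem pair_unique {n e n' e' : M.N}
    (h : (n + e) * (n + e + 1) + 2 * e = (n' + e') * (n' + e' + 1) + 2 * e') :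
    n = n' ∧ e = e' := by
  have hs : n + e = n' + e' := by
    rcases lt_trichotomy (n + e) (n' + e') with h' | h' | h'
    · exact ((pair_lt le_add_self h').ne h).elim
    · exact h'
    · exact ((pair_lt le_add_self h').ne' h).elim
  rw [hs] at h
  obtain rfl := two_mul_cancel' (add_left_cancel h)
  exact ⟨add_right_cancel hs, rfl⟩

theorem even_or_odd' (n : M.N) : (∃ p, n = 2 * p) ∨ ∃ q, n + 1 = 2 * q := by
  refine induction (P := fun n => (∃ p, n = 2 * p) ∨ ∃ q, n + 1 = 2 * q) (by fun_prop)
    (.inl ⟨0, by simp⟩) ?_ n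
  rintro n (⟨p, rfl⟩ | ⟨q, h⟩)
  · exact .inr ⟨p + 1, by ring⟩
  · exact .inl ⟨q, h⟩

theorem exists_codes (c : M.N) : ∃ p q d, Codes c p q d := by
  obtain ⟨n, e, h⟩ := exists_pair c
  rcases even_or_odd' n with ⟨p, hp⟩ | ⟨q, hq⟩
  · exact ⟨p, 0, e + 1, n, e, h, rfl, .inl ⟨hp, rfl⟩⟩
  · exact ⟨0, q, e + 1, n, e, h, rfl, .inr ⟨hq, rfl⟩⟩

theorem Codes.unique {c p q d p' q' d' : M.N} (h : Codes c p q d) (h' : Codes c p' q' d') :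
    p = p' ∧ q = q' ∧ d = d' := by
  obtain ⟨n, e, h₁, rfl, h₂⟩ := h
  obtain ⟨n', e', h₁', rfl, h₂'⟩ := h'
  obtain ⟨rfl, rfl⟩ := pair_unique (h₁.symm.trans h₁')
  rcases h₂ with ⟨h₂, rfl⟩ | ⟨h₂, rfl⟩ <;> rcases h₂' with ⟨h₂', rfl⟩ | ⟨h₂', rfl⟩
  · exact ⟨two_mul_cancel' (h₂.symm.trans h₂'), rfl, rfl⟩
  · rw [h₂] at h₂'
    exact (two_mul_ne_two_mul_add_one _ _ h₂'.symm).elim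
  · rw [h₂'] at h₂
    exact (two_mul_ne_two_mul_add_one _ _ h₂.symm).elim
  · exact ⟨rfl, two_mul_cancel' (h₂.symm.trans h₂'), rfl⟩

/-- The positive part of the numerator of the rational with a given code. -/
noncomputable def posPart' (c : M.N) : M.N := (exists_codes c).choose
/-- The negative part of the numerator of the rational with a given code. -/
noncomputable def negPart' (c : M.N) : M.N := (exists_codes c).choose_spec.choose
/-- The denominator of the rational with a given code. -/
noncomputable def denom (c : M.N) : M.N := (exists_codes c).choose_spec.choose_spec.choose

theorem codes_parts (c : M.N) : Codes c (posPart' c) (negPart' c) (denom c) :=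
  (exists_codes c).choose_spec.choose_spec.choose_spec

theorem codes_iff {c p q d : M.N} :
    Codes c p q d ↔ p = posPart' c ∧ q = negPart' c ∧ d = denom c :=
  ⟨fun h => h.unique (codes_parts c), by rintro ⟨rfl, rfl, rfl⟩; exact codes_parts c⟩

theorem denom_ne_zero (c : M.N) : denom c ≠ 0 := by
  obtain ⟨n, e, -, h, -⟩ := codes_parts c
  rw [h]
  exact (add_pos_of_nonneg_of_pos (zero_le' e) one_pos).ne'

-- Although the function is defined by a choice outside the model, its graph is arithmetical, so it
-- is internal.
@[fun_prop] theorem internal_posPart : Internal M (posPart' (M := M)) := by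
  refine .of_graph ?_
  have h (p : M.N × M.N) : p.2 = posPart' p.1 ↔ ∃ q d, Codes p.1 p.2 q d := by
    simp [codes_iff]
  simp only [h, Codes]
  fun_prop

@[fun_prop] theorem internal_negPart : Internal M (negPart' (M := M)) := by
  refine .of_graph ?_
  have h (p : M.N × M.N) : p.2 = negPart' p.1 ↔ ∃ q d, Codes p.1 q p.2 d := by
    simp [codes_iff]
  simp only [h, Codes]
  fun_prop

@[fun_prop] theorem internal_denom : Internal M (denom (M := M)) := by
  refine .of_graph ?_
  have h (p : M.N × M.N) : p.2 = denom p.1 ↔ ∃ q d, Codes p.1 q d p.2 := by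
    simp [codes_iff]
  simp only [h, Codes]
  fun_prop

/-- The embedding of the numbers into the rationals. -/
noncomputable abbrev toQ : M.N →+* M.Q := FracField.of

/-- The rational with a given code. -/
noncomputable def dec (c : M.N) : M.Q := (toQ (posPart' c) - toQ (negPart' c)) / toQ (denom c)

theorem toQ_ne_zero {n : M.N} (h : n ≠ 0) : toQ n ≠ 0 := FracField.of_eq_zero.not.2 h

theorem toQ_pos {n : M.N} (h : n ≠ 0) : 0 < toQ n :=
  (FracField.of_nonneg n).lt_of_ne' (toQ_ne_zero h)

theorem toQ_lt {m n : M.N} : toQ m < toQ n ↔ m < n := FracField.of_strictMono.lt_iff_lt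

theorem toQ_le {m n : M.N} : toQ m ≤ toQ n ↔ m ≤ n := FracField.of_strictMono.le_iff_le

theorem toQ_inj {m n : M.N} : toQ m = toQ n ↔ m = n := FracField.of_injective.eq_iff

theorem Codes.dec_eq {c p q d : M.N} (h : Codes c p q d) : dec c = (toQ p - toQ q) / toQ d := by
  obtain ⟨rfl, rfl, rfl⟩ := codes_iff.1 h
  rfl

theorem dec_surjective : Function.Surjective (dec (M := M)) := by
  intro x
  obtain ⟨a, b, hb, h⟩ := FracField.exists_eq x
  obtain ⟨e, rfl⟩ := (eq_zero_or_eq_add_one b).resolve_left hb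
  -- A product of two successive numbers is even, so the equation for the Cantor code can be solved.
  have hpair (n e : M.N) : ∃ c, 2 * c = (n + e) * (n + e + 1) + 2 * e := by
    obtain ⟨k, hk⟩ : ∃ k, (n + e) * (n + e + 1) = 2 * k := by
      refine induction (P := fun s => ∃ k, s * (s + 1) = 2 * k) (by fun_prop) ⟨0, by simp⟩ ?_ _
      rintro s ⟨k, hk⟩
      exact ⟨k + s + 1, by rw [mul_add 2, mul_add 2, ← hk]; ring⟩
    exact ⟨k + e, by rw [hk, mul_add]⟩
  rcases h with rfl | rfl
  · obtain ⟨c, hc⟩ := hpair (2 * a) e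
    refine ⟨c, ?_⟩
    rw [Codes.dec_eq ⟨_, _, hc, rfl, .inl ⟨rfl, rfl⟩⟩]
    simp
  -- An odd `n` codes a strictly negative rational; minus zero therefore needs an even code.
  · rcases eq_zero_or_eq_add_one a with rfl | ⟨a, rfl⟩
    · obtain ⟨c, hc⟩ := hpair (2 * 0) e
      refine ⟨c, ?_⟩
      rw [Codes.dec_eq ⟨_, _, hc, rfl, .inl ⟨rfl, rfl⟩⟩]
      simp
    · obtain ⟨c, hc⟩ := hpair (2 * a + 1) e
      refine ⟨c, ?_⟩
      rw [Codes.dec_eq ⟨_, _, hc, rfl, .inr ⟨(by ring : 2 * a + 1 + 1 = 2 * (a + 1)), rfl⟩⟩]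
      rw [map_zero, zero_sub, neg_div]

/-! ### Internal maps into the rationals -/

/-- A quotient structure: families of rationals are those that lift to families of codes, so that
maps out of the rationals are internal if they are so on codes. -/
instance : Dfl M M.Q where
  plot Γ p := ∃ q, Rep M Γ q ∧ ∀ e, p e = dec (q e)
  const x := let ⟨c, h⟩ := dec_surjective x
    ⟨fun _ => c, Rep.const c, fun _ => h.symm⟩
  weaken := fun ⟨q, hq, h⟩ => ⟨fun e => q e.2, hq.weaken, fun e => h e.2⟩

@[fun_prop] theorem internal_dec : Internal M (dec (M := M)) :=
  fun _ p hp => ⟨p, hp, fun _ => rfl⟩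

/-- Predicates of rationals are internal if they are internal as predicates of codes. -/
theorem Internal.of_dec {f : X × M.Q → Y}
    (hf : Internal M (fun p : X × M.N => f (p.1, dec p.2))) : Internal M f := by
  rintro Γ p ⟨h₁, q, hq, h₂⟩
  have := hf Γ (fun e => ((p e).1, q e)) ⟨h₁, hq⟩
  simpa only [← h₂] using this

theorem dec_lt_dec {c d : M.N} : dec c < dec d ↔
    posPart' c * denom d + negPart' d * denom c < posPart' d * denom c + negPart' c * denom d := by
  have h₁ := toQ_pos (denom_ne_zero c)
  have h₂ := toQ_pos (denom_ne_zero d)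
  rw [dec, dec, div_lt_div_iff₀ h₁ h₂, ← toQ_lt]
  simp only [map_add, map_mul]
  constructor <;> intro h <;> linarith

@[fun_prop] theorem Internal.ltQ {f g : X → M.Q} (hf : Internal M f) (hg : Internal M g) :
    Internal M (fun x => f x < g x) := by
  have : Internal M (fun p : M.Q × M.Q => p.1 < p.2) := by
    refine .of_dec ?_
    refine Internal.comp (f := fun p : M.N × M.Q => p.2 < dec p.1)
      (g := fun p : M.Q × M.N => (p.2, p.1)) (.of_dec ?_) (by fun_prop)
    simp only [dec_lt_dec]
    fun_prop
  exact this.comp (hf.prodMk hg)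

@[fun_prop] theorem Internal.leQ {f g : X → M.Q} (hf : Internal M f) (hg : Internal M g) :
    Internal M (fun x => f x ≤ g x) := by
  simp only [← not_lt]
  fun_prop

@[fun_prop] theorem Internal.eqQ {f g : X → M.Q} (hf : Internal M f) (hg : Internal M g) :
    Internal M (fun x => f x = g x) := by
  simp only [le_antisymm_iff]
  fun_prop

/-- The least code of a rational. -/
noncomputable def encQ (x : M.Q) : M.N := least fun c => dec c = x

@[fun_prop] theorem internal_encQ : Internal M (encQ (M := M)) := by
  unfold encQ
  fun_prop

@[simp] theorem dec_encQ (x : M.Q) : dec (encQ x) = x :=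
  (least_spec (by fun_prop) (dec_surjective x)).1

/-- Codes of a rational are not unique; the least one is chosen. -/
theorem Internal.of_graphQ {f : X → M.Q}
    (hf : Internal M (fun p : X × M.N => dec p.2 = f p.1)) : Internal M f := by
  have : f = fun x => dec (Model.least fun n => dec n = f x) := by
    funext x
    have : Internal M (fun n => dec n = f x) :=
      Internal.comp (f := fun p : X × M.N => dec p.2 = f p.1) (g := fun n => (x, n)) hf
        (by fun_prop)
    exact (least_spec this (dec_surjective _)).1.symm
  rw [this]
  exact internal_dec.comp (Internal.least (P := fun x n => dec n = f x) hf)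

@[fun_prop] theorem Internal.toQ {f : X → M.N} (hf : Internal M f) :
    Internal M (fun x => toQ (f x)) := by
  refine .of_graphQ ?_
  have (p : X × M.N) : dec p.2 = Model.toQ (f p.1) ↔
      posPart' p.2 = f p.1 * denom p.2 + negPart' p.2 := by
    have := toQ_ne_zero (denom_ne_zero p.2)
    rw [dec, div_eq_iff this, sub_eq_iff_eq_add, ← map_mul, ← map_add, toQ_inj]
  simp only [this]
  fun_prop

theorem dec_add_dec {a b c : M.N} : dec c = dec a + dec b ↔
    posPart' c * (denom a * denom b) + (negPart' a * denom b + negPart' b * denom a) * denom c =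
    negPart' c * (denom a * denom b) + (posPart' a * denom b + posPart' b * denom a) * denom c := by
  have h₁ := toQ_ne_zero (denom_ne_zero a)
  have h₂ := toQ_ne_zero (denom_ne_zero b)
  have h₃ := toQ_ne_zero (denom_ne_zero c)
  rw [dec, dec, dec, div_add_div _ _ h₁ h₂, div_eq_div_iff h₃ (mul_ne_zero h₁ h₂), ← toQ_inj]
  simp only [map_add, map_mul]
  constructor <;> intro h <;> linear_combination h

theorem dec_mul_dec {a b c : M.N} : dec c = dec a * dec b ↔
    posPart' c * (denom a * denom b) + (posPart' a * negPart' b + negPart' a * posPart' b) * denom c =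
    negPart' c * (denom a * denom b) + (posPart' a * posPart' b + negPart' a * negPart' b) * denom c := by
  have h₁ := toQ_ne_zero (denom_ne_zero a)
  have h₂ := toQ_ne_zero (denom_ne_zero b)
  have h₃ := toQ_ne_zero (denom_ne_zero c)
  rw [dec, dec, dec, div_mul_div_comm, div_eq_div_iff h₃ (mul_ne_zero h₁ h₂), ← toQ_inj]
  simp only [map_add, map_mul]
  constructor <;> intro h <;> linear_combination h

@[fun_prop] theorem Internal.addQ {f g : X → M.Q} (hf : Internal M f) (hg : Internal M g) :
    Internal M (fun x => f x + g x) := by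
  have : Internal M (fun p : M.Q × M.Q => p.1 + p.2) := by
    refine .of_dec ?_
    refine Internal.comp (f := fun p : M.N × M.Q => p.2 + dec p.1)
      (g := fun p : M.Q × M.N => (p.2, p.1)) (.of_dec (.of_graphQ ?_)) (by fun_prop)
    simp only [dec_add_dec]
    fun_prop
  exact this.comp (hf.prodMk hg)

@[fun_prop] theorem Internal.mulQ {f g : X → M.Q} (hf : Internal M f) (hg : Internal M g) :
    Internal M (fun x => f x * g x) := by
  have : Internal M (fun p : M.Q × M.Q => p.1 * p.2) := by
    refine .of_dec ?_
    refine Internal.comp (f := fun p : M.N × M.Q => p.2 * dec p.1)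
      (g := fun p : M.Q × M.N => (p.2, p.1)) (.of_dec (.of_graphQ ?_)) (by fun_prop)
    simp only [dec_mul_dec]
    fun_prop
  exact this.comp (hf.prodMk hg)

@[fun_prop] theorem Internal.negQ {f : X → M.Q} (hf : Internal M f) :
    Internal M (fun x => -f x) := by
  simp only [neg_eq_neg_one_mul (f _)]
  fun_prop

@[fun_prop] theorem Internal.subQ {f g : X → M.Q} (hf : Internal M f) (hg : Internal M g) :
    Internal M (fun x => f x - g x) := by
  simp only [sub_eq_add_neg]
  fun_prop

@[fun_prop] theorem Internal.invQ {f : X → M.Q} (hf : Internal M f) :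
    Internal M (fun x => (f x)⁻¹) := by
  refine .of_graphQ ?_
  have (p : X × M.N) : dec p.2 = (f p.1)⁻¹ ↔
      (f p.1 = 0 ∧ dec p.2 = 0) ∨ dec p.2 * f p.1 = 1 := by
    by_cases h : f p.1 = 0
    · simp [h]
    · simp only [h, false_and, false_or]
      exact ⟨fun h' => by rw [h', inv_mul_cancel₀ h], eq_inv_of_mul_eq_one_left⟩
  simp only [this]
  fun_prop

@[fun_prop] theorem Internal.absQ {f : X → M.Q} (hf : Internal M f) :
    Internal M (fun x => |f x|) := by
  refine .of_graphQ ?_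
  have (p : X × M.N) : dec p.2 = |f p.1| ↔
      (0 ≤ f p.1 ∧ dec p.2 = f p.1) ∨ (f p.1 < 0 ∧ dec p.2 = -f p.1) := by
    rcases le_or_gt 0 (f p.1) with h | h
    · simp [h, h.not_gt, abs_of_nonneg]
    · simp [h, h.not_ge, abs_of_neg]
  simp only [this]
  fun_prop

/-- Primitive recursion with values in the rationals. -/
noncomputable def qrec (g : M.N → M.Q → M.Q) (x : M.Q) (n : M.N) : M.Q :=
  dec (nrec (fun i c => encQ (g i (dec c))) (encQ x) n)

@[fun_prop] theorem Internal.qrec {g : X → M.N → M.Q → M.Q} {x : X → M.Q} {n : X → M.N}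
    (hg : Internal M (fun p : X × M.N × M.Q => g p.1 p.2.1 p.2.2)) (hx : Internal M x)
    (hn : Internal M n) : Internal M (fun a => qrec (g a) (x a) (n a)) := by
  unfold Model.qrec
  fun_prop

@[simp] theorem qrec_zero (g : M.N → M.Q → M.Q) (x : M.Q) : qrec g x 0 = x := by
  simp [qrec]

theorem qrec_succ {g : M.N → M.Q → M.Q} (hg : Internal M (fun p : M.N × M.Q => g p.1 p.2))
    (x : M.Q) (n : M.N) : qrec g x (n + 1) = g n (qrec g x n) := by
  rw [qrec, nrec_succ (by fun_prop), dec_encQ, qrec]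

/-! ### Powers of two -/

/-- The number `2 ^ n`. -/
noncomputable def pw (n : M.N) : M.N := nrec (fun _ a => a + a) 1 n

@[fun_prop] theorem internal_pw : Internal M (pw (M := M)) := by
  unfold pw
  fun_prop

@[simp] theorem pw_zero : pw (0 : M.N) = 1 := nrec_zero _ _

theorem pw_succ (n : M.N) : pw (n + 1) = 2 * pw n := by
  rw [pw, nrec_succ (by fun_prop), two_mul, pw]

theorem val_pow2 {V : Ty → Type} (e : ∀ σ, V σ → M.T σ) (t : Tm V ty0) :
    (pow2 t).val e = pw (t.val e) := by
  rw [pw, nrec, pow2]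
  simp only [Tm.val_app, Tm.val_cst, val_one]
  congr 3
  refine (lam_eq fun i => ?_).symm
  refine (lam_eq fun a => ?_).symm
  rw [P_app, S_app, S_app, P_app]
  rfl

theorem pw_ne_zero (n : M.N) : pw n ≠ 0 := by
  refine induction (P := fun n => pw n ≠ 0) (by fun_prop) (by simp) (fun n h => ?_) n
  rw [pw_succ]
  exact mul_ne_zero two_ne_zero h

theorem pw_pos (n : M.N) : 0 < pw n := pos_iff_ne_zero.2 (pw_ne_zero n)

theorem lt_pw (n : M.N) : n < pw n := by
  refine induction (P := fun n => n < pw n) (by fun_prop) (by simp) (fun n h => ?_) n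
  rw [pw_succ, two_mul]
  exact add_lt_add_of_lt_of_le h (Order.one_le_iff_pos.2 (pw_pos n))

theorem pw_add (m n : M.N) : pw (m + n) = pw m * pw n := by
  refine induction (P := fun n => pw (m + n) = pw m * pw n) (by fun_prop) (by simp)
    (fun n h => ?_) n
  rw [← add_assoc, pw_succ, pw_succ, h]
  ring

theorem pw_le_pw {m n : M.N} (h : m ≤ n) : pw m ≤ pw n := by
  obtain ⟨k, rfl⟩ := exists_add_of_le h
  rw [pw_add]
  exact le_mul_of_one_le_right (zero_le' _) (Order.one_le_iff_pos.2 (pw_pos k))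

/-- The rational `2 ^ (-n)`. -/
noncomputable def ip (n : M.N) : M.Q := (toQ (pw n))⁻¹

@[fun_prop] theorem internal_ip : Internal M (ip (M := M)) := by
  unfold ip
  fun_prop

theorem ip_pos (n : M.N) : 0 < ip n := inv_pos.2 (toQ_pos (pw_ne_zero n))

@[simp] theorem ip_zero : ip (0 : M.N) = 1 := by simp [ip]

theorem ip_le_ip {m n : M.N} (h : m ≤ n) : ip n ≤ ip m :=
  inv_anti₀ (toQ_pos (pw_ne_zero m)) (toQ_le.2 (pw_le_pw h))

/-- The Archimedean property, relative to the possibly nonstandard numbers of the model. -/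
theorem exists_lt_toQ (x : M.Q) : ∃ n, x < toQ n := by
  obtain ⟨a, b, hb, h⟩ := FracField.exists_eq x
  have h₁ : toQ a / toQ b < toQ (a + 1) := by
    rw [div_lt_iff₀ (toQ_pos hb), ← map_mul, toQ_lt]
    exact (lt_add_one a).trans_le (le_mul_of_one_le_right (zero_le' _) (Order.one_le_iff_pos.2
      (pos_iff_ne_zero.2 hb)))
  have h₂ : 0 ≤ toQ a / toQ b := div_nonneg (FracField.of_nonneg _) (FracField.of_nonneg _)
  refine ⟨a + 1, ?_⟩
  rcases h with rfl | rfl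
  · exact h₁
  · linarith

theorem exists_ip_lt {x : M.Q} (hx : 0 < x) : ∃ n, ip n < x := by
  obtain ⟨n, hn⟩ := exists_lt_toQ x⁻¹
  refine ⟨n, inv_lt_of_inv_lt₀ hx (hn.trans (toQ_lt.2 (lt_pw n)))⟩

end Model
end HOA

namespace HOA
namespace Model

variable {M : Model} {X Y Z : Type} [Dfl M X] [Dfl M Y] [Dfl M Z]

/-! ### Real numbers of a model -/

/-- Cauchy sequences of rationals. -/
def IsCauchy (a : M.N → M.Q) : Prop := ∀ ε > 0, ∃ m, ∀ n ≥ m, ∀ n' ≥ m, |a n - a n'| < ε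

/-- Sequences of rationals with limit zero. -/
def IsNull (a : M.N → M.Q) : Prop := ∀ ε > 0, ∃ m, ∀ n ≥ m, |a n| < ε

theorem IsCauchy.bounded {a : M.N → M.Q} (ha : IsCauchy a) :
    ∃ B > 0, ∃ m, ∀ n ≥ m, |a n| < B := by
  obtain ⟨m, hm⟩ := ha 1 one_pos
  refine ⟨|a m| + 1, by positivity, m, fun n hn => ?_⟩
  have := abs_sub_abs_le_abs_sub (a n) (a m)
  linarith [hm n hn m le_rfl]

theorem IsCauchy.add {a b : M.N → M.Q} (ha : IsCauchy a) (hb : IsCauchy b) :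
    IsCauchy (fun n => a n + b n) := by
  intro ε hε
  obtain ⟨m, hm⟩ := ha (ε / 2) (by linarith)
  obtain ⟨m', hm'⟩ := hb (ε / 2) (by linarith)
  refine ⟨max m m', fun n hn n' hn' => ?_⟩
  rw [ge_iff_le, max_le_iff] at hn hn'
  have h₁ := hm n hn.1 n' hn'.1
  have h₂ := hm' n hn.2 n' hn'.2
  rw [abs_lt] at *
  constructor <;> linarith

theorem IsCauchy.mul {a b : M.N → M.Q} (ha : IsCauchy a) (hb : IsCauchy b) :
    IsCauchy (fun n => a n * b n) := by
  intro ε hε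
  obtain ⟨A, hA, m₁, h₁⟩ := ha.bounded
  obtain ⟨B, hB, m₂, h₂⟩ := hb.bounded
  obtain ⟨m₃, h₃⟩ := ha (ε / (2 * B)) (by positivity)
  obtain ⟨m₄, h₄⟩ := hb (ε / (2 * A)) (by positivity)
  refine ⟨max (max m₁ m₂) (max m₃ m₄), fun n hn n' hn' => ?_⟩
  simp only [ge_iff_le, max_le_iff] at hn hn'
  have h₁ := h₁ n hn.1.1
  have h₂ := h₂ n' hn'.1.2
  have h₃ := h₃ n hn.2.1 n' hn'.2.1
  have h₄ := h₄ n hn.2.2 n' hn'.2.2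
  calc |a n * b n - a n' * b n'| = |a n * (b n - b n') + (a n - a n') * b n'| := by ring_nf
    _ ≤ |a n| * |b n - b n'| + |a n - a n'| * |b n'| := by
      rw [← abs_mul, ← abs_mul]; exact abs_add_le _ _
    _ < A * (ε / (2 * A)) + ε / (2 * B) * B := by
      refine add_lt_add_of_le_of_lt ?_ ?_
      · gcongr
      · exact mul_lt_mul'' h₃ h₂ (abs_nonneg _) (abs_nonneg _)
    _ = ε := by field_simp; ring

theorem IsCauchy.const (x : M.Q) : IsCauchy (fun _ : M.N => x) :=
  fun ε hε => ⟨0, fun _ _ _ _ => by simpa using hε⟩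

theorem IsCauchy.neg {a : M.N → M.Q} (ha : IsCauchy a) : IsCauchy (fun n => -a n) := by
  intro ε hε
  obtain ⟨m, hm⟩ := ha ε hε
  refine ⟨m, fun n hn n' hn' => ?_⟩
  rw [neg_sub_neg]
  exact hm n' hn' n hn

theorem IsCauchy.abs {a : M.N → M.Q} (ha : IsCauchy a) : IsCauchy (fun n => |a n|) := by
  intro ε hε
  obtain ⟨m, hm⟩ := ha ε hε
  exact ⟨m, fun n hn n' hn' => (abs_abs_sub_abs_le _ _).trans_lt (hm n hn n' hn')⟩

/-- A Cauchy sequence without limit zero is bounded away from zero. -/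
theorem IsCauchy.pos_or_neg {a : M.N → M.Q} (ha : IsCauchy a) (ha' : ¬ IsNull a) :
    ∃ ε > 0, ∃ m, (∀ n ≥ m, ε < a n) ∨ ∀ n ≥ m, a n < -ε := by
  simp only [IsNull, not_forall, not_exists, not_lt] at ha'
  obtain ⟨ε, hε, h⟩ := ha'
  obtain ⟨m, hm⟩ := ha (ε / 2) (by linarith)
  obtain ⟨n, hn, h⟩ := h m
  refine ⟨ε / 2, by linarith, m, ?_⟩
  rcases le_abs.1 h with h | h
  · exact .inl fun n' hn' => by linarith [abs_lt.1 (hm n hn n' hn')]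
  · exact .inr fun n' hn' => by linarith [abs_lt.1 (hm n hn n' hn')]

variable (M) in
/-- The ring of internal Cauchy sequences. -/
def cauchyRing : Subring (M.N → M.Q) where
  carrier := {a | Internal M a ∧ IsCauchy a}
  mul_mem' h h' := ⟨h.1.mulQ h'.1, h.2.mul h'.2⟩
  one_mem' := ⟨.const 1, .const 1⟩
  add_mem' h h' := ⟨h.1.addQ h'.1, h.2.add h'.2⟩
  zero_mem' := ⟨.const 0, .const 0⟩
  neg_mem' h := ⟨h.1.negQ, h.2.neg⟩

theorem IsNull.add {a b : M.N → M.Q} (ha : IsNull a) (hb : IsNull b) :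
    IsNull (fun n => a n + b n) := by
  intro ε hε
  obtain ⟨m, hm⟩ := ha (ε / 2) (by linarith)
  obtain ⟨m', hm'⟩ := hb (ε / 2) (by linarith)
  refine ⟨max m m', fun n hn => ?_⟩
  rw [ge_iff_le, max_le_iff] at hn
  have h₁ := hm n hn.1
  have h₂ := hm' n hn.2
  rw [abs_lt] at *
  constructor <;> linarith

theorem IsNull.of_le {a b : M.N → M.Q} (hb : IsNull b) (h : ∀ n, |a n| ≤ |b n|) : IsNull a := by
  intro ε hε
  obtain ⟨m, hm⟩ := hb ε hε
  exact ⟨m, fun n hn => (h n).trans_lt (hm n hn)⟩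

variable (M) in
/-- The ideal of sequences with limit zero. -/
def nullIdeal : Ideal (cauchyRing M) where
  carrier := {a | IsNull a.1}
  add_mem' h h' := h.add h'
  zero_mem' := fun ε hε => ⟨0, fun n _ => by simpa using hε⟩
  smul_mem' := by
    intro a b hb ε hε
    obtain ⟨A, hA, m, hm⟩ := a.2.2.bounded
    obtain ⟨m', hm'⟩ := hb (ε / A) (by positivity)
    refine ⟨max m m', fun n hn => ?_⟩
    rw [ge_iff_le, max_le_iff] at hn
    change |a.1 n * b.1 n| < ε
    rw [abs_mul]
    calc |a.1 n| * |b.1 n| < A * (ε / A) :=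
          mul_lt_mul'' (hm n hn.1) (hm' n hn.2) (abs_nonneg _) (abs_nonneg _)
      _ = ε := by field_simp

variable (M) in
/-- The real numbers of a model. -/
def R : Type := @HasQuotient.Quotient (cauchyRing M) (Ideal (cauchyRing M)) Ideal.instHasQuotient (nullIdeal M)

namespace R

noncomputable instance : CommRing M.R := inferInstanceAs (CommRing
  (@HasQuotient.Quotient (cauchyRing M) (Ideal (cauchyRing M)) Ideal.instHasQuotient (nullIdeal M)))

/-- The real number represented by a Cauchy sequence. -/
noncomputable def mk : cauchyRing M →+* M.R := Ideal.Quotient.mk (nullIdeal M)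

theorem mk_surjective : Function.Surjective (mk (M := M)) := Ideal.Quotient.mk_surjective

theorem mk_eq_zero {a : cauchyRing M} : mk a = 0 ↔ IsNull a.1 := Ideal.Quotient.eq_zero_iff_mem

theorem mk_eq {a b : cauchyRing M} : mk a = mk b ↔ IsNull (fun n => a.1 n - b.1 n) := by
  rw [← sub_eq_zero, ← map_sub, mk_eq_zero]
  rfl

variable (M) in
/-- The cone of non-negative reals. -/
def cone : RingCone M.R where
  carrier := {x | ∃ a : cauchyRing M, mk a = x ∧ ∀ n, 0 ≤ a.1 n}
  mul_mem' := by
    rintro _ _ ⟨a, rfl, ha⟩ ⟨b, rfl, hb⟩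
    exact ⟨a * b, map_mul _ _ _, fun n => mul_nonneg (ha n) (hb n)⟩
  one_mem' := ⟨1, map_one _, fun _ => zero_le_one⟩
  add_mem' := by
    rintro _ _ ⟨a, rfl, ha⟩ ⟨b, rfl, hb⟩
    exact ⟨a + b, map_add _ _ _, fun n => add_nonneg (ha n) (hb n)⟩
  zero_mem' := ⟨0, map_zero _, fun _ => le_rfl⟩
  eq_zero_of_mem_of_neg_mem' := by
    rintro _ ⟨a, rfl, ha⟩ ⟨b, h, hb⟩
    rw [eq_neg_iff_add_eq_zero, ← map_add, mk_eq_zero] at h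
    refine mk_eq_zero.2 (h.of_le fun n => ?_)
    change |a.1 n| ≤ |b.1 n + a.1 n|
    rw [abs_of_nonneg (ha n), abs_of_nonneg (add_nonneg (hb n) (ha n))]
    exact le_add_of_nonneg_left (hb n)

/-- The sequence of absolute values agrees with `a` from `m` on, hence represents the same real, and
has no negative terms. -/
theorem mk_mem_cone {a : cauchyRing M} {m : M.N} (h : ∀ n ≥ m, 0 ≤ a.1 n) : mk a ∈ cone M := by
  refine ⟨⟨fun n => |a.1 n|, a.2.1.absQ, a.2.2.abs⟩, mk_eq.2 fun ε hε => ⟨m, fun n hn => ?_⟩,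
    fun n => abs_nonneg _⟩
  dsimp only
  rwa [abs_of_nonneg (h n hn), sub_self, abs_zero]

instance : HasMemOrNegMem (cone M) where
  mem_or_neg_mem x := by
    obtain ⟨a, rfl⟩ := mk_surjective x
    by_cases ha : IsNull a.1
    · rw [mk_eq_zero.2 ha]
      exact .inl (zero_mem _)
    · obtain ⟨ε, hε, m, h | h⟩ := a.2.2.pos_or_neg ha
      · exact .inl (mk_mem_cone (m := m) fun n hn => (hε.trans (h n hn)).le)
      · rw [← map_neg]
        refine .inr (mk_mem_cone (m := m) fun n hn => ?_)
        have := h n hn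
        change 0 ≤ -a.1 n
        linarith

variable (M) in
/-- The order of the reals. -/
protected noncomputable def linearOrder : LinearOrder M.R :=
  letI : DecidablePred (· ∈ cone M) := Classical.decPred _
  LinearOrder.mkOfAddGroupCone (cone M)

noncomputable instance : LinearOrder M.R := R.linearOrder M

instance : IsOrderedRing M.R := .mkOfCone (cone M)

theorem mk_pos {a : cauchyRing M} : 0 < mk a ↔ ∃ ε > 0, ∃ m, ∀ n ≥ m, ε < a.1 n := by
  rw [← not_le]
  change ¬ (0 - mk a ∈ cone M) ↔ _
  rw [zero_sub]
  constructor
  · intro h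
    by_cases ha : IsNull a.1
    · rw [mk_eq_zero.2 ha, neg_zero] at h
      exact (h (zero_mem _)).elim
    · obtain ⟨ε, hε, m, h' | h'⟩ := a.2.2.pos_or_neg ha
      · exact ⟨ε, hε, m, h'⟩
      · refine (h ?_).elim
        rw [← map_neg]
        refine mk_mem_cone (m := m) fun n hn => ?_
        have := h' n hn
        change 0 ≤ -a.1 n
        linarith
  · rintro ⟨ε, hε, m, h⟩ ⟨b, hb, hb'⟩
    rw [eq_neg_iff_add_eq_zero, ← map_add, mk_eq_zero] at hb
    obtain ⟨m', hm'⟩ := hb ε hε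
    have h₁ := h (max m m') (le_max_left _ _)
    have h₂ := (abs_lt.1 (hm' (max m m') (le_max_right _ _))).2
    have h₃ := hb' (max m m')
    change b.1 _ + a.1 _ < ε at h₂
    linarith

theorem mk_lt {a b : cauchyRing M} : mk a < mk b ↔ ∃ k m, ∀ n ≥ m, a.1 n + ip k < b.1 n := by
  rw [← sub_pos, ← map_sub, mk_pos]
  constructor
  · rintro ⟨ε, hε, m, h⟩
    obtain ⟨k, hk⟩ := exists_ip_lt hε
    refine ⟨k, m, fun n hn => ?_⟩
    have := h n hn
    change ε < b.1 n - a.1 n at this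
    linarith
  · rintro ⟨k, m, h⟩
    refine ⟨ip k, ip_pos k, m, fun n hn => ?_⟩
    have := h n hn
    change ip k < b.1 n - a.1 n
    linarith

instance : Nontrivial M.R := ⟨0, 1, fun h => by
  have : (0 : M.R) < 1 := by
    rw [← map_one mk, mk_pos]
    exact ⟨1 / 2, by norm_num, 0, fun n _ => by change (1 / 2 : M.Q) < 1; norm_num⟩
  exact this.ne h⟩

theorem isField : IsField M.R where
  exists_pair_ne := exists_pair_ne _
  mul_comm := mul_comm
  mul_inv_cancel {x} hx := by
    obtain ⟨a, rfl⟩ := mk_surjective x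
    obtain ⟨ε, hε, m, h⟩ := a.2.2.pos_or_neg (mk_eq_zero.not.1 hx)
    have h : ∀ n ≥ m, ε < |a.1 n| := fun n hn => by
      rcases h with h | h
      · exact (h n hn).trans_le (le_abs_self _)
      · exact (lt_neg_of_lt_neg (h n hn)).trans_le (neg_le_abs _)
    have hne : ∀ n ≥ m, a.1 n ≠ 0 := fun n hn => abs_pos.1 (hε.trans (h n hn))
    -- From `m` on, the terms of `a` have absolute value above `ε`. Earlier ones may vanish, but do
    -- not affect the limit.
    refine ⟨mk ⟨fun n => (a.1 n)⁻¹, a.2.1.invQ, fun δ hδ => ?_⟩, ?_⟩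
    · obtain ⟨m', hm'⟩ := a.2.2 (δ * (ε * ε)) (by positivity)
      refine ⟨max m m', fun n hn n' hn' => ?_⟩
      rw [ge_iff_le, max_le_iff] at hn hn'
      rw [inv_sub_inv (hne n hn.1) (hne n' hn'.1), abs_div, abs_mul,
        div_lt_iff₀ (mul_pos (hε.trans (h n hn.1)) (hε.trans (h n' hn'.1)))]
      refine (hm' n' hn'.2 n hn.2).trans_le ?_
      gcongr
      · exact (h n hn.1).le
      · exact (h n' hn'.1).le
    · rw [← map_mul, ← map_one mk, mk_eq]
      refine fun δ hδ => ⟨m, fun n hn => ?_⟩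
      change |a.1 n * (a.1 n)⁻¹ - 1| < δ
      rwa [mul_inv_cancel₀ (hne n hn), sub_self, abs_zero]

open Classical in
noncomputable instance : Field M.R where
  inv x := if h : x = 0 then 0 else (isField.mul_inv_cancel h).choose
  mul_inv_cancel x h := by
    rw [dif_neg h]
    exact (isField.mul_inv_cancel h).choose_spec
  inv_zero := dif_pos rfl
  nnqsmul := _
  nnqsmul_def _ _ := rfl
  qsmul := _
  qsmul_def _ _ := rfl

instance : IsStrictOrderedRing M.R := IsOrderedRing.toIsStrictOrderedRing _

instance : IsOrderedRing M.R := inferInstance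
instance : IsOrderedAddMonoid M.R := inferInstance
instance : AddLeftMono M.R := inferInstance
instance : AddRightMono M.R := inferInstance
instance : PosMulMono M.R := inferInstance
instance : MulPosMono M.R := inferInstance
instance : PosMulStrictMono M.R := inferInstance
instance : MulPosStrictMono M.R := inferInstance
instance : PosMulReflectLT M.R := inferInstance
instance : MulPosReflectLT M.R := inferInstance
instance : ZeroLEOneClass M.R := inferInstance
instance : CharZero M.R := inferInstance

end R
end Model
end HOA

namespace HOA
namespace Model

variable {M : Model} {X Y Z : Type} [Dfl M X] [Dfl M Y] [Dfl M Z]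

@[fun_prop] theorem Internal.iteQ {P : X → Prop} [DecidablePred P] {f g : X → M.Q}
    (hP : Internal M P) (hf : Internal M f) (hg : Internal M g) :
    Internal M (fun x => if P x then f x else g x) := by
  refine .of_graphQ ?_
  have h (p : X × M.N) : (dec p.2 = if P p.1 then f p.1 else g p.1) ↔
      (P p.1 ∧ dec p.2 = f p.1) ∨ (¬ P p.1 ∧ dec p.2 = g p.1) := by
    split_ifs with h <;> simp [h]
  simp only [h]
  fun_prop

/-! ### Limits -/

theorem isCauchy_iff {a : M.N → M.Q} :
    IsCauchy a ↔ ∀ k, ∃ m, ∀ n, m ≤ n → ∀ n', m ≤ n' → |a n - a n'| < ip k := by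
  refine ⟨fun h k => h _ (ip_pos k), fun h ε hε => ?_⟩
  obtain ⟨k, hk⟩ := exists_ip_lt hε
  obtain ⟨m, hm⟩ := h k
  exact ⟨m, fun n hn n' hn' => (hm n hn n' hn').trans hk⟩

@[fun_prop] theorem internal_isCauchy {a : X → M.N → M.Q}
    (ha : Internal M (fun p : X × M.N => a p.1 p.2)) : Internal M (fun x => IsCauchy (a x)) := by
  simp only [isCauchy_iff]
  fun_prop

open Classical in
/-- The limit of a sequence of rationals. -/
noncomputable def lim (a : M.N → M.Q) : M.R :=
  if h : Internal M a ∧ IsCauchy a then R.mk ⟨a, h⟩ else 0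

theorem lim_eq {a : M.N → M.Q} (h : Internal M a) (h' : IsCauchy a) :
    lim a = R.mk ⟨a, h, h'⟩ := dif_pos ⟨h, h'⟩

theorem exists_lim_eq (r : M.R) : ∃ a, Internal M a ∧ IsCauchy a ∧ lim a = r := by
  obtain ⟨a, rfl⟩ := R.mk_surjective r
  exact ⟨a.1, a.2.1, a.2.2, lim_eq a.2.1 a.2.2⟩

theorem lim_add {a b : M.N → M.Q} (h : Internal M a) (h' : IsCauchy a) (hb : Internal M b)
    (hb' : IsCauchy b) : lim (fun n => a n + b n) = lim a + lim b := by
  rw [lim_eq h h', lim_eq hb hb', lim_eq (h.addQ hb) (h'.add hb'), ← map_add]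
  rfl

theorem lim_mul {a b : M.N → M.Q} (h : Internal M a) (h' : IsCauchy a) (hb : Internal M b)
    (hb' : IsCauchy b) : lim (fun n => a n * b n) = lim a * lim b := by
  rw [lim_eq h h', lim_eq hb hb', lim_eq (h.mulQ hb) (h'.mul hb'), ← map_mul]
  rfl

theorem lim_lt {a b : M.N → M.Q} (h : Internal M a) (h' : IsCauchy a) (hb : Internal M b)
    (hb' : IsCauchy b) : lim a < lim b ↔ ∃ k m, ∀ n, m ≤ n → a n + ip k < b n := by
  rw [lim_eq h h', lim_eq hb hb', R.mk_lt]

variable (M) in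
/-- The embedding of the rationals into the reals. -/
noncomputable def ofQ : M.Q →+* M.R :=
  R.mk.comp
    { toFun x := ⟨fun _ => x, .const x, .const x⟩
      map_one' := rfl
      map_mul' _ _ := rfl
      map_zero' := rfl
      map_add' _ _ := rfl }

theorem lim_const (x : M.Q) : lim (fun _ : M.N => x) = ofQ M x := lim_eq (.const x) (.const x)

theorem ofQ_lt {x y : M.Q} : ofQ M x < ofQ M y ↔ x < y := by
  rw [← lim_const, ← lim_const, lim_lt (.const _) (.const _) (.const _) (.const _)]
  constructor
  · rintro ⟨k, m, h⟩
    have := h m le_rfl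
    linarith [ip_pos k]
  · intro h
    obtain ⟨k, hk⟩ := exists_ip_lt (sub_pos.2 h)
    exact ⟨k, 0, fun _ _ => by linarith⟩

theorem ofQ_le {x y : M.Q} : ofQ M x ≤ ofQ M y ↔ x ≤ y := by
  rw [← not_lt, ofQ_lt, not_lt]

/-- The least modulus of convergence of a sequence of rationals. -/
noncomputable def modulus (a : M.N → M.Q) (k : M.N) : M.N :=
  least fun m => ∀ n, m ≤ n → ∀ n', m ≤ n' → |a n - a n'| < ip k

theorem modulus_spec {a : M.N → M.Q} (h : Internal M a) (h' : IsCauchy a) (k : M.N) :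
    ∀ n, modulus a k ≤ n → ∀ n', modulus a k ≤ n' → |a n - a n'| < ip k :=
  (least_spec (P := fun m => ∀ n, m ≤ n → ∀ n', m ≤ n' → |a n - a n'| < ip k) (by fun_prop)
    (isCauchy_iff.1 h' k)).1

theorem modulus_le {a : M.N → M.Q} (h : Internal M a) {k m : M.N}
    (hm : ∀ n, m ≤ n → ∀ n', m ≤ n' → |a n - a n'| < ip k) : modulus a k ≤ m :=
  not_lt.1 fun h' => (least_spec (P := fun m => ∀ n, m ≤ n → ∀ n', m ≤ n' → |a n - a n'| < ip k)
    (by fun_prop) ⟨m, hm⟩).2 m h' hm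

theorem modulus_mono {a : M.N → M.Q} (h : Internal M a) (h' : IsCauchy a) {k k' : M.N}
    (hk : k ≤ k') : modulus a k ≤ modulus a k' :=
  modulus_le h fun n hn n' hn' => (modulus_spec h h' k' n hn n' hn').trans_le (ip_le_ip hk)

/-! ### Codes of real numbers -/

/-- `x` represents a real. -/
def IsReal (x : M.T ty1) : Prop := ∀ n i, |dec (x ⊡ n) - dec (x ⊡ (n + i))| < ip n

@[fun_prop] theorem Internal.isReal {f : X → M.T ty1} (hf : Internal M f) :
    Internal M (fun x => IsReal (f x)) := by
  unfold IsReal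
  fun_prop

open Classical in
/-- The sequence of rational approximations of the real represented by `x`. -/
noncomputable def appr (x : M.T ty1) (n : M.N) : M.Q := if IsReal x then dec (x ⊡ n) else 0

@[fun_prop] theorem Internal.appr {f : X → M.T ty1} {g : X → M.N} (hf : Internal M f)
    (hg : Internal M g) : Internal M (fun x => appr (f x) (g x)) := by
  unfold Model.appr
  fun_prop

theorem IsReal.appr_eq {x : M.T ty1} (h : IsReal x) (n : M.N) : appr x n = dec (x ⊡ n) := if_pos h

/-- There is no hypothesis on `x`: a sequence that does not represent a real is read as the constant
`0`. This makes `proj` total. -/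
theorem appr_lt (x : M.T ty1) (n i : M.N) : |appr x n - appr x (n + i)| < ip n := by
  unfold appr
  split_ifs with h
  · exact h n i
  · simpa using ip_pos n

theorem appr_lt_of_le (x : M.T ty1) {n n' : M.N} (h : n ≤ n') : |appr x n - appr x n'| < ip n := by
  obtain ⟨i, rfl⟩ := exists_add_of_le h
  exact appr_lt x n i

theorem isCauchy_of_appr_lt {a : M.N → M.Q} {c : M.Q}
    (h : ∀ n n', n ≤ n' → |a n - a n'| ≤ c * ip n) : IsCauchy a := by
  intro ε hε
  obtain ⟨b, hb⟩ := exists_lt_toQ c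
  have hb0 : 0 < |c| + 1 := by positivity
  obtain ⟨k, hk⟩ := exists_ip_lt (x := ε / (2 * (|c| + 1))) (by positivity)
  have hc : c * ip k < ε / 2 := by
    rw [lt_div_iff₀ (by positivity)] at hk
    have := ip_pos k
    nlinarith [le_abs_self c]
  refine ⟨k, fun n hn n' hn' => ?_⟩
  have h₁ := h k n hn
  have h₂ := h k n' hn'
  rw [abs_le] at h₁ h₂
  rw [abs_lt]
  constructor <;> linarith

theorem isCauchy_appr (x : M.T ty1) : IsCauchy (appr x) :=
  isCauchy_of_appr_lt (c := 1) fun n n' h => by rw [one_mul]; exact (appr_lt_of_le x h).le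

theorem internal_appr (x : M.T ty1) : Internal M (appr x) := by fun_prop

/-- The real represented by `x`. -/
noncomputable def proj (x : M.T ty1) : M.R := lim (appr x)

/-- A fast convergent sequence with the limit of a given sequence. -/
noncomputable def fast (a : M.N → M.Q) : M.T ty1 := lam fun k => encQ (a (modulus a k))

theorem dec_fast {a : M.N → M.Q} (h : Internal M a) (k : M.N) :
    dec (fast a ⊡ k) = a (modulus a k) := by
  have : Internal M fun k => encQ (a (modulus a k)) := by unfold modulus; fun_prop
  rw [fast, lam_app this, dec_encQ]

theorem isReal_fast {a : M.N → M.Q} (h : Internal M a) (h' : IsCauchy a) : IsReal (fast a) := by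
  intro n i
  rw [dec_fast h, dec_fast h]
  exact modulus_spec h h' n _ le_rfl _ (modulus_mono h h' le_self_add)

theorem proj_fast {a : M.N → M.Q} (h : Internal M a) (h' : IsCauchy a) : proj (fast a) = lim a := by
  rw [proj, lim_eq (internal_appr _) (isCauchy_appr _), lim_eq h h', R.mk_eq]
  intro ε hε
  obtain ⟨k, hk⟩ := exists_ip_lt hε
  refine ⟨max k (modulus a k), fun n hn => ?_⟩
  rw [ge_iff_le, max_le_iff] at hn
  dsimp only
  rw [(isReal_fast h h').appr_eq, dec_fast h]
  exact (modulus_spec h h' k _ (modulus_mono h h' hn.1) _ hn.2).trans hk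

theorem exists_code (r : M.R) : ∃ x, IsReal x ∧ proj x = r := by
  obtain ⟨a, h, h', rfl⟩ := exists_lim_eq r
  exact ⟨fast a, isReal_fast h h', proj_fast h h'⟩

/-- Replace a sequence that does not represent a real by zero. -/
noncomputable def regular (x : M.T ty1) : M.T ty1 := lam fun n => encQ (appr x n)

@[fun_prop] theorem Internal.regular {f : X → M.T ty1} (hf : Internal M f) :
    Internal M (fun x => regular (f x)) := by
  unfold Model.regular
  fun_prop

theorem dec_regular (x : M.T ty1) (n : M.N) : dec (regular x ⊡ n) = appr x n := by
  rw [regular, lam_app (by fun_prop), dec_encQ]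

theorem isReal_regular (x : M.T ty1) : IsReal (regular x) := fun n i => by
  rw [dec_regular, dec_regular]
  exact appr_lt x n i

theorem proj_regular (x : M.T ty1) : proj (regular x) = proj x := by
  rw [proj, proj]
  congr 1
  funext n
  rw [(isReal_regular x).appr_eq, dec_regular]

/-! ### Internal maps into the reals -/

/-- Again a quotient structure: families of reals are those that lift to families of codes. -/
instance : Dfl M M.R where
  plot Γ p := ∃ q, Rep M Γ q ∧ ∀ e, p e = proj (q e)
  const x := let ⟨c, _, h⟩ := exists_code x
    ⟨fun _ => c, Rep.const c, fun _ => h.symm⟩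
  weaken := fun ⟨q, hq, h⟩ => ⟨fun e => q e.2, hq.weaken, fun e => h e.2⟩

@[fun_prop] theorem internal_proj : Internal M (proj (M := M)) :=
  fun _ p hp => ⟨p, hp, fun _ => rfl⟩

theorem Internal.of_proj₂ {f : M.R × M.R → Y}
    (hf : Internal M (fun p : M.T ty1 × M.T ty1 => f (proj p.1, proj p.2))) : Internal M f := by
  rintro Γ p ⟨⟨q, hq, h⟩, q', hq', h'⟩
  have := hf Γ (fun e => (q e, q' e)) ⟨hq, hq'⟩
  simpa only [← h, ← h'] using this

/-- The way back from internal maps to objects of the model: lift to codes, then correct by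
`regular`, so that every value represents a real. -/
theorem Internal.exists_fn {σ : Ty} {g : X → M.R} (hg : Internal M g) {i : M.T σ → X}
    (hi : Internal M i) :
    ∃ F : M.T (σ ⇾ ty1), ∀ x, IsReal (F ⊡ x) ∧ proj (F ⊡ x) = g (i x) := by
  obtain ⟨q, ⟨F, -, hF⟩, h⟩ := hg [σ] (fun e => i e.1) (hi [σ] (fun e => e.1) Rep.fst)
  refine ⟨Model.lam fun x => Model.regular (F () ⊡ x), fun x => ?_⟩
  rw [lam_app (by fun_prop)]
  refine ⟨isReal_regular _, ?_⟩
  exact (proj_regular _).trans ((congrArg proj (hF (x, ())).symm).trans (h (x, ())).symm)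

@[fun_prop] theorem Internal.lim {a : X → M.N → M.Q}
    (ha : Internal M (fun p : X × M.N => a p.1 p.2)) : Internal M (fun x => lim (a x)) := by
  classical
  have h₀ (x : X) : Internal M (a x) := ha.right x
  -- Being Cauchy is arithmetical, so sequences without limit can be replaced internally by zero, in
  -- accordance with the default value of `lim`; then a modulus of convergence is found with
  -- `least`.
  have h (x : X) : Model.lim (a x) = proj (fast fun n => if IsCauchy (a x) then a x n else 0) := by
    have := h₀ x
    by_cases hx : IsCauchy (a x)
    · simp only [if_pos hx, proj_fast this hx]
    · rw [Model.lim, dif_neg (by simp [hx])]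
      simp only [if_neg hx]
      rw [proj_fast (.const 0) (.const 0), lim_const, map_zero]
  simp only [h]
  unfold fast modulus
  fun_prop

@[fun_prop] theorem Internal.ltR {f g : X → M.R} (hf : Internal M f) (hg : Internal M g) :
    Internal M (fun x => f x < g x) := by
  have : Internal M (fun p : M.R × M.R => p.1 < p.2) := by
    refine .of_proj₂ ?_
    have h (x y : M.T ty1) : proj x < proj y ↔ ∃ k m, ∀ n, m ≤ n → Model.appr x n + ip k < Model.appr y n :=
      lim_lt (internal_appr _) (isCauchy_appr _) (internal_appr _) (isCauchy_appr _)
    simp only [h]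
    fun_prop
  exact this.comp (hf.prodMk hg)

@[fun_prop] theorem Internal.leR {f g : X → M.R} (hf : Internal M f) (hg : Internal M g) :
    Internal M (fun x => f x ≤ g x) := by
  simp only [← not_lt]
  fun_prop

@[fun_prop] theorem Internal.eqR {f g : X → M.R} (hf : Internal M f) (hg : Internal M g) :
    Internal M (fun x => f x = g x) := by
  simp only [le_antisymm_iff]
  fun_prop

@[fun_prop] theorem Internal.addR {f g : X → M.R} (hf : Internal M f) (hg : Internal M g) :
    Internal M (fun x => f x + g x) := by
  have : Internal M (fun p : M.R × M.R => p.1 + p.2) := by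
    refine .of_proj₂ ?_
    have h (x y : M.T ty1) : proj x + proj y = Model.lim fun n => Model.appr x n + Model.appr y n :=
      (lim_add (internal_appr _) (isCauchy_appr _) (internal_appr _) (isCauchy_appr _)).symm
    simp only [h]
    fun_prop
  exact this.comp (hf.prodMk hg)

@[fun_prop] theorem Internal.mulR {f g : X → M.R} (hf : Internal M f) (hg : Internal M g) :
    Internal M (fun x => f x * g x) := by
  have : Internal M (fun p : M.R × M.R => p.1 * p.2) := by
    refine .of_proj₂ ?_
    have h (x y : M.T ty1) : proj x * proj y = Model.lim fun n => Model.appr x n * Model.appr y n :=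
      (lim_mul (internal_appr _) (isCauchy_appr _) (internal_appr _) (isCauchy_appr _)).symm
    simp only [h]
    fun_prop
  exact this.comp (hf.prodMk hg)

@[fun_prop] theorem Internal.negR {f : X → M.R} (hf : Internal M f) :
    Internal M (fun x => -f x) := by
  simp only [neg_eq_neg_one_mul (f _)]
  fun_prop

@[fun_prop] theorem Internal.subR {f g : X → M.R} (hf : Internal M f) (hg : Internal M g) :
    Internal M (fun x => f x - g x) := by
  simp only [sub_eq_add_neg]
  fun_prop

@[fun_prop] theorem Internal.divR {f : X → M.R} (hf : Internal M f) (c : M.R) :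
    Internal M (fun x => f x / c) := by
  simp only [div_eq_mul_inv]
  fun_prop

@[fun_prop] theorem Internal.ofQ {f : X → M.Q} (hf : Internal M f) :
    Internal M (fun x => ofQ M (f x)) := by
  simp only [← lim_const]
  fun_prop

@[fun_prop] theorem Internal.iteR {P : X → Prop} [DecidablePred P] {f g : X → M.R}
    (hP : Internal M P) (hf : Internal M f) (hg : Internal M g) :
    Internal M (fun x => if P x then f x else g x) := by
  classical
  -- The case distinction is moved into a rational factor, where it is known to be internal.
  have h (x : X) : (if P x then f x else g x) =
      Model.ofQ M (if P x then 1 else 0) * (f x - g x) + g x := by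
    split_ifs <;> simp
  simp only [h]
  fun_prop

@[fun_prop] theorem Internal.maxR {f g : X → M.R} (hf : Internal M f) (hg : Internal M g) :
    Internal M (fun x => max (f x) (g x)) := by
  simp only [max_def]
  fun_prop

@[fun_prop] theorem Internal.minR {f g : X → M.R} (hf : Internal M f) (hg : Internal M g) :
    Internal M (fun x => min (f x) (g x)) := by
  simp only [min_def]
  fun_prop

@[fun_prop] theorem Internal.absR {f : X → M.R} (hf : Internal M f) :
    Internal M (fun x => |f x|) := by
  simp only [abs]
  fun_prop

variable (M) in
/-- The embedding of the numbers into the reals. -/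
noncomputable def ofN : M.N →+* M.R := (ofQ M).comp toQ

@[fun_prop] theorem Internal.ofN {f : X → M.N} (hf : Internal M f) :
    Internal M (fun x => ofN M (f x)) :=
  Internal.ofQ (f := fun x => Model.toQ (f x)) (by fun_prop)

theorem ofN_lt {m n : M.N} : ofN M m < ofN M n ↔ m < n := ofQ_lt.trans toQ_lt

theorem ofN_le {m n : M.N} : ofN M m ≤ ofN M n ↔ m ≤ n := ofQ_le.trans toQ_le

theorem ofN_nonneg (n : M.N) : 0 ≤ ofN M n := by
  rw [← map_zero (ofN M), ofN_le]
  exact zero_le' n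

theorem exists_lt_ofN (r : M.R) : ∃ n, r < ofN M n := by
  obtain ⟨a, h, h', rfl⟩ := exists_lim_eq r
  obtain ⟨B, hB, m, hm⟩ := h'.bounded
  obtain ⟨n, hn⟩ := exists_lt_toQ (B + 1)
  refine ⟨n, ?_⟩
  change _ < ofQ M (toQ n)
  rw [← lim_const, lim_lt h h' (.const _) (.const _)]
  refine ⟨0, m, fun i hi => ?_⟩
  rw [ip_zero]
  linarith [le_abs_self (a i), hm i hi]

/-- The real `2 ^ (-n)`. -/
noncomputable def hp (n : M.N) : M.R := ofQ M (ip n)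

theorem hp_pos (n : M.N) : 0 < hp n := by
  rw [hp, ← map_zero (ofQ M), ofQ_lt]
  exact ip_pos n

theorem ofN_pw_mul_hp (n : M.N) : ofN M (pw n) * hp n = 1 := by
  change ofQ M _ * ofQ M _ = 1
  rw [← map_mul, ip, mul_inv_cancel₀ (toQ_ne_zero (pw_ne_zero n)), map_one]

theorem exists_hp_lt {r : M.R} (h : 0 < r) : ∃ n, hp n < r := by
  obtain ⟨n, hn⟩ := exists_lt_ofN r⁻¹
  refine ⟨n, ?_⟩
  have h₁ : ofN M n < ofN M (pw n) := ofN_lt.2 (lt_pw n)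
  have h₂ := ofN_pw_mul_hp n
  have h₃ := hp_pos n
  have h₄ : 1 < ofN M (pw n) * r := by
    rw [← div_lt_iff₀ h, one_div]
    exact hn.trans h₁
  by_contra! h₅
  have h₆ := mul_le_mul_of_nonneg_left h₅ (ofN_nonneg (pw n))
  linarith

/-! ### Finite sums -/

/-- Partial sums of a sequence of reals that is given by codes. -/
noncomputable def codeSum (c : M.T (ty0 ⇾ ty1)) (n : M.N) : M.R :=
  lim fun k => qrec (fun i s => s + appr (c ⊡ i) k) 0 n

@[fun_prop] theorem Internal.codeSum {f : X → M.T (ty0 ⇾ ty1)} {g : X → M.N} (hf : Internal M f)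
    (hg : Internal M g) : Internal M (fun x => codeSum (f x) (g x)) := by
  unfold Model.codeSum
  fun_prop

/-- The errors of `n` terms add up to at most `n * 2 ^ (-k)`, and `n` is fixed while `k` grows. -/
theorem isCauchy_qrec (c : M.T (ty0 ⇾ ty1)) (n : M.N) :
    IsCauchy fun k => qrec (fun i s => s + appr (c ⊡ i) k) 0 n := by
  refine isCauchy_of_appr_lt (c := toQ n) fun k k' hk => ?_
  refine induction (P := fun n => |qrec (fun i s => s + appr (c ⊡ i) k) 0 n -
    qrec (fun i s => s + appr (c ⊡ i) k') 0 n| ≤ toQ n * ip k) (by fun_prop) (by simp)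
    (fun n ih => ?_) n
  rw [qrec_succ (by fun_prop), qrec_succ (by fun_prop), map_add, map_one, add_mul, one_mul]
  have := appr_lt_of_le (c ⊡ n) hk
  rw [abs_lt] at this
  rw [abs_le] at *
  constructor <;> linarith

theorem codeSum_zero (c : M.T (ty0 ⇾ ty1)) : codeSum c 0 = 0 := by
  simp only [codeSum, qrec_zero, lim_const, map_zero]

theorem codeSum_succ (c : M.T (ty0 ⇾ ty1)) (n : M.N) :
    codeSum c (n + 1) = codeSum c n + proj (c ⊡ n) := by
  have h (k : M.N) : qrec (fun i s => s + appr (c ⊡ i) k) 0 (n + 1) =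
      qrec (fun i s => s + appr (c ⊡ i) k) 0 n + appr (c ⊡ n) k := qrec_succ (by fun_prop) _ _
  simp only [codeSum, h]
  exact lim_add (by fun_prop) (isCauchy_qrec c n) (internal_appr _) (isCauchy_appr _)

/-- The sum of the first `n` terms of an internal sequence of reals. -/
noncomputable def sum (n : M.N) (a : M.N → M.R) : M.R :=
  codeSum (Classical.epsilon fun c => ∀ i, proj (c ⊡ i) = a i) n

/-- An internal sequence of partial sums is unique. -/
theorem eq_of_succ {s t : M.N → M.R} {a : M.N → M.R} (hs : Internal M s) (ht : Internal M t)
    (h₀ : s 0 = t 0) (h₁ : ∀ n, s (n + 1) = s n + a n) (h₂ : ∀ n, t (n + 1) = t n + a n)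
    (n : M.N) : s n = t n :=
  induction (P := fun n => s n = t n) (by fun_prop) h₀ (fun n ih => by rw [h₁, h₂, ih]) n

/-- Partial sums are determined by their recursion, by internal induction. Hence the code picked in
the definition of `sum` is immaterial. -/
theorem sum_eq_codeSum {a : M.N → M.R} {c : M.T (ty0 ⇾ ty1)} (h : ∀ i, proj (c ⊡ i) = a i)
    (n : M.N) : sum n a = codeSum c n := by
  have := Classical.epsilon_spec (p := fun c : M.T (ty0 ⇾ ty1) => ∀ i, proj (c ⊡ i) = a i) ⟨c, h⟩
  refine eq_of_succ (s := fun n => sum n a) (a := a) (by unfold sum; fun_prop) (by fun_prop) ?_ ?_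
    ?_ n
  · simp only [sum, codeSum_zero]
  · intro n
    simp only [sum]
    rw [codeSum_succ, this]
  · intro n
    rw [codeSum_succ, h]

@[simp] theorem sum_zero (a : M.N → M.R) : sum 0 a = 0 := codeSum_zero _

theorem sum_succ {a : M.N → M.R} (ha : Internal M a) (n : M.N) :
    sum (n + 1) a = sum n a + a n := by
  obtain ⟨c, hc⟩ := ha.exists_fn .id
  have hc (i : M.N) := (hc i).2
  rw [sum_eq_codeSum hc, sum_eq_codeSum hc, codeSum_succ, hc]

-- Abstracting the summation index in a lift of `a` gives codes of the sequences that depend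
-- internally on the parameters; the codes picked separately for each sequence would not.
@[fun_prop] theorem Internal.sum {a : X → M.N → M.R} {n : X → M.N}
    (ha : Internal M (fun p : X × M.N => a p.1 p.2)) (hn : Internal M n) :
    Internal M (fun x => sum (n x) (a x)) := by
  intro Γ p hp
  obtain ⟨q, ⟨F, hF, hF'⟩, h⟩ := ha (ty0 :: Γ) (fun e => (p e.2, e.1)) ⟨Dfl.weaken hp, Rep.fst⟩
  have h (e : Env M Γ) : Model.sum (n (p e)) (a (p e)) = Model.codeSum (F e) (n (p e)) :=
    sum_eq_codeSum (fun i => by rw [← hF' (i, e), ← h]) _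
  have hi : Internal M (fun p : M.T (ty0 ⇾ ty1) × M.N => Model.codeSum p.1 p.2) := by fun_prop
  simp only [h]
  exact hi Γ (fun e => (F e, n (p e))) ⟨hF, hn Γ p hp⟩

end Model
end HOA

namespace HOA
namespace Model

variable {M : Model} {V W : Ty → Type}

/-! ### The interpretation of rational and real numbers of the language -/

variable (M) in
/-- Triples of numbers. -/
@[ext] structure Triple where
  /-- positive part of the numerator -/
  pos : M.N
  /-- negative part of the numerator -/
  neg : M.N
  /-- denominator -/
  den : M.N

namespace Triple

/-- The rational number given by a triple. -/
noncomputable def toQ (x : M.Triple) : M.Q := (Model.toQ x.pos - Model.toQ x.neg) / Model.toQ x.den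

instance : Add M.Triple := ⟨fun x y =>
  ⟨x.pos * y.den + y.pos * x.den, x.neg * y.den + y.neg * x.den, x.den * y.den⟩⟩
instance : Mul M.Triple := ⟨fun x y =>
  ⟨x.pos * y.pos + x.neg * y.neg, x.pos * y.neg + x.neg * y.pos, x.den * y.den⟩⟩
instance : Neg M.Triple := ⟨fun x => ⟨x.neg, x.pos, x.den⟩⟩
instance : LT M.Triple :=
  ⟨fun x y => x.pos * y.den + y.neg * x.den < y.pos * x.den + x.neg * y.den⟩

/-- The triple of a code. -/
noncomputable def ofCode (c : M.N) : M.Triple := ⟨posPart' c, negPart' c, denom c⟩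

/-- The triple for `2 ^ (-n)`. -/
noncomputable def ip (n : M.N) : M.Triple := ⟨1, 0, pw n⟩

variable {x y : M.Triple}

theorem lt_iff (hx : x.den ≠ 0) (hy : y.den ≠ 0) : x < y ↔ x.toQ < y.toQ := by
  rw [toQ, toQ, div_lt_div_iff₀ (toQ_pos hx) (toQ_pos hy)]
  change x.pos * y.den + y.neg * x.den < y.pos * x.den + x.neg * y.den ↔ _
  rw [← toQ_lt]
  simp only [map_add, map_mul]
  constructor <;> intro h <;> linarith

theorem toQ_add (hx : x.den ≠ 0) (hy : y.den ≠ 0) : (x + y).toQ = x.toQ + y.toQ := by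
  rw [toQ, toQ, toQ, div_add_div _ _ (toQ_ne_zero hx) (toQ_ne_zero hy)]
  change (Model.toQ (_ * _ + _ * _) - Model.toQ (_ * _ + _ * _)) / Model.toQ (_ * _) = _
  simp only [map_add, map_mul]
  congr 1
  ring

theorem toQ_mul : (x * y).toQ = x.toQ * y.toQ := by
  rw [toQ, toQ, toQ, div_mul_div_comm]
  change (Model.toQ (_ * _ + _ * _) - Model.toQ (_ * _ + _ * _)) / Model.toQ (_ * _) = _
  simp only [map_add, map_mul]
  congr 1
  ring

theorem toQ_neg : (-x).toQ = -x.toQ := by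
  rw [toQ, toQ, ← neg_div, neg_sub]
  rfl

theorem den_add (hx : x.den ≠ 0) (hy : y.den ≠ 0) : (x + y).den ≠ 0 := mul_ne_zero hx hy

theorem den_mul (hx : x.den ≠ 0) (hy : y.den ≠ 0) : (x * y).den ≠ 0 := mul_ne_zero hx hy

theorem den_neg (hx : x.den ≠ 0) : (-x).den ≠ 0 := hx

theorem den_ofCode (c : M.N) : (ofCode c).den ≠ 0 := denom_ne_zero c

theorem toQ_ofCode (c : M.N) : (ofCode c).toQ = dec c := rfl

theorem den_ip (n : M.N) : (ip n).den ≠ 0 := pw_ne_zero n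

theorem toQ_ip (n : M.N) : (ip n).toQ = Model.ip n := by
  rw [toQ, ip, Model.ip, map_one, map_zero, sub_zero, one_div]

theorem sub_lt_iff {z : M.Triple} (hx : x.den ≠ 0) (hy : y.den ≠ 0) (hz : z.den ≠ 0) :
    x + -y < z ↔ x.toQ - y.toQ < z.toQ := by
  rw [lt_iff (den_add hx (den_neg hy)) hz, toQ_add hx (den_neg hy), toQ_neg, sub_eq_add_neg]

theorem lt_sub_iff {z : M.Triple} (hx : x.den ≠ 0) (hy : y.den ≠ 0) (hz : z.den ≠ 0) :
    z < x + -y ↔ z.toQ < x.toQ - y.toQ := by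
  rw [lt_iff hz (den_add hx (den_neg hy)), toQ_add hx (den_neg hy), toQ_neg, sub_eq_add_neg]

end Triple

section
variable (e : ∀ σ, V σ → M.T σ)

/-- The value of a triple of terms. -/
def _root_.HOA.Frac.val (F : Frac V) : M.Triple := ⟨F.pos.val e, F.neg.val e, F.den.val e⟩

variable {e}

@[simp] theorem frac_val_add (F G : Frac V) : (F + G).val e = F.val e + G.val e := rfl
@[simp] theorem frac_val_mul (F G : Frac V) : (F * G).val e = F.val e * G.val e := rfl
@[simp] theorem frac_val_neg (F : Frac V) : (-F).val e = -F.val e := rfl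

@[simp] theorem frac_val_powNeg (n : Tm V ty0) : (Frac.powNeg n).val e = .ip (n.val e) := by
  rw [Triple.ip, ← val_pow2]
  rfl

@[simp] theorem frac_val_powNegSucc (n : Tm V ty0) :
    (Frac.powNegSucc n).val e = ⟨1 + 1, 0, pw (n.val e)⟩ := by
  rw [← val_pow2]
  rfl

@[simp] theorem frac_val_ofNat (n : Tm V ty0) : (Frac.ofNat n).val e = ⟨n.val e, 0, 1⟩ := rfl

@[simp] theorem frac_val_up_refl (F : Frac V) : (F.up : Frac V).val e = F.val e := by
  simp [Frac.up, Frac.val]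

@[simp] theorem frac_val_up_step [Lift V W] {ρ : Ty} (m : M.T ρ) (e : ∀ σ, W σ → M.T σ)
    (F : Frac V) : (F.up : Frac (Ext W ρ)).val (Ext.val m e) = (F.up : Frac W).val e := by
  simp [Frac.up, Frac.val]

@[simp] theorem sat_fracLt (F G : Frac V) : (F.lt G).Sat M.T e ↔ F.val e < G.val e := Iff.rfl

@[simp] theorem sat_fracLe (F G : Frac V) : (F.le G).Sat M.T e ↔ ¬ G.val e < F.val e := Iff.rfl

@[simp] theorem sat_same (F G : Frac V) : (F.same G).Sat M.T e ↔ F.val e = G.val e := by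
  simp [Frac.same, Frac.val, Triple.ext_iff]

@[simp] theorem sat_codes (c : Tm V ty0) (F : Frac V) :
    (codes c F).Sat M.T e ↔ F.val e = .ofCode (c.val e) := by
  trans Codes (c.val e) (F.pos.val e) (F.neg.val e) (F.den.val e)
  · simp [codes, Codes, two, one_add_one_eq_two]
  · rw [codes_iff, Frac.val, Triple.ofCode, Triple.ext_iff]

theorem exists_triple {P : M.Triple → Prop} : (∃ x, P x) ↔ ∃ p q d, P ⟨p, q, d⟩ :=
  ⟨fun ⟨x, h⟩ => ⟨x.pos, x.neg, x.den, h⟩, fun ⟨_, _, _, h⟩ => ⟨_, h⟩⟩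

theorem forall_triple {P : M.Triple → Prop} : (∀ x, P x) ↔ ∀ p q d, P ⟨p, q, d⟩ :=
  ⟨fun h _ _ _ => h _, fun h x => h x.pos x.neg x.den⟩

/-- Evaluation in the scope of three additional quantifiers. -/
def val₃ (x : M.Triple) (e : ∀ σ, V σ → M.T σ) :
    ∀ σ, Ext (Ext (Ext V ty0) ty0) ty0 σ → M.T σ :=
  Ext.val x.den (Ext.val x.neg (Ext.val x.pos e))

/-- The triple of the last three variables. -/
def frac₃ : Frac (Ext (Ext (Ext V ty0) ty0) ty0) :=
  ⟨.var (.old (.old .new)), .var (.old .new), .var .new⟩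

@[simp] theorem val_frac₃ (x : M.Triple) : frac₃.val (val₃ x e) = x := rfl

@[simp] theorem frac_val_up_val₃ [Lift V W] (x : M.Triple) (e : ∀ σ, W σ → M.T σ)
    (F : Frac V) : (F.up : Frac (Ext (Ext (Ext W ty0) ty0) ty0)).val (val₃ x e) =
      (F.up : Frac W).val e := by
  simp [val₃]

@[simp] theorem val_up_val₃ [Lift V W] (x : M.Triple) (e : ∀ σ, W σ → M.T σ) {σ : Ty}
    (t : Tm V σ) : (t.up : Tm (Ext (Ext (Ext W ty0) ty0) ty0) σ).val (val₃ x e) =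
      (t.up : Tm W σ).val e := by
  simp [val₃]

@[simp] theorem lift_refl {σ : Ty} (v : V σ) : (Lift.lift σ v : V σ) = v := rfl

@[simp] theorem val_lift [Lift V W] {ρ σ : Ty} (m : M.T ρ) (e : ∀ σ, W σ → M.T σ) (v : V σ) :
    Ext.val m e σ (Lift.lift σ v) = e σ (Lift.lift σ v) := rfl

@[simp] theorem val₃_lift [Lift V W] {σ : Ty} (x : M.Triple) (e : ∀ σ, W σ → M.T σ) (v : V σ) :
    val₃ x e σ (Lift.lift σ v) = e σ (Lift.lift σ v) := rfl

@[simp] theorem sat_allFrac (φ : Frac (Ext (Ext (Ext V ty0) ty0) ty0) → Fm _) :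
    (AllFrac φ).Sat M.T e ↔ ∀ x : M.Triple, (φ frac₃).Sat M.T (val₃ x e) := by
  rw [forall_triple]
  rfl

@[simp] theorem sat_exFrac (φ : Frac (Ext (Ext (Ext V ty0) ty0) ty0) → Fm _) :
    (ExFrac φ).Sat M.T e ↔ ∃ x : M.Triple, (φ frac₃).Sat M.T (val₃ x e) := by
  rw [exists_triple]
  simp only [ExFrac, sat_ex]
  rfl

@[simp] theorem sat_isReal (x : Tm V ty1) : (HOA.isReal x).Sat M.T e ↔ IsReal (x.val e) := by
  simp [isReal, IsReal, abs_lt, Triple.sub_lt_iff, Triple.den_ofCode, Triple.den_ip, Triple.toQ_ofCode,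
    Triple.toQ_ip]
  refine forall_congr' fun n => forall_congr' fun i => ?_
  constructor
  · rintro ⟨h, h'⟩
    constructor <;> linarith
  · rintro ⟨h, h'⟩
    constructor <;> linarith

/-- Passes between convergence to zero and the explicit bound of the definition of equality. For the
bound at `n`, compare both terms with those at a large `n + m`: regularity costs `2 ^ (-n)` on each
side. -/
theorem proj_eq_iff {x y : M.T ty1} (hx : IsReal x) (hy : IsReal y) :
    proj x = proj y ↔ ∀ n, |dec (x ⊡ n) - dec (y ⊡ n)| ≤ 2 * ip n := by
  rw [proj, proj, lim_eq (internal_appr _) (isCauchy_appr _),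
    lim_eq (internal_appr _) (isCauchy_appr _), R.mk_eq]
  simp only [hx.appr_eq, hy.appr_eq]
  constructor
  · intro h n
    refine le_of_forall_pos_le_add fun ε hε => ?_
    obtain ⟨m, hm⟩ := h ε hε
    have h₁ := hm (n + m) le_add_self
    have h₂ := hx n m
    have h₃ := hy n m
    rw [abs_lt] at h₁ h₂ h₃
    rw [abs_le]
    constructor <;> linarith
  · intro h ε hε
    obtain ⟨k, hk⟩ := exists_ip_lt (half_pos hε)
    exact ⟨k, fun n hn => (h n).trans_lt (by linarith [ip_le_ip hn])⟩

theorem sat_realEq {x y : Tm V ty1} (hx : IsReal (x.val e)) (hy : IsReal (y.val e)) :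
    (realEq x y).Sat M.T e ↔ proj (x.val e) = proj (y.val e) := by
  have h (n : M.N) : Triple.toQ ⟨1 + 1, 0, pw n⟩ = 2 * ip n := by
    rw [Triple.toQ, ip, map_add, map_one, map_zero, sub_zero, div_eq_mul_inv, one_add_one_eq_two]
  simp [realEq, proj_eq_iff hx hy, abs_le, Triple.lt_sub_iff, Triple.den_ofCode, pw_ne_zero,
    Triple.toQ_ofCode, h]
  refine forall_congr' fun n => ?_
  constructor
  · rintro ⟨h, h'⟩
    constructor <;> linarith
  · rintro ⟨h, h'⟩
    constructor <;> linarith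

end

/-! ### The interpretation of polynomial expressions -/

section
variable (e : ∀ σ, V σ → M.T σ)

/-- The value of an expression if each real is replaced by its `n`-th approximation. -/
noncomputable def _root_.HOA.RExp.triple : RExp V → M.N → M.Triple
  | .real x, n => .ofCode (x.val e ⊡ n)
  | .nat a, _ => ⟨a.val e, 0, 1⟩
  | .neg a, n => -a.triple n
  | .add a b, n => a.triple n + b.triple n
  | .mul a b, n => a.triple n * b.triple n

/-- The reals in an expression are represented by regular sequences. -/
def _root_.HOA.RExp.OK : RExp V → Prop
  | .real x => IsReal (x.val e)
  | .nat _ => True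
  | .neg a => a.OK
  | .add a b => a.OK ∧ b.OK
  | .mul a b => a.OK ∧ b.OK

/-- The value of an expression. -/
noncomputable def _root_.HOA.RExp.value : RExp V → M.R
  | .real x => proj (x.val e)
  | .nat a => ofN M (a.val e)
  | .neg a => -a.value
  | .add a b => a.value + b.value
  | .mul a b => a.value * b.value

variable {e}

theorem sat_approx (a : RExp V) {W : Ty → Type} (f : ∀ σ, V σ → W σ) (n : Tm W ty0) (F : Frac W)
    (e : ∀ σ, W σ → M.T σ) : (a.approx f n F).Sat M.T e ↔
      F.val e = a.triple (fun σ v => e σ (f σ v)) (n.val e) := by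
  have neg_eq (x y : M.Triple) : -x = y ↔ x = -y :=
    ⟨fun h => h ▸ rfl, fun h => h ▸ rfl⟩
  induction a generalizing W with
  | real x => simp [RExp.approx, RExp.triple, Tm.val_map]
  | nat a => simp [RExp.approx, RExp.triple, Tm.val_map]
  | neg a ih => simp [RExp.approx, RExp.triple, ih, neg_eq]
  | add a b ha hb =>
    simp [RExp.approx, RExp.triple, ha, hb]
  | mul a b ha hb =>
    simp [RExp.approx, RExp.triple, ha, hb]

theorem den_triple (a : RExp V) (n : M.N) : (a.triple e n).den ≠ 0 := by
  induction a with
  | real x => exact Triple.den_ofCode _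
  | nat a => exact one_ne_zero
  | neg a ih => exact ih
  | add a b ha hb => exact Triple.den_add ha hb
  | mul a b ha hb => exact Triple.den_mul ha hb

theorem lim_neg {a : M.N → M.Q} (h : Internal M a) (h' : IsCauchy a) :
    lim (fun n => -a n) = -lim a := by
  rw [lim_eq h h', lim_eq h.negQ h'.neg, ← map_neg]
  rfl

/-- Evaluating an expression termwise gives an internal Cauchy sequence with the expected limit. The
formal order, which speaks of rational approximations, thereby becomes the order of the field of
reals. -/
theorem lim_triple {a : RExp V} (ha : a.OK e) : Internal M (fun n => (a.triple e n).toQ) ∧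
    IsCauchy (fun n => (a.triple e n).toQ) ∧
    lim (fun n => (a.triple e n).toQ) = a.value e := by
  induction a with
  | real x =>
    have : (fun n => ((RExp.real x).triple e n).toQ) = appr (x.val e) := by
      funext n
      rw [IsReal.appr_eq ha]
      rfl
    rw [this]
    exact ⟨internal_appr _, isCauchy_appr _, rfl⟩
  | nat a =>
    have (n : M.N) : ((RExp.nat a).triple e n).toQ = toQ (a.val e) := by
      simp [RExp.triple, Triple.toQ]
    simp only [this]
    exact ⟨.const _, .const _, lim_const _⟩
  | neg a ih =>
    obtain ⟨h₁, h₂, h₃⟩ := ih ha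
    simp only [RExp.triple, RExp.value, Triple.toQ_neg]
    exact ⟨h₁.negQ, h₂.neg, by rw [lim_neg h₁ h₂, h₃]⟩
  | add a b iha ihb =>
    obtain ⟨h₁, h₂, h₃⟩ := iha ha.1
    obtain ⟨h₁', h₂', h₃'⟩ := ihb ha.2
    simp only [RExp.triple, RExp.value, Triple.toQ_add (den_triple _ _) (den_triple _ _)]
    exact ⟨h₁.addQ h₁', h₂.add h₂', by rw [lim_add h₁ h₂ h₁' h₂', h₃, h₃']⟩
  | mul a b iha ihb =>
    obtain ⟨h₁, h₂, h₃⟩ := iha ha.1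
    obtain ⟨h₁', h₂', h₃'⟩ := ihb ha.2
    simp only [RExp.triple, RExp.value, Triple.toQ_mul]
    exact ⟨h₁.mulQ h₁', h₂.mul h₂', by rw [lim_mul h₁ h₂ h₁' h₂', h₃, h₃']⟩

theorem sat_rexp_lt {a b : RExp V} (ha : a.OK e) (hb : b.OK e) :
    (a.lt b).Sat M.T e ↔ a.value e < b.value e := by
  obtain ⟨h₁, h₂, h₃⟩ := lim_triple ha
  obtain ⟨h₁', h₂', h₃'⟩ := lim_triple hb
  rw [← h₃, ← h₃', lim_lt h₁ h₂ h₁' h₂']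
  simp [RExp.lt, sat_approx, Fm.le]
  refine exists_congr fun k => exists_congr fun m => forall_congr' fun n => imp_congr_right
    fun _ => ?_
  rw [← Triple.toQ_ip, ← Triple.toQ_add (den_triple _ _) (Triple.den_ip _), ← Triple.lt_iff
    (Triple.den_add (den_triple _ _) (Triple.den_ip _)) (den_triple _ _)]

theorem sat_rexp_le {a b : RExp V} (ha : a.OK e) (hb : b.OK e) :
    (a.le b).Sat M.T e ↔ a.value e ≤ b.value e := by
  rw [RExp.le, sat_neg, sat_rexp_lt hb ha, not_lt]

theorem sat_rexp_equal {a b : RExp V} (ha : a.OK e) (hb : b.OK e) :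
    (a.equal b).Sat M.T e ↔ a.value e = b.value e := by
  rw [RExp.equal, sat_and, sat_rexp_le ha hb, sat_rexp_le hb ha, le_antisymm_iff]

@[simp] theorem rexp_ok_real (x : Tm V ty1) : (RExp.real x).OK e ↔ IsReal (x.val e) := Iff.rfl
@[simp] theorem rexp_ok_nat (a : Tm V ty0) : (RExp.nat a).OK e := trivial
@[simp] theorem rexp_ok_zero : (0 : RExp V).OK e := trivial
@[simp] theorem rexp_ok_one : (1 : RExp V).OK e := trivial
@[simp] theorem rexp_ok_add (a b : RExp V) : (a + b).OK e ↔ a.OK e ∧ b.OK e := Iff.rfl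
@[simp] theorem rexp_ok_sub (a b : RExp V) : (a - b).OK e ↔ a.OK e ∧ b.OK e := Iff.rfl
@[simp] theorem rexp_ok_mul (a b : RExp V) : (a * b).OK e ↔ a.OK e ∧ b.OK e := Iff.rfl
@[simp] theorem rexp_ok_neg (a : RExp V) : (-a).OK e ↔ a.OK e := Iff.rfl

@[simp] theorem rexp_value_real (x : Tm V ty1) : (RExp.real x).value e = proj (x.val e) := rfl
@[simp] theorem rexp_value_nat (a : Tm V ty0) : (RExp.nat a).value e = ofN M (a.val e) := rfl
@[simp] theorem rexp_value_zero : (0 : RExp V).value e = 0 := map_zero _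
@[simp] theorem rexp_value_one : (1 : RExp V).value e = 1 := map_one _
@[simp] theorem rexp_value_add (a b : RExp V) : (a + b).value e = a.value e + b.value e := rfl
@[simp] theorem rexp_value_sub (a b : RExp V) : (a - b).value e = a.value e - b.value e :=
  (sub_eq_add_neg _ _).symm
@[simp] theorem rexp_value_mul (a b : RExp V) : (a * b).value e = a.value e * b.value e := rfl
@[simp] theorem rexp_value_neg (a : RExp V) : (-a).value e = -a.value e := rfl

@[simp] theorem sat_le (s t : Tm V ty0) : (Fm.le s t).Sat M.T e ↔ s.val e ≤ t.val e := by
  rw [Fm.le, sat_neg, sat_lt, struct_lt, not_lt]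

@[simp] theorem sat_allReal (φ : Tm (Ext V ty1) ty1 → Fm (Ext V ty1)) :
    (AllReal φ).Sat M.T e ↔ ∀ x, IsReal x → (φ (.var .new)).Sat M.T (Ext.val x e) := by
  simp [AllReal]

@[simp] theorem sat_exReal (φ : Tm (Ext V ty1) ty1 → Fm (Ext V ty1)) :
    (ExReal φ).Sat M.T e ↔ ∃ x, IsReal x ∧ (φ (.var .new)).Sat M.T (Ext.val x e) := by
  simp [ExReal]

end
end Model
end HOA

namespace HOA
namespace Model

variable {M : Model} {V W : Ty → Type}

/-! ### Functions of reals -/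

/-- A representative of a real. -/
noncomputable def code (r : M.R) : M.T ty1 := (exists_code r).choose

theorem isReal_code (r : M.R) : IsReal (code r) := (exists_code r).choose_spec.1

@[simp] theorem proj_code (r : M.R) : proj (code r) = r := (exists_code r).choose_spec.2

/-- The element of the unit interval that is closest to a real. -/
noncomputable def clamp (r : M.R) : M.R := max 0 (min r 1)

theorem clamp_nonneg (r : M.R) : 0 ≤ clamp r := le_max_left _ _

theorem clamp_le_one (r : M.R) : clamp r ≤ 1 := max_le zero_le_one (min_le_right _ _)

theorem clamp_eq {r : M.R} (h₀ : 0 ≤ r) (h₁ : r ≤ 1) : clamp r = r := by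
  rw [clamp, min_eq_left h₁, max_eq_right h₀]

@[fun_prop] theorem internal_clamp : Internal M (clamp (M := M)) := by
  unfold clamp
  fun_prop

theorem Internal.of_proj' {Y : Type} [Dfl M Y] {f : M.R → Y}
    (hf : Internal M (fun x => f (proj x))) : Internal M f := by
  rintro Γ p ⟨q, hq, h⟩
  have := hf Γ q hq
  simpa only [← h] using this

/-- `f` represents a function on the unit interval. -/
def FunI (f : M.T (ty1 ⇾ ty1)) : Prop :=
  (∀ x, IsReal x → 0 ≤ proj x ∧ proj x ≤ 1 → IsReal (f ⊡ x)) ∧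
  ∀ x, IsReal x → ∀ y, IsReal y → 0 ≤ proj x ∧ proj x ≤ 1 → 0 ≤ proj y ∧ proj y ≤ 1 →
    proj x = proj y → proj (f ⊡ x) = proj (f ⊡ y)

/-- The function on the unit interval represented by `f`, extended by constants. -/
noncomputable def fnI (f : M.T (ty1 ⇾ ty1)) (r : M.R) : M.R := proj (f ⊡ code (clamp r))

theorem FunI.proj_eq {f : M.T (ty1 ⇾ ty1)} (hf : FunI f) {x : M.T ty1} (hx : IsReal x)
    (hI : 0 ≤ proj x ∧ proj x ≤ 1) : proj (f ⊡ x) = fnI f (proj x) := by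
  have h : clamp (proj x) = proj x := clamp_eq hI.1 hI.2
  rw [fnI, h]
  refine hf.2 _ hx _ (isReal_code _) hI ?_ ?_ <;> rw [proj_code]
  exact hI

/-- The representative `code` in `fnI` need not be internal. As `f` respects equality of reals, it
may be replaced by one computed by an object `F` of the model. -/
theorem FunI.internal {f : M.T (ty1 ⇾ ty1)} (hf : FunI f) : Internal M (fnI f) := by
  obtain ⟨F, hF⟩ := Internal.exists_fn (M := M) (g := fun x => clamp (proj x)) (by fun_prop) .id
  refine .of_proj' ?_
  have h (x : M.T ty1) : fnI f (proj x) = proj (f ⊡ (F ⊡ x)) := by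
    rw [hf.proj_eq (hF x).1, (hF x).2, fnI, fnI, clamp_eq (r := clamp _) (clamp_nonneg _)
      (clamp_le_one _)]
    rw [(hF x).2]
    exact ⟨clamp_nonneg _, clamp_le_one _⟩
  simp only [h]
  fun_prop

/-- `f` represents a function on the reals. -/
def FunR (f : M.T (ty1 ⇾ ty1)) : Prop :=
  (∀ x, IsReal x → IsReal (f ⊡ x)) ∧
  ∀ x, IsReal x → ∀ y, IsReal y → proj x = proj y → proj (f ⊡ x) = proj (f ⊡ y)

/-- The function on the reals represented by `f`. -/
noncomputable def fnR (f : M.T (ty1 ⇾ ty1)) (r : M.R) : M.R := proj (f ⊡ code r)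

theorem FunR.proj_eq {f : M.T (ty1 ⇾ ty1)} (hf : FunR f) {x : M.T ty1} (hx : IsReal x) :
    proj (f ⊡ x) = fnR f (proj x) :=
  hf.2 _ hx _ (isReal_code _) (proj_code _).symm

theorem FunR.internal {f : M.T (ty1 ⇾ ty1)} (hf : FunR f) : Internal M (fnR f) := by
  refine .of_proj' ?_
  have h (x : M.T ty1) : fnR f (proj x) = proj (f ⊡ regular x) := by
    rw [hf.proj_eq (isReal_regular x), proj_regular]
  simp only [h]
  fun_prop

/-- Internal functions on the reals are represented by objects of the model. -/
theorem exists_funR {g : M.R → M.R} (hg : Internal M g) :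
    ∃ f, FunR f ∧ FunI f ∧ (∀ r, fnR f r = g r) ∧ ∀ r, fnI f r = g (clamp r) := by
  obtain ⟨F, hF⟩ := Internal.exists_fn (M := M) (g := fun x => g (proj x)) (by fun_prop) .id
  have hF (x : M.T ty1) : IsReal (F ⊡ x) ∧ proj (F ⊡ x) = g (proj x) := hF x
  refine ⟨F, ⟨fun x _ => (hF x).1, fun x _ y _ h => ?_⟩,
    ⟨fun x _ _ => (hF x).1, fun x _ y _ _ _ h => ?_⟩, fun r => ?_, fun r => ?_⟩
  · rw [(hF x).2, (hF y).2, h]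
  · rw [(hF x).2, (hF y).2, h]
  · rw [fnR, (hF _).2, proj_code]
  · rw [fnI, (hF _).2, proj_code]

theorem exists_seq {a : M.N → M.R} (ha : Internal M a) :
    ∃ c : M.T (ty0 ⇾ ty1), ∀ i, IsReal (c ⊡ i) ∧ proj (c ⊡ i) = a i := ha.exists_fn .id

/-- The sentences express finite sums by sequences of partial sums. By induction their values up to
`m` are those of `sum`, and `sum` itself provides such a sequence. -/
theorem exists_partialSums_iff {b : M.N → M.R} (hb : Internal M b) {m : M.N} {r : M.R} :
    (∃ s : M.T (ty0 ⇾ ty1), (∀ j ≤ m, IsReal (s ⊡ j)) ∧ proj (s ⊡ (0 : M.N)) = 0 ∧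
      (∀ j < m, proj (s ⊡ (j + 1)) = proj (s ⊡ j) + b j) ∧ r = proj (s ⊡ m)) ↔ r = sum m b := by
  constructor
  · rintro ⟨s, -, h₀, h, rfl⟩
    refine induction (P := fun j => j ≤ m → proj (s ⊡ j) = sum j b) (by fun_prop)
      (fun _ => by rw [h₀, sum_zero]) (fun j ih hj => ?_) m le_rfl
    rw [Order.add_one_le_iff] at hj
    rw [h j hj, ih hj.le, sum_succ hb]
  · rintro rfl
    obtain ⟨s, hs⟩ := exists_seq (a := fun j => sum j b) (by fun_prop)
    refine ⟨s, fun j _ => (hs j).1, ?_, fun j _ => ?_, (hs m).2.symm⟩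
    · rw [(hs 0).2, sum_zero]
    · rw [(hs _).2, (hs _).2, sum_succ hb]

/-! ### The interpretation of the sentences -/

section
variable {e : ∀ σ, V σ → M.T σ}

theorem sat_inI {x : Tm V ty1} (hx : IsReal (x.val e)) :
    (inI x).Sat M.T e ↔ 0 ≤ proj (x.val e) ∧ proj (x.val e) ≤ 1 := by
  rw [inI, sat_and, sat_rexp_le (by simp) (by simpa), sat_rexp_le (by simpa) (by simp)]
  simp

/-- Formal quantifiers over reals range over codes. They may be read as quantifiers over `M.R` as
soon as the matrix depends only on the real represented. -/
theorem sat_allReal_iff {φ : Tm (Ext V ty1) ty1 → Fm (Ext V ty1)} {P : M.R → Prop}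
    (h : ∀ x, IsReal x → ((φ (.var .new)).Sat M.T (Ext.val x e) ↔ P (proj x))) :
    (AllReal φ).Sat M.T e ↔ ∀ r, P r := by
  rw [sat_allReal]
  refine (forall₂_congr h).trans ⟨fun h r => ?_, fun h x _ => h _⟩
  have := h (code r) (isReal_code r)
  rwa [proj_code] at this

theorem sat_exReal_iff {φ : Tm (Ext V ty1) ty1 → Fm (Ext V ty1)} {P : M.R → Prop}
    (h : ∀ x, IsReal x → ((φ (.var .new)).Sat M.T (Ext.val x e) ↔ P (proj x))) :
    (ExReal φ).Sat M.T e ↔ ∃ r, P r := by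
  rw [sat_exReal]
  refine (exists_congr fun x => and_congr_right (h x)).trans
    ⟨fun ⟨x, _, h⟩ => ⟨_, h⟩, fun ⟨r, h⟩ => ⟨code r, isReal_code r, ?_⟩⟩
  rwa [proj_code]

/-- A statement about reals can be evaluated only once its terms are known to represent reals. Each
clause is therefore rewritten under the clauses before it; later evaluations follow the same
pattern. -/
theorem sat_isFunI (f : Tm V (ty1 ⇾ ty1)) : (isFunI f).Sat M.T e ↔ FunI (f.val e) := by
  rw [isFunI, FunI, sat_and, sat_allReal]
  have h : (∀ x, IsReal x → Fm.Sat M.T (inI (Tm.var Ext.new) ⟹ isReal (f↟ ⬝ Tm.var Ext.new))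
      (Ext.val x e)) ↔ ∀ x, IsReal x → 0 ≤ proj x ∧ proj x ≤ 1 → IsReal (f.val e ⊡ x) := by
    refine forall₂_congr fun x hx => ?_
    rw [sat_imp, sat_inI (by simpa), sat_isReal]
    simp
  rw [h, sat_allReal]
  refine and_congr_right fun h' => forall₂_congr fun x hx => ?_
  rw [sat_allReal]
  refine forall₂_congr fun y hy => ?_
  simp only [sat_imp]
  refine imp_congr_ctx ((sat_inI (by simpa)).trans (by simp)) fun h₁ => imp_congr_ctx
    ((sat_inI (by simpa)).trans (by simp)) fun h₂ => imp_congr_ctx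
    ((sat_realEq (by simpa) (by simpa)).trans (by simp)) fun _ => ?_
  refine (sat_realEq ?_ ?_).trans (by simp)
  · simpa using h' x hx h₁
  · simpa using h' y hy h₂

theorem sat_isPosFunI (f : Tm V (ty1 ⇾ ty1)) : (isPosFunI f).Sat M.T e ↔
    FunI (f.val e) ∧ ∀ r, 0 ≤ r ∧ r ≤ 1 → 0 < fnI (f.val e) r := by
  rw [isPosFunI, sat_and, sat_isFunI]
  refine and_congr_right fun h => sat_allReal_iff fun x hx => ?_
  rw [sat_imp, sat_inI (by simpa)]
  simp only [Tm.val_new]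
  refine imp_congr_right fun hI => ?_
  rw [← h.proj_eq hx hI]
  refine (sat_rexp_lt (by simp) ?_).trans (by simp)
  simpa using h.1 x hx hI

theorem sat_isGauge (f : Tm V (ty1 ⇾ ty1)) : (isGauge f).Sat M.T e ↔
    FunR (f.val e) ∧ ∀ r, 0 < fnR (f.val e) r := by
  rw [isGauge, sat_and, sat_and, ← and_assoc]
  refine (and_congr_left' (b := FunR (f.val e)) ?_).trans (and_congr_right fun h => ?_)
  · rw [FunR, sat_allReal]
    refine (and_congr_left' (b := ∀ x, IsReal x → IsReal (f.val e ⊡ x)) (by simp)).trans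
      (and_congr_right fun h' => ?_)
    rw [sat_allReal]
    refine forall₂_congr fun x hx => ?_
    rw [sat_allReal]
    refine forall₂_congr fun y hy => ?_
    rw [sat_imp]
    refine imp_congr_ctx ((sat_realEq (by simpa) (by simpa)).trans (by simp)) fun _ => ?_
    refine (sat_realEq ?_ ?_).trans (by simp)
    · simpa using h' x hx
    · simpa using h' y hy
  · refine sat_allReal_iff fun x hx => ?_
    rw [← h.proj_eq hx]
    refine (sat_rexp_lt (by simp) ?_).trans (by simp)
    simpa using h.1 x hx

/-- `f` is bounded on the unit interval. -/
def BddI (f : M.R → M.R) : Prop := ∃ b, ∀ r, 0 ≤ r ∧ r ≤ 1 → |f r| ≤ ofN M b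

theorem sat_isBddI {f : Tm V (ty1 ⇾ ty1)} (hf : FunI (f.val e)) :
    (isBddI f).Sat M.T e ↔ BddI (fnI (f.val e)) := by
  rw [isBddI, sat_ex]
  refine exists_congr fun b => sat_allReal_iff fun x hx => ?_
  rw [sat_imp, sat_inI (by simpa)]
  simp only [Tm.val_new]
  refine imp_congr_right fun hI => ?_
  have := hf.1 x hx hI
  rw [← hf.proj_eq hx hI, abs_le', sat_and]
  refine and_congr ((sat_rexp_le ?_ (by simp)).trans (by simp))
    ((sat_rexp_le ?_ (by simp)).trans (by simp)) <;> simpa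

/-- `z ∈ J_y`. -/
def InJ (Ψ : M.R → M.R) (y z : M.R) : Prop := y - Ψ y < z ∧ z < y + Ψ y

/-- `z ∈ J_i'`. -/
def InJ' (Ψ : M.R → M.R) (y : M.N → M.R) (i : M.N) (z : M.R) : Prop :=
  InJ Ψ (y i) z ∧ ∀ j < i, ¬ InJ Ψ (y j) z

theorem sat_inJ {Ψ : Tm V (ty1 ⇾ ty1)} {y z : Tm V ty1} (hΨ : FunI (Ψ.val e))
    (hy : IsReal (y.val e)) (hI : 0 ≤ proj (y.val e) ∧ proj (y.val e) ≤ 1)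
    (hz : IsReal (z.val e)) : (inJ Ψ y z).Sat M.T e ↔
      InJ (fnI (Ψ.val e)) (proj (y.val e)) (proj (z.val e)) := by
  have := hΨ.1 _ hy hI
  rw [inJ, sat_and, sat_rexp_lt (by simp [*]) (by simpa), sat_rexp_lt (by simpa) (by simp [*])]
  simp [hΨ.proj_eq hy hI, InJ]

theorem sat_inJ' {Ψ : Tm V (ty1 ⇾ ty1)} {y : Tm V (ty0 ⇾ ty1)} {i : Tm V ty0} {z : Tm V ty1}
    (hΨ : FunI (Ψ.val e)) (hy : ∀ j ≤ i.val e, IsReal (y.val e ⊡ j) ∧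
      (0 ≤ proj (y.val e ⊡ j) ∧ proj (y.val e ⊡ j) ≤ 1)) (hz : IsReal (z.val e)) :
    (inJ' Ψ y i z).Sat M.T e ↔
      InJ' (fnI (Ψ.val e)) (fun j => proj (y.val e ⊡ j)) (i.val e) (proj (z.val e)) := by
  obtain ⟨h₁, h₂⟩ := hy _ le_rfl
  rw [inJ', sat_and, sat_inJ hΨ (by simpa) (by simpa) hz, sat_all, InJ']
  refine and_congr (by simp) (forall_congr' fun j => ?_)
  rw [sat_imp, sat_neg, sat_lt]
  simp only [Tm.val_up_step, Tm.val_up_refl, Tm.val_new, struct_lt]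
  refine imp_congr_right fun hj => not_congr ?_
  obtain ⟨h₁, h₂⟩ := hy j hj.le
  rw [sat_inJ (by simpa) (by simpa) (by simpa) (by simpa)]
  simp

end
end Model
end HOA

/-! ### Lengths, weak compactness and tagged partitions in a model. -/

namespace HOA
namespace Model

variable {M : Model} {V W : Ty → Type}

section
variable {e : ∀ σ, V σ → M.T σ}

open Classical in
/-- `l` is the length of `J_i'`. -/
def IsLength (Ψ : M.R → M.R) (y : M.N → M.R) (i : M.N) (l : M.R) : Prop :=
  ∃ (m : M.N) (c : M.N → M.R) (B : M.N → Prop), Internal M c ∧ Internal M B ∧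
    (∀ j < m, c j ≤ c (j + 1)) ∧ (∀ z, InJ' Ψ y i z → c 0 ≤ z ∧ z ≤ c m) ∧
    (∀ j < m, (B j → ∀ z, c j < z → z < c (j + 1) → InJ' Ψ y i z) ∧
      (¬ B j → ∀ z, c j < z → z < c (j + 1) → ¬ InJ' Ψ y i z)) ∧
    l = sum m fun j => if B j then c (j + 1) - c j else 0

theorem sat_isLengthJ' {Ψ : Tm V (ty1 ⇾ ty1)} {y : Tm V (ty0 ⇾ ty1)} {i : Tm V ty0} {l : Tm V ty1}
    (hΨ : FunI (Ψ.val e)) (hy : ∀ j ≤ i.val e, IsReal (y.val e ⊡ j) ∧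
      (0 ≤ proj (y.val e ⊡ j) ∧ proj (y.val e ⊡ j) ≤ 1)) (hl : IsReal (l.val e)) :
    (isLengthJ' Ψ y i l).Sat M.T e ↔
      IsLength (fnI (Ψ.val e)) (fun j => proj (y.val e ⊡ j)) (i.val e) (proj (l.val e)) := by
  classical
  rw [isLengthJ', sat_ex]
  refine exists_congr fun m => ?_
  rw [sat_ex]
  trans ∃ c : M.T (ty0 ⇾ ty1), ∃ s : M.T (ty0 ⇾ ty1),
    (∀ j ≤ m, IsReal (c ⊡ j) ∧ IsReal (s ⊡ j)) ∧
    (∀ j < m, proj (c ⊡ j) ≤ proj (c ⊡ (j + 1))) ∧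
    (∀ z, InJ' (fnI (Ψ.val e)) (fun j => proj (y.val e ⊡ j)) (i.val e) z →
      proj (c ⊡ (0 : M.N)) ≤ z ∧ z ≤ proj (c ⊡ m)) ∧
    proj (s ⊡ (0 : M.N)) = 0 ∧
    (∀ j < m,
      ((∀ z, proj (c ⊡ j) < z → z < proj (c ⊡ (j + 1)) →
        InJ' (fnI (Ψ.val e)) (fun j => proj (y.val e ⊡ j)) (i.val e) z) ∧
        proj (s ⊡ (j + 1)) = proj (s ⊡ j) + (proj (c ⊡ (j + 1)) - proj (c ⊡ j))) ∨
      ((∀ z, proj (c ⊡ j) < z → z < proj (c ⊡ (j + 1)) →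
        ¬ InJ' (fnI (Ψ.val e)) (fun j => proj (y.val e ⊡ j)) (i.val e) z) ∧
        proj (s ⊡ (j + 1)) = proj (s ⊡ j))) ∧
    proj (l.val e) = proj (s ⊡ m)
  · refine exists_congr fun c => ?_
    rw [sat_ex]
    refine exists_congr fun s => ?_
    rw [sat_and]
    refine (and_congr_left' (b := ∀ j ≤ m, IsReal (c ⊡ j) ∧ IsReal (s ⊡ j)) (by simp)).trans
      (and_congr_right fun h => ?_)
    have hc (j : M.N) (hj : j ≤ m) : IsReal (c ⊡ j) := (h j hj).1
    have hs (j : M.N) (hj : j ≤ m) : IsReal (s ⊡ j) := (h j hj).2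
    have hc' (j : M.N) (hj : j < m) : IsReal (c ⊡ (j + 1)) := hc _ (Order.add_one_le_iff.2 hj)
    have hs' (j : M.N) (hj : j < m) : IsReal (s ⊡ (j + 1)) := hs _ (Order.add_one_le_iff.2 hj)
    have h0 : (0 : M.N) ≤ m := zero_le' m
    simp only [sat_and]
    refine and_congr ?_ (and_congr ?_ (and_congr ?_ (and_congr ?_ ?_)))
    · rw [sat_all]
      refine forall_congr' fun j => ?_
      rw [sat_imp]
      refine imp_congr_ctx (by simp) fun hj => (sat_rexp_le ?_ ?_).trans (by simp)
      · simpa using hc j hj.le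
      · simpa using hc' j hj
    · refine sat_allReal_iff fun x hx => ?_
      rw [sat_imp]
      refine imp_congr ((sat_inJ' (by simpa) (by simpa) (by simpa)).trans (by simp)) ?_
      rw [sat_and]
      refine and_congr ((sat_rexp_le ?_ ?_).trans (by simp)) ((sat_rexp_le ?_ ?_).trans (by simp))
      · simpa using hc _ h0
      · simpa
      · simpa
      · simpa using hc m le_rfl
    · refine (sat_rexp_equal ?_ (by simp)).trans (by simp)
      simpa using hs _ h0
    · rw [sat_all]
      refine forall_congr' fun j => ?_
      rw [sat_imp]
      refine imp_congr_ctx (by simp) fun hj => ?_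
      have h₁ := hc j hj.le
      have h₂ := hc' j hj
      have h₃ := hs j hj.le
      have h₄ := hs' j hj
      rw [sat_or, sat_and, sat_and]
      refine or_congr (and_congr ?_ ?_) (and_congr ?_ ?_)
      · refine sat_allReal_iff fun x hx => ?_
        rw [sat_imp, sat_imp]
        refine imp_congr ((sat_rexp_lt (by simpa) (by simpa)).trans (by simp))
          (imp_congr ((sat_rexp_lt (by simpa) (by simpa)).trans (by simp)) ?_)
        exact (sat_inJ' (by simpa) (by simpa) (by simpa)).trans (by simp)
      · refine (sat_rexp_equal (by simpa) ?_).trans (by simp)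
        simp [*]
      · refine sat_allReal_iff fun x hx => ?_
        rw [sat_imp, sat_imp, sat_neg]
        refine imp_congr ((sat_rexp_lt (by simpa) (by simpa)).trans (by simp))
          (imp_congr ((sat_rexp_lt (by simpa) (by simpa)).trans (by simp)) (not_congr ?_))
        exact (sat_inJ' (by simpa) (by simpa) (by simpa)).trans (by simp)
      · exact (sat_rexp_equal (by simpa) (by simpa)).trans (by simp)
    · refine (sat_rexp_equal (by simpa) ?_).trans (by simp)
      simpa using hs m le_rfl
  · constructor
    · rintro ⟨c, s, h, h₁, h₂, h₃, h₄, h₅⟩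
      -- Whether a cell is counted is read off the partial sums. This is arithmetical, whereas being
      -- contained in `J_i'` involves a quantifier over reals.
      have hB : Internal M fun j => proj (s ⊡ (j + 1)) =
        proj (s ⊡ j) + (proj (c ⊡ (j + 1)) - proj (c ⊡ j)) := by fun_prop
      refine ⟨fun j => proj (c ⊡ j), _, by fun_prop, hB, h₁, h₂, fun j hj => ⟨fun hj' z hz hz' => ?_,
        fun hj' z hz hz' => ?_⟩, ?_⟩
      · rcases h₄ j hj with h | h
        · exact h.1 z hz hz'
        -- The equation for a counted cell and that for a skipped one can both hold only if the cell
        -- has length zero, but it contains `z`.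
        · rw [h.2] at hj'
          linarith
      · rcases h₄ j hj with h | h
        · exact (hj' h.2).elim
        · exact h.1 z hz hz'
      · refine (exists_partialSums_iff (by fun_prop)).1 ⟨s, fun j hj => (h j hj).2, h₃,
          fun j hj => ?_, h₅⟩
        split_ifs with h
        · exact h
        · rcases h₄ j hj with h' | h'
          · exact (h h'.2).elim
          · rw [h'.2, add_zero]
    · rintro ⟨c, B, hc, hB, h₁, h₂, h₃, h₄⟩
      obtain ⟨c', hc'⟩ := exists_seq hc
      obtain ⟨s, hs, hs₀, hs₁, hs₂⟩ := (exists_partialSums_iff (by fun_prop)).2 h₄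
      refine ⟨c', s, fun j hj => ⟨(hc' j).1, hs j hj⟩, ?_⟩
      simp only [(hc' _).2]
      refine ⟨h₁, h₂, hs₀, fun j hj => ?_, hs₂⟩
      rw [hs₁ j hj]
      by_cases h : B j
      · rw [if_pos h]
        exact .inl ⟨(h₃ j hj).1 h, rfl⟩
      · rw [if_neg h, add_zero]
        exact .inr ⟨(h₃ j hj).2 h, rfl⟩

theorem sat_isSum {k : Tm V ty0} {a : Tm V (ty0 ⇾ ty1)} {S : Tm V ty1}
    (ha : ∀ i ≤ k.val e, IsReal (a.val e ⊡ i)) (hS : IsReal (S.val e)) :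
    (isSum k a S).Sat M.T e ↔
      proj (S.val e) = sum (k.val e + 1) fun i => proj (a.val e ⊡ i) := by
  rw [isSum, sat_ex, ← exists_partialSums_iff (by fun_prop)]
  refine exists_congr fun s => ?_
  rw [sat_and]
  refine (and_congr_left' (b := ∀ j ≤ k.val e + 1, IsReal (s ⊡ j)) (by simp)).trans
    (and_congr_right fun hs => ?_)
  rw [sat_and, sat_and]
  refine and_congr ?_ (and_congr ?_ ?_)
  · refine (sat_rexp_equal ?_ (by simp)).trans (by simp)
    simpa using hs _ (zero_le' _)
  · rw [sat_all]
    refine forall_congr' fun i => ?_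
    rw [sat_imp]
    refine imp_congr_ctx (by simp [Order.lt_add_one_iff]) fun hi => ?_
    have h₁ := hs _ hi.le
    have h₂ := hs _ (Order.add_one_le_iff.2 hi)
    have h₃ := ha i (Order.lt_add_one_iff.1 hi)
    refine (sat_rexp_equal (by simpa) ?_).trans (by simp)
    simp [*]
  · refine (sat_rexp_equal (by simpa) ?_).trans (by simp)
    simpa using hs _ le_rfl

variable (M) in
/-- Weak compactness. -/
def WeakCompactness : Prop :=
  ∀ Ψ : M.R → M.R, Internal M Ψ → (∀ r, 0 ≤ r ∧ r ≤ 1 → 0 < Ψ r) → ∀ ε > 0,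
    ∃ (n : M.N) (y l : M.N → M.R), Internal M y ∧ Internal M l ∧
      (∀ i ≤ n, 0 ≤ y i ∧ y i ≤ 1) ∧ (∀ i ≤ n, IsLength Ψ y i (l i)) ∧ 1 - ε ≤ sum (n + 1) l

theorem sum_congr {a b : M.N → M.R} {n : M.N} (ha : Internal M a) (hb : Internal M b)
    (h : ∀ i < n, a i = b i) : sum n a = sum n b := by
  refine induction (P := fun m => m ≤ n → sum m a = sum m b) (by fun_prop) (fun _ => by simp)
    (fun m ih hm => ?_) n le_rfl
  rw [Order.add_one_le_iff] at hm
  rw [sum_succ ha, sum_succ hb, ih hm.le, h m hm]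

/-- Only the radii at the centres `y 0, …, y i` matter, so it is harmless to extend `Ψ` beyond the
unit interval. -/
theorem isLength_congr {Ψ Ψ' : M.R → M.R} {y y' : M.N → M.R} {i : M.N} {l : M.R}
    (hy : ∀ j ≤ i, y j = y' j) (hΨ : ∀ j ≤ i, Ψ (y j) = Ψ' (y j)) :
    IsLength Ψ y i l ↔ IsLength Ψ' y' i l := by
  have h₁ (j : M.N) (hj : j ≤ i) (z : M.R) : InJ Ψ (y j) z ↔ InJ Ψ' (y' j) z := by
    rw [InJ, InJ, hΨ j hj, hy j hj]
  have (z : M.R) : InJ' Ψ y i z ↔ InJ' Ψ' y' i z :=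
    and_congr (h₁ i le_rfl z) (forall₂_congr fun j hj => not_congr (h₁ j hj.le z))
  simp only [IsLength, this]

variable (e) in
theorem sat_WHBU₀ {φ : Fm V} (hφ : φ = All (ty1 ⇾ ty1) fun Ψ => isPosFunI Ψ ⟹
    AllReal fun ε => RExp.lt 0 (.real ε) ⟹
      Ex ty0 fun n => Ex (ty0 ⇾ ty1) fun y =>
        (All ty0 fun i => .le i n↟ ⟹ isReal (y↟ ⬝ i) ⩓ inI (y↟ ⬝ i)) ⩓
        Ex (ty0 ⇾ ty1) fun l =>
          (All ty0 fun i => .le i n↟ ⟹ isReal (l↟ ⬝ i) ⩓ isLengthJ' Ψ↟ y↟ i (l↟ ⬝ i)) ⩓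
          ExReal fun S => isSum n↟ l↟ S ⩓ (1 - RExp.real ε↟).le (.real S)) :
    φ.Sat M.T e ↔ WeakCompactness M := by
  trans ∀ Ψ : M.T (ty1 ⇾ ty1), (FunI Ψ ∧ ∀ r, 0 ≤ r ∧ r ≤ 1 → 0 < fnI Ψ r) → ∀ ε : M.R, 0 < ε →
    ∃ n, ∃ y : M.T (ty0 ⇾ ty1), (∀ i ≤ n, IsReal (y ⊡ i) ∧ (0 ≤ proj (y ⊡ i) ∧ proj (y ⊡ i) ≤ 1)) ∧
      ∃ l : M.T (ty0 ⇾ ty1), (∀ i ≤ n, IsReal (l ⊡ i) ∧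
        IsLength (fnI Ψ) (fun j => proj (y ⊡ j)) i (proj (l ⊡ i))) ∧
        ∃ S : M.R, S = sum (n + 1) (fun i => proj (l ⊡ i)) ∧ 1 - ε ≤ S
  · rw [hφ, sat_all]
    refine forall_congr' fun Ψ => ?_
    rw [sat_imp]
    refine imp_congr_ctx ((sat_isPosFunI _).trans (by simp)) fun hΨ => sat_allReal_iff fun ε hε => ?_
    rw [sat_imp]
    refine imp_congr ((sat_rexp_lt (by simp) (by simpa)).trans (by simp)) ?_
    rw [sat_ex]
    refine exists_congr fun n => ?_
    rw [sat_ex]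
    refine exists_congr fun y => ?_
    rw [sat_and]
    refine (and_congr_left' (b := ∀ i ≤ n, IsReal (y ⊡ i) ∧
      (0 ≤ proj (y ⊡ i) ∧ proj (y ⊡ i) ≤ 1)) ?_).trans (and_congr_right fun hy => ?_)
    · rw [sat_all]
      refine forall_congr' fun i => ?_
      rw [sat_imp, sat_and]
      refine imp_congr (by simp) ((and_congr_left' (b := IsReal (y ⊡ i)) (by simp)).trans
        (and_congr_right fun h => (sat_inI (by simpa)).trans (by simp)))
    rw [sat_ex]
    refine exists_congr fun l => ?_
    rw [sat_and]
    refine (and_congr_left' (b := ∀ i ≤ n, IsReal (l ⊡ i) ∧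
        IsLength (fnI Ψ) (fun j => proj (y ⊡ j)) i (proj (l ⊡ i))) ?_).trans
        (and_congr_right fun hl => ?_)
    · rw [sat_all]
      refine forall_congr' fun i => ?_
      rw [sat_imp]
      refine imp_congr_ctx (by simp) fun hi => ?_
      rw [sat_and]
      refine (and_congr_left' (b := IsReal (l ⊡ i)) (by simp)).trans (and_congr_right fun hl => ?_)
      refine (sat_isLengthJ' ?_ ?_ ?_).trans (by simp)
      · simpa using hΨ.1
      · intro j hj
        simp only [Tm.val_up_step, Tm.val_up_refl, Tm.val_new] at hj ⊢
        exact hy j (hj.trans hi)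
      · simpa
    · refine sat_exReal_iff fun S hS => ?_
      rw [sat_and]
      refine and_congr ((sat_isSum ?_ (by simpa)).trans (by simp))
        ((sat_rexp_le ?_ (by simpa)).trans (by simp))
      · intro i hi
        simp only [Tm.val_up_step, Tm.val_up_refl, Tm.val_new] at hi ⊢
        exact (hl i hi).1
      · simpa
  · constructor
    · intro h Ψ hΨ hpos ε hε
      obtain ⟨F, -, hF, -, hF'⟩ := exists_funR hΨ
      obtain ⟨n, y, hy, l, hl, _, rfl, hS⟩ := h F ⟨hF, fun r hr => by
        rw [hF']
        exact hpos _ ⟨clamp_nonneg _, clamp_le_one _⟩⟩ ε hε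
      refine ⟨n, fun i => proj (y ⊡ i), fun i => proj (l ⊡ i), by fun_prop, by fun_prop,
        fun i hi => (hy i hi).2, fun i hi => ?_, hS⟩
      refine (isLength_congr (fun _ _ => rfl) fun j hj => ?_).1 (hl i hi).2
      have := (hy j (hj.trans hi)).2
      rw [hF', clamp_eq this.1 this.2]
    · rintro h Ψ ⟨hΨ, hpos⟩ ε hε
      obtain ⟨n, y, l, hy, hl, hyI, hlen, hS⟩ := h (fnI Ψ) hΨ.internal hpos ε hε
      obtain ⟨y', hy'⟩ := exists_seq hy
      obtain ⟨l', hl'⟩ := exists_seq hl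
      refine ⟨n, y', fun i hi => ⟨(hy' i).1, ?_⟩, l', fun i hi => ⟨(hl' i).1, ?_⟩, _, rfl, ?_⟩
      · rw [(hy' i).2]
        exact hyI i hi
      · simp only [(hy' _).2, (hl' _).2]
        exact hlen i hi
      · simp only [(hl' _).2]
        exact hS

theorem holds_WHBU₀ : Holds M.T WHBU₀ ↔ WeakCompactness M := sat_WHBU₀ _ rfl

/-! ### Tagged partitions -/

/-- A tagged partition. -/
def IsTP (k : M.N) (t x : M.N → M.R) : Prop :=
  x 0 = 0 ∧ x (k + 1) = 1 ∧ ∀ i ≤ k, x i < x (i + 1) ∧ x i ≤ t i ∧ t i ≤ x (i + 1)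

/-- Codes of a tagged partition. -/
def TPCode (k : M.N) (t x : M.T (ty0 ⇾ ty1)) : Prop :=
  (∀ i ≤ k + 1, IsReal (x ⊡ i)) ∧ (∀ i ≤ k, IsReal (t ⊡ i)) ∧
    IsTP k (fun i => proj (t ⊡ i)) (fun i => proj (x ⊡ i))

theorem sat_isTP (P : TP V) :
    P.isTP.Sat M.T e ↔ TPCode (P.k.val e) (P.t.val e) (P.x.val e) := by
  rw [TP.isTP, sat_and, TPCode]
  refine (and_congr_left' (b := ∀ i ≤ P.k.val e + 1, IsReal (P.x.val e ⊡ i)) (by simp)).trans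
    (and_congr_right fun hx => ?_)
  rw [sat_and, sat_and, sat_all, IsTP]
  trans proj (P.x.val e ⊡ (0 : M.N)) = 0 ∧ proj (P.x.val e ⊡ (P.k.val e + 1)) = 1 ∧
    ∀ i ≤ P.k.val e, IsReal (P.t.val e ⊡ i) ∧ (proj (P.x.val e ⊡ i) < proj (P.x.val e ⊡ (i + 1)) ∧
      proj (P.x.val e ⊡ i) ≤ proj (P.t.val e ⊡ i) ∧
      proj (P.t.val e ⊡ i) ≤ proj (P.x.val e ⊡ (i + 1)))
  · refine and_congr ?_ (and_congr ?_ (forall_congr' fun i => ?_))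
    · refine (sat_rexp_equal ?_ (by simp)).trans (by simp)
      simpa using hx _ (zero_le' _)
    · refine (sat_rexp_equal ?_ (by simp)).trans (by simp)
      simpa using hx _ le_rfl
    · rw [sat_imp]
      refine imp_congr_ctx (by simp) fun hi => ?_
      have h₁ := hx _ (hi.trans le_self_add)
      have h₂ := hx _ (add_le_add_left hi 1)
      rw [sat_and]
      refine (and_congr_left' (b := IsReal (P.t.val e ⊡ i)) (by simp)).trans
        (and_congr_right fun ht => ?_)
      rw [sat_and, sat_and]
      exact and_congr ((sat_rexp_lt (by simpa) (by simpa)).trans (by simp))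
        (and_congr ((sat_rexp_le (by simpa) (by simpa)).trans (by simp))
          ((sat_rexp_le (by simpa) (by simpa)).trans (by simp)))
  · constructor
    · rintro ⟨h₁, h₂, h₃⟩
      exact ⟨fun i hi => (h₃ i hi).1, h₁, h₂, fun i hi => (h₃ i hi).2⟩
    · rintro ⟨h₃, h₁, h₂, h₄⟩
      exact ⟨h₁, h₂, fun i hi => ⟨h₃ i hi, h₄ i hi⟩⟩

end
end Model
end HOA

/-! ### Riemann sums and the two integrals in a model. -/

namespace HOA
namespace Model

variable {M : Model} {V W : Ty → Type}

theorem IsTP.mono {k : M.N} {t x : M.N → M.R} (h : IsTP k t x) (hx : Internal M x) {i j : M.N}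
    (hij : i ≤ j) (hj : j ≤ k + 1) : x i ≤ x j := by
  obtain ⟨n, rfl⟩ := exists_add_of_le hij
  clear hij
  revert hj
  refine induction (P := fun n => i + n ≤ k + 1 → x i ≤ x (i + n)) (by fun_prop)
    (fun _ => by rw [add_zero]) (fun n ih hn => ?_) n
  rw [← add_assoc] at hn ⊢
  have hn' : i + n ≤ k := by simpa using hn
  exact (ih (hn'.trans le_self_add)).trans (h.2.2 _ hn').1.le

theorem IsTP.mem {k : M.N} {t x : M.N → M.R} (h : IsTP k t x) (hx : Internal M x) {i : M.N}
    (hi : i ≤ k + 1) : 0 ≤ x i ∧ x i ≤ 1 := by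
  have h₁ := h.mono hx (zero_le' i) hi
  have h₂ := h.mono hx hi le_rfl
  rw [h.1] at h₁
  rw [h.2.1] at h₂
  exact ⟨h₁, h₂⟩

theorem IsTP.tag_mem {k : M.N} {t x : M.N → M.R} (h : IsTP k t x) (hx : Internal M x) {i : M.N}
    (hi : i ≤ k) : 0 ≤ t i ∧ t i ≤ 1 :=
  ⟨(h.mem hx (hi.trans le_self_add)).1.trans (h.2.2 i hi).2.1,
    (h.2.2 i hi).2.2.trans (h.mem hx (add_le_add_left hi 1)).2⟩

/-- The Riemann sum of a tagged partition. -/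
noncomputable def riemannSum (f : M.R → M.R) (k : M.N) (t x : M.N → M.R) : M.R :=
  sum (k + 1) fun i => f (t i) * (x (i + 1) - x i)

open Classical in
/-- The total length of the intervals of a tagged partition that are fine. -/
noncomputable def fineLength (δ : M.R → M.R) (k : M.N) (t x : M.N → M.R) : M.R :=
  sum (k + 1) fun i => if t i - δ (t i) ≤ x i ∧ x (i + 1) ≤ t i + δ (t i) then x (i + 1) - x i else 0

/-- `f` is Riemann integrable with Riemann integral `A`. -/
def RInt (f : M.R → M.R) (A : M.R) : Prop :=
  ∀ ε > 0, ∃ d > 0, ∀ k t x, Internal M t → Internal M x → IsTP k t x →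
    (∀ i ≤ k, x (i + 1) - x i ≤ d) → |riemannSum f k t x - A| < ε

/-- `f` is L-integrable with L-integral `A`. -/
def LInt (f : M.R → M.R) (A : M.R) : Prop :=
  BddI f ∧ ∀ ε > 0, ∃ η > 0, ∃ δ : M.R → M.R, Internal M δ ∧ (∀ r, 0 < δ r) ∧
    ∀ k t x, Internal M t → Internal M x → IsTP k t x → 1 - η ≤ fineLength δ k t x →
      |riemannSum f k t x - A| < ε

section
variable {e : ∀ σ, V σ → M.T σ}

theorem TPCode.len {P : TP V} (hP : TPCode (P.k.val e) (P.t.val e) (P.x.val e)) {i : Tm V ty0}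
    (hi : i.val e ≤ P.k.val e) : (P.len i).OK e := by
  have h₁ := hP.1 _ (hi.trans le_self_add)
  have h₂ := hP.1 _ (add_le_add_left hi 1)
  simpa [TP.len] using ⟨h₂, h₁⟩

theorem value_len (P : TP V) (i : Tm V ty0) : (P.len i).value e =
    proj (P.x.val e ⊡ (i.val e + 1)) - proj (P.x.val e ⊡ i.val e) := by
  simp [TP.len]

@[simp] theorem k_up (P : TP V) [Lift V W] : (P.up : TP W).k = P.k.up := rfl
@[simp] theorem t_up (P : TP V) [Lift V W] : (P.up : TP W).t = P.t.up := rfl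
@[simp] theorem x_up (P : TP V) [Lift V W] : (P.up : TP W).x = P.x.up := rfl

theorem sat_isRiemannSum {P : TP V} {f : Tm V (ty1 ⇾ ty1)} {S : Tm V ty1}
    (hP : TPCode (P.k.val e) (P.t.val e) (P.x.val e)) (hf : FunI (f.val e))
    (hS : IsReal (S.val e)) : (P.isRiemannSum f S).Sat M.T e ↔
      proj (S.val e) = riemannSum (fnI (f.val e)) (P.k.val e) (fun i => proj (P.t.val e ⊡ i))
        (fun i => proj (P.x.val e ⊡ i)) := by
  have := hf.internal
  rw [TP.isRiemannSum, sat_ex, riemannSum, ← exists_partialSums_iff (by fun_prop)]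
  refine exists_congr fun s => ?_
  rw [sat_and]
  refine (and_congr_left' (b := ∀ j ≤ P.k.val e + 1, IsReal (s ⊡ j)) (by simp)).trans
    (and_congr_right fun hs => ?_)
  rw [sat_and, sat_and]
  refine and_congr ?_ (and_congr ?_ ?_)
  · refine (sat_rexp_equal ?_ (by simp)).trans (by simp)
    simpa using hs _ (zero_le' _)
  · rw [sat_all]
    refine forall_congr' fun i => ?_
    rw [sat_imp]
    refine imp_congr_ctx (by simp [Order.lt_add_one_iff]) fun hi => ?_
    have h₁ := hs _ hi.le
    have h₂ := hs _ (Order.add_one_le_iff.2 hi)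
    have hi := Order.lt_add_one_iff.1 hi
    have hI := hP.2.2.tag_mem (by fun_prop) hi
    have h₄ := hf.1 _ (hP.2.1 i hi) hI
    rw [← hf.proj_eq (hP.2.1 i hi) hI]
    refine (sat_rexp_equal (by simpa) ?_).trans (by simp [value_len])
    simp only [rexp_ok_add, rexp_ok_mul, rexp_ok_real]
    exact ⟨by simpa, by simpa, TPCode.len (by simpa) (by simpa)⟩
  · refine (sat_rexp_equal (by simpa) ?_).trans (by simp)
    simpa using hs _ le_rfl

theorem sat_fineAt {P : TP V} {δ : Tm V (ty1 ⇾ ty1)} {i : Tm V ty0}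
    (hP : TPCode (P.k.val e) (P.t.val e) (P.x.val e)) (hδ : FunR (δ.val e))
    (hi : i.val e ≤ P.k.val e) : (P.fineAt δ i).Sat M.T e ↔
      proj (P.t.val e ⊡ i.val e) - fnR (δ.val e) (proj (P.t.val e ⊡ i.val e)) ≤
        proj (P.x.val e ⊡ i.val e) ∧ proj (P.x.val e ⊡ (i.val e + 1)) ≤
        proj (P.t.val e ⊡ i.val e) + fnR (δ.val e) (proj (P.t.val e ⊡ i.val e)) := by
  have h₁ := hP.1 _ (hi.trans le_self_add)
  have h₂ := hP.1 _ (add_le_add_left hi 1)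
  have h₃ := hP.2.1 _ hi
  have h₄ := hδ.1 _ h₃
  rw [TP.fineAt, sat_and, ← hδ.proj_eq h₃]
  exact and_congr ((sat_rexp_le (by simp [*]) (by simpa)).trans (by simp))
    ((sat_rexp_le (by simpa) (by simp [*])).trans (by simp))

theorem sat_isFineLength {P : TP V} {δ : Tm V (ty1 ⇾ ty1)} {S : Tm V ty1}
    (hP : TPCode (P.k.val e) (P.t.val e) (P.x.val e)) (hδ : FunR (δ.val e))
    (hS : IsReal (S.val e)) : (P.isFineLength δ S).Sat M.T e ↔
      proj (S.val e) = fineLength (fnR (δ.val e)) (P.k.val e) (fun i => proj (P.t.val e ⊡ i))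
        (fun i => proj (P.x.val e ⊡ i)) := by
  have := hδ.internal
  rw [TP.isFineLength, sat_ex, fineLength, ← exists_partialSums_iff (by fun_prop)]
  refine exists_congr fun s => ?_
  rw [sat_and]
  refine (and_congr_left' (b := ∀ j ≤ P.k.val e + 1, IsReal (s ⊡ j)) (by simp)).trans
    (and_congr_right fun hs => ?_)
  rw [sat_and, sat_and]
  refine and_congr ?_ (and_congr ?_ ?_)
  · refine (sat_rexp_equal ?_ (by simp)).trans (by simp)
    simpa using hs _ (zero_le' _)
  · rw [sat_all]
    refine forall_congr' fun i => ?_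
    rw [sat_imp]
    refine imp_congr_ctx (by simp [Order.lt_add_one_iff]) fun hi => ?_
    have h₁ := hs _ hi.le
    have h₂ := hs _ (Order.add_one_le_iff.2 hi)
    have hi := Order.lt_add_one_iff.1 hi
    have h₃ := sat_fineAt (P := P.up) (δ := δ↟) (i := .var .new) (e := Ext.val i (Ext.val s e))
      (by simpa) (by simpa) (by simpa)
    rw [sat_and, sat_imp, sat_imp, sat_neg, h₃]
    simp only [t_up, x_up, Tm.val_up_step, Tm.val_up_refl, Tm.val_new]
    have h₅ : ((RExp.real ((Tm.var .new : Tm (Ext V (ty0 ⇾ ty1)) (ty0 ⇾ ty1))↟ ⬝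
          ((Tm.var .new : Tm (Ext (Ext V (ty0 ⇾ ty1)) ty0) ty0) + 1))).equal
        (.real ((Tm.var .new : Tm (Ext V (ty0 ⇾ ty1)) (ty0 ⇾ ty1))↟ ⬝ Tm.var .new) +
          P.up.len (.var .new))).Sat M.T (Ext.val i (Ext.val s e)) ↔
        proj (s ⊡ (i + 1)) = proj (s ⊡ i) +
          (proj (P.x.val e ⊡ (i + 1)) - proj (P.x.val e ⊡ i)) := by
      refine (sat_rexp_equal (by simpa) ?_).trans (by simp [value_len])
      simp only [rexp_ok_add, rexp_ok_real]
      exact ⟨by simpa, TPCode.len (by simpa) (by simpa)⟩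
    rw [h₅, sat_rexp_equal (by simpa) (by simpa)]
    simp only [rexp_value_real, Tm.val_app, val_add, val_one, Tm.val_up_step, Tm.val_up_refl,
      Tm.val_new]
    split_ifs with h
    · exact ⟨fun h' => h'.1 h, fun h' => ⟨fun _ => h', fun h'' => (h'' h).elim⟩⟩
    · rw [add_zero]
      exact ⟨fun h' => h'.2 h, fun h' => ⟨fun h'' => (h h'').elim, fun _ => h'⟩⟩
  · refine (sat_rexp_equal (by simpa) ?_).trans (by simp)
    simpa using hs _ le_rfl

theorem sat_isFine {P : TP V} {η : Tm V ty1} {δ : Tm V (ty1 ⇾ ty1)}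
    (hP : TPCode (P.k.val e) (P.t.val e) (P.x.val e)) (hδ : FunR (δ.val e))
    (hη : IsReal (η.val e)) : (P.isFine η δ).Sat M.T e ↔
      1 - proj (η.val e) ≤ fineLength (fnR (δ.val e)) (P.k.val e) (fun i => proj (P.t.val e ⊡ i))
        (fun i => proj (P.x.val e ⊡ i)) := by
  refine (sat_exReal_iff (P := fun S => S = fineLength (fnR (δ.val e)) (P.k.val e)
    (fun i => proj (P.t.val e ⊡ i)) (fun i => proj (P.x.val e ⊡ i)) ∧ 1 - proj (η.val e) ≤ S)
    fun S hS => ?_).trans (by simp)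
  rw [sat_and]
  exact and_congr ((sat_isFineLength (by simpa) (by simpa) (by simpa)).trans (by simp))
    ((sat_rexp_le (by simpa) (by simpa)).trans (by simp))

theorem sat_isClose {P : TP V} {f : Tm V (ty1 ⇾ ty1)} {A ε : Tm V ty1}
    (hP : TPCode (P.k.val e) (P.t.val e) (P.x.val e)) (hf : FunI (f.val e))
    (hA : IsReal (A.val e)) (hε : IsReal (ε.val e)) : (P.isClose f A ε).Sat M.T e ↔
      |riemannSum (fnI (f.val e)) (P.k.val e) (fun i => proj (P.t.val e ⊡ i))
        (fun i => proj (P.x.val e ⊡ i)) - proj (A.val e)| < proj (ε.val e) := by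
  refine (sat_exReal_iff (P := fun S => S = riemannSum (fnI (f.val e)) (P.k.val e)
    (fun i => proj (P.t.val e ⊡ i)) (fun i => proj (P.x.val e ⊡ i)) ∧
    |S - proj (A.val e)| < proj (ε.val e)) fun S hS => ?_).trans (by simp)
  rw [sat_and, absSubLt, sat_and, abs_sub_lt_iff]
  exact and_congr ((sat_isRiemannSum (by simpa) (by simpa) (by simpa)).trans (by simp))
    (and_congr ((sat_rexp_lt (by simp [*]) (by simpa)).trans (by simp))
      ((sat_rexp_lt (by simp [*]) (by simpa)).trans (by simp)))

theorem sat_meshLe {P : TP V} {d : Tm V ty1}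
    (hP : TPCode (P.k.val e) (P.t.val e) (P.x.val e)) (hd : IsReal (d.val e)) :
    (P.meshLe d).Sat M.T e ↔ ∀ i ≤ P.k.val e,
      proj (P.x.val e ⊡ (i + 1)) - proj (P.x.val e ⊡ i) ≤ proj (d.val e) := by
  rw [TP.meshLe, sat_all]
  refine forall_congr' fun i => ?_
  rw [sat_imp]
  refine imp_congr_ctx (by simp) fun hi => ?_
  exact (sat_rexp_le (TPCode.len (by simpa) (by simpa)) (by simpa)).trans (by simp [value_len])

/-- The tagged partition of the last three variables. -/
def tp₃ : TP (Ext (Ext (Ext V ty0) (ty0 ⇾ ty1)) (ty0 ⇾ ty1)) :=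
  ⟨.var (.old (.old .new)), .var (.old .new), .var .new⟩

@[simp] theorem val_old {σ ρ : Ty} (m : M.T ρ) (v : V σ) :
    (Tm.var (.old v)).val (Ext.val m e) = (Tm.var v).val e := rfl

theorem sat_allTP_iff {φ : TP (Ext (Ext (Ext V ty0) (ty0 ⇾ ty1)) (ty0 ⇾ ty1)) → Fm _}
    {Q : M.N → (M.N → M.R) → (M.N → M.R) → Prop}
    (h : ∀ k t x, TPCode k t x → ((φ tp₃).Sat M.T (Ext.val x (Ext.val t (Ext.val k e))) ↔
      Q k (fun i => proj (t ⊡ i)) (fun i => proj (x ⊡ i)))) :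
    (AllTP φ).Sat M.T e ↔ ∀ k t x, Internal M t → Internal M x → IsTP k t x → Q k t x := by
  trans ∀ k t x, TPCode k t x → Q k (fun i => proj (t ⊡ i)) (fun i => proj (x ⊡ i))
  · rw [AllTP, sat_all]
    refine forall_congr' fun k => ?_
    rw [sat_all]
    refine forall_congr' fun t => ?_
    rw [sat_all]
    refine forall_congr' fun x => ?_
    rw [sat_imp]
    exact imp_congr_ctx ((sat_isTP _).trans (by simp)) fun hP => h k t x hP
  · constructor
    · intro h k t x ht hx hP
      obtain ⟨t', ht'⟩ := exists_seq ht
      obtain ⟨x', hx'⟩ := exists_seq hx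
      have := h k t' x'
      simp only [(ht' _).2, (hx' _).2] at this
      refine this ⟨fun i _ => (hx' i).1, fun i _ => (ht' i).1, ?_⟩
      simp only [(ht' _).2, (hx' _).2]
      exact hP
    · intro h k t x hP
      exact h k _ _ (by fun_prop) (by fun_prop) hP.2.2

theorem sat_isRInt {f : Tm V (ty1 ⇾ ty1)} {A : Tm V ty1} (hA : IsReal (A.val e)) :
    (isRInt f A).Sat M.T e ↔ FunI (f.val e) ∧ RInt (fnI (f.val e)) (proj (A.val e)) := by
  rw [isRInt, sat_and, sat_isFunI]
  refine and_congr_right fun hf => sat_allReal_iff fun ε hε => ?_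
  rw [sat_imp]
  refine imp_congr ((sat_rexp_lt (by simp) (by simpa)).trans (by simp)) ?_
  refine sat_exReal_iff fun d hd => ?_
  rw [sat_and]
  refine and_congr ((sat_rexp_lt (by simp) (by simpa)).trans (by simp)) ?_
  refine sat_allTP_iff fun k t x hP => ?_
  rw [sat_imp]
  exact imp_congr ((sat_meshLe (by simpa [tp₃]) (by simpa)).trans (by simp [tp₃]))
    ((sat_isClose (by simpa [tp₃]) (by simpa) (by simpa) (by simpa)).trans (by simp [tp₃]))

theorem sat_isLInt {f : Tm V (ty1 ⇾ ty1)} {A : Tm V ty1} (hA : IsReal (A.val e)) :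
    (isLInt f A).Sat M.T e ↔ FunI (f.val e) ∧ LInt (fnI (f.val e)) (proj (A.val e)) := by
  rw [isLInt, sat_and, sat_and, sat_isFunI]
  refine and_congr_right fun hf => and_congr (sat_isBddI hf) (sat_allReal_iff fun ε hε => ?_)
  rw [sat_imp]
  refine imp_congr ((sat_rexp_lt (by simp) (by simpa)).trans (by simp)) ?_
  refine sat_exReal_iff fun η hη => ?_
  rw [sat_and]
  refine and_congr ((sat_rexp_lt (by simp) (by simpa)).trans (by simp)) ?_
  rw [sat_ex]
  trans ∃ δ : M.T (ty1 ⇾ ty1), (FunR δ ∧ ∀ r, 0 < fnR δ r) ∧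
    ∀ k t x, Internal M t → Internal M x → IsTP k t x → 1 - proj η ≤ fineLength (fnR δ) k t x →
      |riemannSum (fnI (f.val e)) k t x - proj (A.val e)| < proj ε
  · refine exists_congr fun δ => ?_
    rw [sat_and]
    refine (and_congr_left' (b := FunR δ ∧ ∀ r, 0 < fnR δ r)
      ((sat_isGauge _).trans (by simp))).trans (and_congr_right fun hδ => ?_)
    refine sat_allTP_iff fun k t x hP => ?_
    rw [sat_imp]
    exact imp_congr ((sat_isFine (by simpa [tp₃]) (by simpa using hδ.1) (by simpa)).trans
      (by simp [tp₃]))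
      ((sat_isClose (by simpa [tp₃]) (by simpa) (by simpa) (by simpa)).trans (by simp [tp₃]))
  · constructor
    · rintro ⟨δ, hδ, h⟩
      exact ⟨fnR δ, hδ.1.internal, hδ.2, h⟩
    · rintro ⟨δ, hδ, h, h'⟩
      obtain ⟨δ', hδ', -, hr, -⟩ := exists_funR hδ
      obtain rfl : δ = fnR δ' := (funext hr).symm
      exact ⟨δ', ⟨hδ', h⟩, h'⟩

end

theorem riemannSum_congr {f g : M.R → M.R} (hf : Internal M f) (hg : Internal M g)
    (h : ∀ r, 0 ≤ r ∧ r ≤ 1 → f r = g r) {k : M.N} {t x : M.N → M.R} (ht : Internal M t)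
    (hx : Internal M x) (hP : IsTP k t x) : riemannSum f k t x = riemannSum g k t x := by
  refine sum_congr (by fun_prop) (by fun_prop) fun i hi => ?_
  rw [h _ (hP.tag_mem hx (Order.lt_add_one_iff.1 hi))]

/-- Tags lie in the unit interval. This allows to pass between `f` and the object representing it,
which agrees with `f` only there. -/
theorem LInt.congr {f g : M.R → M.R} {A : M.R} (hf : Internal M f) (hg : Internal M g)
    (h : ∀ r, 0 ≤ r ∧ r ≤ 1 → f r = g r) (hA : LInt f A) : LInt g A := by
  refine ⟨?_, fun ε hε => ?_⟩
  · obtain ⟨b, hb⟩ := hA.1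
    exact ⟨b, fun r hr => by rw [← h r hr]; exact hb r hr⟩
  · obtain ⟨η, hη, δ, hδ, hpos, h'⟩ := hA.2 ε hε
    refine ⟨η, hη, δ, hδ, hpos, fun k t x ht hx hP hfine => ?_⟩
    rw [← riemannSum_congr hf hg h ht hx hP]
    exact h' k t x ht hx hP hfine

theorem RInt.congr {f g : M.R → M.R} {A : M.R} (hf : Internal M f) (hg : Internal M g)
    (h : ∀ r, 0 ≤ r ∧ r ≤ 1 → f r = g r) (hA : RInt f A) : RInt g A := by
  intro ε hε
  obtain ⟨d, hd, h'⟩ := hA ε hε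
  refine ⟨d, hd, fun k t x ht hx hP hmesh => ?_⟩
  rw [← riemannSum_congr hf hg h ht hx hP]
  exact h' k t x ht hx hP hmesh

variable (M) in
/-- Uniqueness of the L-integral. -/
def UniqueIntegral : Prop :=
  ∀ f : M.R → M.R, Internal M f → ∀ A B, LInt f A → LInt f B → A = B

variable (M) in
/-- Consistency of the L-integral with the Riemann integral. -/
def ConsistentIntegral : Prop :=
  ∀ f : M.R → M.R, Internal M f → ∀ A, RInt f A → (∃ B, LInt f B) ∧ ∀ B, LInt f B → B = A

theorem holds_uniqueness : Holds M.T Uniqueness ↔ UniqueIntegral M := by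
  trans ∀ f : M.T (ty1 ⇾ ty1), ∀ A B : M.R, (FunI f ∧ LInt (fnI f) A) → (FunI f ∧ LInt (fnI f) B) →
    A = B
  · refine (sat_all _ _).trans (forall_congr' fun f => ?_)
    refine sat_allReal_iff fun A hA => sat_allReal_iff fun B hB => ?_
    rw [sat_imp, sat_imp]
    exact imp_congr ((sat_isLInt (by simpa)).trans (by simp)) (imp_congr
      ((sat_isLInt (by simpa)).trans (by simp)) ((sat_realEq (by simpa) (by simpa)).trans (by simp)))
  · constructor
    · intro h f hf A B hA hB
      obtain ⟨F, -, hF, -, hF'⟩ := exists_funR hf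
      have (r : M.R) (hr : 0 ≤ r ∧ r ≤ 1) : f r = fnI F r := by rw [hF', clamp_eq hr.1 hr.2]
      exact h F A B ⟨hF, hA.congr hf hF.internal this⟩ ⟨hF, hB.congr hf hF.internal this⟩
    · intro h f A B hA hB
      exact h _ hA.1.internal A B hA.2 hB.2

theorem holds_consistency : Holds M.T Consistency ↔ ConsistentIntegral M := by
  trans ∀ f : M.T (ty1 ⇾ ty1), ∀ A : M.R, (FunI f ∧ RInt (fnI f) A) →
    (∃ B, FunI f ∧ LInt (fnI f) B) ∧ ∀ B, (FunI f ∧ LInt (fnI f) B) → B = A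
  · refine (sat_all _ _).trans (forall_congr' fun f => ?_)
    refine sat_allReal_iff fun A hA => ?_
    rw [sat_imp, sat_and]
    refine imp_congr ((sat_isRInt (by simpa)).trans (by simp)) (and_congr
      (sat_exReal_iff fun B hB => (sat_isLInt (by simpa)).trans (by simp))
      (sat_allReal_iff fun B hB => ?_))
    rw [sat_imp]
    exact imp_congr ((sat_isLInt (by simpa)).trans (by simp))
      ((sat_realEq (by simpa) (by simpa)).trans (by simp))
  · constructor
    · intro h f hf A hA
      obtain ⟨F, -, hF, -, hF'⟩ := exists_funR hf
      have (r : M.R) (hr : 0 ≤ r ∧ r ≤ 1) : f r = fnI F r := by rw [hF', clamp_eq hr.1 hr.2]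
      obtain ⟨⟨B, hB⟩, h'⟩ := h F A ⟨hF, hA.congr hf hF.internal this⟩
      exact ⟨⟨B, hB.2.congr hF.internal hf fun r hr => (this r hr).symm⟩,
        fun B hB => h' B ⟨hF, hB.congr hf hF.internal this⟩⟩
    · intro h f A hA
      obtain ⟨⟨B, hB⟩, h'⟩ := h _ hA.1.internal A hA.2
      exact ⟨⟨B, hA.1, hB⟩, fun B hB => h' B hB.2⟩

end Model
end HOA

namespace HOA
namespace Model

variable {M : Model}

/-! ### Finite sums and finite sets of reals -/

theorem induction_le {n : M.N} {P : M.N → Prop} (hP : Internal M P) (h₀ : P 0)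
    (h : ∀ i < n, P i → P (i + 1)) {i : M.N} (hi : i ≤ n) : P i := by
  revert hi
  refine induction (P := fun i => i ≤ n → P i) (by fun_prop) (fun _ => h₀) (fun i ih hi => ?_) i
  rw [Order.add_one_le_iff] at hi
  exact h i hi (ih hi.le)

theorem sum_le_sum {a b : M.N → M.R} (ha : Internal M a) (hb : Internal M b) {n : M.N}
    (h : ∀ i < n, a i ≤ b i) : sum n a ≤ sum n b := by
  refine induction_le (P := fun n => sum n a ≤ sum n b) (by fun_prop) (by simp)
    (fun i hi ih => ?_) le_rfl
  rw [sum_succ ha, sum_succ hb]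
  exact add_le_add ih (h i hi)

@[simp] theorem sum_zero_fun (n : M.N) : sum n (fun _ => (0 : M.R)) = 0 := by
  refine induction (P := fun n => sum n (fun _ => (0 : M.R)) = 0) (by fun_prop) (by simp)
    (fun i ih => ?_) n
  rw [sum_succ (by fun_prop), ih, add_zero]

theorem sum_nonneg {a : M.N → M.R} (ha : Internal M a) {n : M.N} (h : ∀ i < n, 0 ≤ a i) :
    0 ≤ sum n a := by
  rw [← sum_zero_fun n]
  exact sum_le_sum (by fun_prop) ha h

theorem sum_add {a b : M.N → M.R} (ha : Internal M a) (hb : Internal M b) (n : M.N) :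
    sum n (fun i => a i + b i) = sum n a + sum n b := by
  refine induction (P := fun n => sum n (fun i => a i + b i) = sum n a + sum n b) (by fun_prop)
    (by simp) (fun i ih => ?_) n
  rw [sum_succ ha, sum_succ hb, sum_succ (by fun_prop), ih]
  ring

theorem sum_sub {a b : M.N → M.R} (ha : Internal M a) (hb : Internal M b) (n : M.N) :
    sum n (fun i => a i - b i) = sum n a - sum n b := by
  rw [eq_sub_iff_add_eq, ← sum_add (by fun_prop) hb]
  simp

theorem sum_comm {a : M.N → M.N → M.R} (ha : Internal M (fun p : M.N × M.N => a p.1 p.2))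
    (m n : M.N) : sum m (fun i => sum n (fun j => a i j)) = sum n fun j => sum m fun i => a i j := by
  refine induction (P := fun m => sum m (fun i => sum n (fun j => a i j)) =
    sum n fun j => sum m fun i => a i j) (by fun_prop) (by simp) (fun i ih => ?_) m
  have h (j : M.N) : sum (i + 1) (fun i => a i j) = sum i (fun i => a i j) + a i j :=
    sum_succ (by fun_prop) _
  rw [sum_succ (by fun_prop), ih]
  simp only [h]
  rw [sum_add (by fun_prop) (by fun_prop)]

theorem sum_telescope {a : M.N → M.R} (ha : Internal M a) (n : M.N) :
    sum n (fun i => a (i + 1) - a i) = a n - a 0 := by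
  refine induction (P := fun n => sum n (fun i => a (i + 1) - a i) = a n - a 0) (by fun_prop)
    (by simp) (fun i ih => ?_) n
  rw [sum_succ (by fun_prop), ih]
  ring

theorem single_le_sum {a : M.N → M.R} (ha : Internal M a) {n : M.N} (h : ∀ i < n, 0 ≤ a i)
    {i : M.N} (hi : i < n) : a i ≤ sum n a := by
  have : ∀ m ≤ n, i < m → a i ≤ sum m a := fun m hm =>
    induction_le (n := n) (P := fun m => i < m → a i ≤ sum m a) (by fun_prop)
      (fun h => ((zero_le' i).not_gt h).elim) (fun m hm ih him => by
        rw [sum_succ ha]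
        rcases (Order.lt_add_one_iff.1 him).lt_or_eq with h' | rfl
        · exact (ih h').trans (le_add_of_nonneg_right (h m hm))
        · exact le_add_of_nonneg_left (sum_nonneg ha fun j hj => h j (hj.trans hm))) hm
  exact this n le_rfl hi

theorem sum_single {a : M.N → M.R} (ha : Internal M a) {n i : M.N} (hi : i < n)
    (h : ∀ j < n, j ≠ i → a j = 0) : sum n a = a i := by
  classical
  have h₁ : ∀ m ≤ n, sum m a = if i < m then a i else 0 := fun m hm =>
    induction_le (n := n) (P := fun m => sum m a = if i < m then a i else 0) (by fun_prop)
      (by simp [(zero_le' i).not_gt]) (fun m hm ih => by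
        rw [sum_succ ha, ih]
        rcases lt_trichotomy i m with h' | rfl | h'
        · rw [if_pos h', if_pos (h'.trans (lt_add_one m)), h m hm h'.ne', add_zero]
        · rw [if_neg (lt_irrefl i), if_pos (lt_add_one i), zero_add]
        · rw [if_neg h'.not_gt, if_neg (Order.add_one_le_iff.2 h').not_gt, h m hm h'.ne, add_zero])
      hm
  rw [h₁ n le_rfl, if_pos hi]

theorem exists_max {P : M.N → Prop} (hP : Internal M P) {a : M.N → M.R} (ha : Internal M a)
    {n : M.N} (h : ∃ i < n, P i) : ∃ i < n, P i ∧ ∀ j < n, P j → a j ≤ a i := by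
  refine induction (P := fun n => (∃ i, i < n ∧ P i) →
    ∃ i, i < n ∧ P i ∧ ∀ j, j < n → P j → a j ≤ a i) (by fun_prop) ?_ ?_ n h
  · rintro ⟨i, hi, -⟩
    exact ((zero_le' i).not_gt hi).elim
  · rintro n ih ⟨i, hi, hPi⟩
    by_cases h : ∃ i, i < n ∧ P i
    · obtain ⟨i₀, h₀, h₁, h₂⟩ := ih h
      by_cases hn : P n ∧ a i₀ ≤ a n
      · refine ⟨n, lt_add_one n, hn.1, fun j hj hPj => ?_⟩
        rcases (Order.lt_add_one_iff.1 hj).lt_or_eq with h' | rfl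
        · exact (h₂ j h' hPj).trans hn.2
        · exact le_rfl
      · refine ⟨i₀, h₀.trans (lt_add_one n), h₁, fun j hj hPj => ?_⟩
        rcases (Order.lt_add_one_iff.1 hj).lt_or_eq with h' | rfl
        · exact h₂ j h' hPj
        · exact (le_total _ _).resolve_right fun h => hn ⟨hPj, h⟩
    · obtain rfl : i = n := (Order.lt_add_one_iff.1 hi).eq_of_not_lt fun h' => h ⟨i, h', hPi⟩
      refine ⟨i, hi, hPi, fun j hj hPj => ?_⟩
      rcases (Order.lt_add_one_iff.1 hj).lt_or_eq with h' | rfl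
      · exact (h ⟨j, h', hPj⟩).elim
      · exact le_rfl

/-- Otherwise induction carries the inequality `c j ≤ z` from `0` up to `m`. -/
theorem exists_cell {c : M.N → M.R} (hc : Internal M c) {m : M.N} {z : M.R} (h₀ : c 0 ≤ z)
    (hm : z < c m) : ∃ j < m, c j ≤ z ∧ z < c (j + 1) := by
  by_contra! h
  exact (induction_le (n := m) (P := fun j => c j ≤ z) (by fun_prop) h₀ h le_rfl).not_gt hm

theorem mono_of_le_succ {c : M.N → M.R} (hc : Internal M c) {m : M.N}
    (h : ∀ j < m, c j ≤ c (j + 1)) {i j : M.N} (hij : i ≤ j) (hj : j ≤ m) : c i ≤ c j := by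
  refine induction_le (n := m) (P := fun j => i ≤ j → c i ≤ c j) (by fun_prop) (fun h => ?_)
    (fun j hj ih hij => ?_) hj hij
  · rw [le_antisymm h (zero_le' i)]
  · rcases hij.lt_or_eq with h' | rfl
    · exact (ih (Order.lt_add_one_iff.1 h')).trans (h j hj)
    · exact le_rfl

theorem exists_union {a b : M.N → M.R} (ha : Internal M a) (hb : Internal M b) (m n : M.N) :
    ∃ c : M.N → M.R, Internal M c ∧ (∀ i < m, ∃ k < m + n, c k = a i) ∧
      (∀ i < n, ∃ k < m + n, c k = b i) ∧
      ∀ k < m + n, (∃ i < m, c k = a i) ∨ ∃ i < n, c k = b i := by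
  classical
  -- The search for a least number replaces the subtraction of `m`.
  have hsub (i : M.N) : (least fun k => m + i ≤ m + k) = i := by
    refine least_eq le_rfl fun k hk => ?_
    simpa using hk
  refine ⟨fun k => if k < m then a k else b (least fun i => k ≤ m + i), by fun_prop,
    fun i hi => ⟨i, hi.trans_le le_self_add, if_pos hi⟩, fun i hi => ⟨m + i, by simpa, ?_⟩,
    fun k hk => ?_⟩
  · dsimp only
    rw [if_neg (by simp), hsub]
  · dsimp only
    split_ifs with h
    · exact .inl ⟨k, h, rfl⟩
    · obtain ⟨i, rfl⟩ := exists_add_of_le (not_lt.1 h)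
      exact .inr ⟨i, by simpa using hk, by rw [hsub]⟩

/-- Finite sets of reals can be sorted. -/
theorem exists_sorted {e : M.N → M.R} (he : Internal M e) {n : M.N} (hn : 0 < n) :
    ∃ (m : M.N) (c : M.N → M.R), Internal M c ∧ (∀ j < m, c j < c (j + 1)) ∧
      (∀ j ≤ m, ∃ i < n, c j = e i) ∧ ∀ i < n, ∃ j ≤ m, c j = e i := by
  classical
  -- Sorting starts at a minimum of `e`, that is, a maximum of `-e`.
  obtain ⟨i₀, hi₀, -, hmin⟩ := exists_max (P := fun _ => True) (by fun_prop) (a := fun i => -e i)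
    (by fun_prop) ⟨0, hn, trivial⟩
  have hmin (i : M.N) (hi : i < n) : e i₀ ≤ e i := neg_le_neg_iff.1 (hmin i hi trivial)
  -- The index `i'` gives the next larger value of `e`, or equals `i` if the value at `i` is already
  -- maximal.
  let Q (i i' : M.N) : Prop := (i' < n ∧ e i < e i' ∧ ∀ k, k < n → e i < e k → e i' ≤ e k) ∨
    (i' = i ∧ ∀ k, k < n → e k ≤ e i)
  have hQ : Internal M (fun p : M.N × M.N => Q p.1 p.2) := by
    dsimp only [Q]
    fun_prop
  have hex (i : M.N) : ∃ i', Q i i' := by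
    by_cases h : ∃ k < n, e i < e k
    · obtain ⟨k, hk, hk', h'⟩ := exists_max (P := fun k => e i < e k) (by fun_prop)
        (a := fun i => -e i) (by fun_prop) h
      exact ⟨k, .inl ⟨hk, hk', fun j hj hj' => neg_le_neg_iff.1 (h' j hj hj')⟩⟩
    · exact ⟨i, .inr ⟨rfl, fun k hk => not_lt.1 fun h' => h ⟨k, hk, h'⟩⟩⟩
  let nxt (i : M.N) : M.N := least (Q i)
  have hnxt : Internal M nxt := by
    dsimp only [nxt]
    fun_prop
  have hspec (i : M.N) : Q i (nxt i) := (least_spec (hQ.right i) (hex i)).1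
  let idx (j : M.N) : M.N := nrec (fun _ i => nxt i) i₀ j
  have hidx : Internal M idx := by
    dsimp only [idx]
    fun_prop
  have h₀ : idx 0 = i₀ := nrec_zero _ _
  have hs (j : M.N) : idx (j + 1) = nxt (idx j) := nrec_succ (by fun_prop) _ _
  clear_value nxt idx
  have hlt (j : M.N) : idx j < n := by
    refine induction (P := fun j => idx j < n) (by fun_prop) (by rwa [h₀]) (fun j ih => ?_) j
    rw [hs]
    rcases hspec (idx j) with h | h
    · exact h.1
    · rw [h.1]
      exact ih
  -- The iteration reaches a maximum: otherwise the number `S j` of indices with values above the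
  -- `j`-th one would drop by at least one in each step, yet remain nonnegative, against the
  -- Archimedean property.
  have hterm : ∃ j, ∀ i, i < n → e i ≤ e (idx j) := by
    by_contra! h
    let S (j : M.N) : M.R := sum n fun i => if e (idx j) < e i then 1 else 0
    have hS : Internal M S := by
      dsimp only [S]
      fun_prop
    have hpos (j : M.N) : 0 ≤ S j :=
      sum_nonneg (by fun_prop) fun i _ => by split_ifs <;> simp
    have hstep (j : M.N) : S (j + 1) + 1 ≤ S j := by
      have h' := (hspec (idx j)).resolve_right fun h' => by
        obtain ⟨i, hi, hi'⟩ := h j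
        exact (h'.2 i hi).not_gt hi'
      rw [← hs] at h'
      have key : (1 : M.R) ≤ S j - S (j + 1) := by
        dsimp only [S]
        rw [← sum_sub (by fun_prop) (by fun_prop)]
        refine le_trans ?_ (single_le_sum (by fun_prop) (fun i hi => ?_) h'.1)
        · simp [h'.2.1]
        · have := h'.2.2 i hi
          by_cases h₁ : e (idx (j + 1)) < e i
          · simp [h₁, h'.2.1.trans h₁]
          · rw [if_neg h₁, sub_zero]
            split_ifs <;> simp
      linarith
    obtain ⟨j, hj⟩ := exists_lt_ofN (S 0)
    have : S j + ofN M j ≤ S 0 := by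
      refine induction (P := fun j => S j + ofN M j ≤ S 0) (by fun_prop) (by simp)
        (fun j ih => ?_) j
      rw [map_add, map_one]
      linarith [hstep j]
    linarith [hpos j]
  obtain ⟨hm, hm'⟩ := least_spec (P := fun j => ∀ i, i < n → e i ≤ e (idx j)) (by fun_prop) hterm
  generalize (least fun j => ∀ i, i < n → e i ≤ e (idx j)) = m at hm hm'
  have hstep (j : M.N) (hj : j < m) : e (idx j) < e (idx (j + 1)) ∧
      ∀ k, k < n → e (idx j) < e k → e (idx (j + 1)) ≤ e k := by
    rcases hspec (idx j) with h' | h'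
    · rw [hs]
      exact h'.2
    · exact (hm' j hj h'.2).elim
  refine ⟨m, fun j => e (idx j), by fun_prop, fun j hj => (hstep j hj).1,
    fun j _ => ⟨idx j, hlt j, rfl⟩, fun i hi => ?_⟩
  rcases (hm i hi).lt_or_eq with h | h
  · obtain ⟨j, hj, h₁, h₂⟩ := exists_cell (c := fun j => e (idx j)) (by fun_prop)
      (by simpa only [h₀] using hmin i hi) h
    refine ⟨j, hj.le, h₁.eq_of_not_lt fun h' => ?_⟩
    exact ((hstep j hj).2 i hi h').not_gt h₂
  · exact ⟨m, le_rfl, h.symm⟩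

/-! ### Comparison of lengths -/

/-- The length of the intersection of the intervals `[a, b]` and `[u, v]`. -/
noncomputable def overlap (a b u v : M.R) : M.R := (min b v - min a v) - (min b u - min a u)

theorem overlap_comm (a b u v : M.R) : overlap a b u v = overlap u v a b := by
  rw [overlap, overlap, min_comm b v, min_comm a v, min_comm b u, min_comm a u]
  ring

/-- The definition by minima makes the overlap additive and symmetric for arbitrary reals; the order
of the endpoints enters only into its sign and bounds. -/
theorem overlap_add (a b c u v : M.R) :
    overlap a c u v = overlap a b u v + overlap b c u v := by
  rw [overlap, overlap, overlap]
  ring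

theorem overlap_eq {a b u v : M.R} (h₁ : a ≤ u) (h₂ : u ≤ v) (h₃ : v ≤ b) :
    overlap a b u v = v - u := by
  rw [overlap, min_eq_right h₃, min_eq_right (h₂.trans h₃), min_eq_left (h₁.trans h₂),
    min_eq_left h₁]
  ring

theorem overlap_nonneg {a b u v : M.R} (h₁ : a ≤ b) (h₂ : u ≤ v) : 0 ≤ overlap a b u v := by
  rw [overlap]
  rcases le_total b v with h | h <;> rcases le_total a v with h' | h' <;>
  rcases le_total b u with h'' | h'' <;> rcases le_total a u with h''' | h''' <;>
  simp only [min_eq_left, min_eq_right, *] <;> linarith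

theorem overlap_le {a b u v : M.R} (h₁ : a ≤ b) (h₂ : u ≤ v) : overlap a b u v ≤ b - a := by
  rw [overlap]
  rcases le_total b v with h | h <;> rcases le_total a v with h' | h' <;>
  rcases le_total b u with h'' | h'' <;> rcases le_total a u with h''' | h''' <;>
  simp only [min_eq_left, min_eq_right, *] <;> linarith

theorem exists_of_overlap_pos {a b u v : M.R} (h₁ : a ≤ b) (h₂ : u ≤ v)
    (h : 0 < overlap a b u v) : ∃ z, a < z ∧ z < b ∧ u < z ∧ z < v := by
  have : max a u < min b v := by
    by_contra! h'
    refine h.not_ge ?_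
    rcases le_max_iff.1 h' with h' | h' <;> rcases min_le_iff.1 h' with h' | h'
    · exact (overlap_le h₁ h₂).trans (by linarith)
    · rw [overlap, min_eq_right h', min_eq_right (h'.trans h₁), min_eq_right (h₂.trans h'),
        min_eq_right (h₂.trans (h'.trans h₁))]
      simp
    · rw [overlap, min_eq_left h', min_eq_left (h₁.trans h'), min_eq_left (h'.trans h₂),
        min_eq_left (h₁.trans (h'.trans h₂))]
      simp
    · rw [overlap_comm]
      exact (overlap_le h₂ h₁).trans (by linarith)
  obtain ⟨z, hz, hz'⟩ := exists_between this
  rw [max_lt_iff] at hz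
  rw [lt_min_iff] at hz'
  exact ⟨z, hz.1, hz'.1, hz.2, hz'.2⟩

@[fun_prop] theorem Internal.overlap {X : Type} [Dfl M X] {a b u v : X → M.R} (ha : Internal M a)
    (hb : Internal M b) (hu : Internal M u) (hv : Internal M v) :
    Internal M fun x => overlap (a x) (b x) (u x) (v x) := by
  unfold Model.overlap
  fun_prop

theorem sum_overlap {c : M.N → M.R} (hc : Internal M c) (m : M.N) (u v : M.R) :
    sum m (fun i => overlap (c i) (c (i + 1)) u v) = overlap (c 0) (c m) u v := by
  refine induction (P := fun m => sum m (fun i => overlap (c i) (c (i + 1)) u v) =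
    overlap (c 0) (c m) u v) (by fun_prop) (by simp [overlap]) (fun m ih => ?_) m
  rw [sum_succ (by fun_prop), ih, ← overlap_add]

open Classical in
/-- Comparison of the total lengths of two finite families of intervals. -/
theorem sum_length_le {m m' : M.N} {c c' : M.N → M.R} (hc : Internal M c) (hc' : Internal M c')
    {B B' : M.N → Prop} (hB : Internal M B) (hB' : Internal M B')
    (hmono : ∀ i < m, c i ≤ c (i + 1)) (hmono' : ∀ j < m', c' j ≤ c' (j + 1))
    {α β : M.R} (hα : α ≤ c' 0) (hβ : c' m' ≤ β)
    (h : ∀ i < m, B i → ∀ z, c i < z → z < c (i + 1) → α ≤ z ∧ z ≤ β ∧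
      ∀ j < m', c' j < z → z < c' (j + 1) → B' j) :
    sum m (fun i => if B i then c (i + 1) - c i else 0) ≤
      sum m' (fun j => if B' j then c' (j + 1) - c' j else 0) + (c' 0 - α) + (β - c' m') := by
  have hle : c' 0 ≤ c' m' := mono_of_le_succ hc' hmono' (zero_le' _) le_rfl
  have hcle : c 0 ≤ c m := mono_of_le_succ hc hmono (zero_le' _) le_rfl
  -- Each counted cell of the first family is distributed over the counted cells of the second
  -- family and the two margins `[α, c' 0]` and `[c' m', β]`.
  have h₁ : sum m (fun i => if B i then c (i + 1) - c i else 0) ≤ sum m (fun i =>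
      sum m' (fun j => if B' j then overlap (c i) (c (i + 1)) (c' j) (c' (j + 1)) else 0) +
        overlap (c i) (c (i + 1)) α (c' 0) + overlap (c i) (c (i + 1)) (c' m') β) := by
    refine sum_le_sum (by fun_prop) (by fun_prop) fun i hi => ?_
    have hi' := hmono i hi
    split_ifs with hBi
    · rcases hi'.lt_or_eq with hi' | hi'
      · have hα' : α ≤ c i := by
          by_contra! h'
          obtain ⟨z, hz, hz'⟩ := exists_between (lt_min h' hi')
          rw [lt_min_iff] at hz'
          exact (h i hi hBi z hz hz'.2).1.not_gt hz'.1
        have hβ' : c (i + 1) ≤ β := by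
          by_contra! h'
          obtain ⟨z, hz, hz'⟩ := exists_between (max_lt h' hi')
          rw [max_lt_iff] at hz
          exact (h i hi hBi z hz.2 hz').2.1.not_gt hz.1
        -- Cells that are not counted contribute nothing: a positive overlap would contain a point
        -- `z`, and the hypothesis would give `B' j`.
        have h₂ : sum m' (fun j =>
            if B' j then overlap (c i) (c (i + 1)) (c' j) (c' (j + 1)) else 0) =
            sum m' (fun j => overlap (c' j) (c' (j + 1)) (c i) (c (i + 1))) := by
          refine sum_congr (by fun_prop) (by fun_prop) fun j hj => ?_
          rw [overlap_comm]
          split_ifs with hBj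
          · rfl
          · refine (overlap_nonneg (hmono' j hj) hi'.le).eq_of_not_lt fun h' => hBj ?_
            obtain ⟨z, h₁, h₂, h₃, h₄⟩ := exists_of_overlap_pos (hmono' j hj) hi'.le h'
            exact (h i hi hBi z h₃ h₄).2.2 j hj h₁ h₂
        have e₁ := overlap_add α (c' 0) β (c i) (c (i + 1))
        have e₂ := overlap_add (c' 0) (c' m') β (c i) (c (i + 1))
        have e₃ := overlap_comm (c i) (c (i + 1)) α (c' 0)
        have e₄ := overlap_comm (c i) (c (i + 1)) (c' m') β
        have e₅ := overlap_eq hα' hi'.le hβ'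
        rw [h₂, sum_overlap hc']
        linarith
      · rw [← hi', sub_self]
        refine add_nonneg (add_nonneg (sum_nonneg (by fun_prop) fun j hj => ?_)
          (overlap_nonneg le_rfl hα)) (overlap_nonneg le_rfl hβ)
        split_ifs
        · exact overlap_nonneg le_rfl (hmono' j hj)
        · exact le_rfl
    · refine add_nonneg (add_nonneg (sum_nonneg (by fun_prop) fun j hj => ?_)
        (overlap_nonneg hi' hα)) (overlap_nonneg hi' hβ)
      split_ifs
      · exact overlap_nonneg hi' (hmono' j hj)
      · exact le_rfl
  -- After interchanging the sums, the cells of the first family together overlap each cell of the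
  -- second family, and each margin, in at most its length.
  refine h₁.trans ?_
  rw [sum_add (by fun_prop) (by fun_prop), sum_add (by fun_prop) (by fun_prop), sum_overlap hc,
    sum_overlap hc, sum_comm (a := fun i j =>
      if B' j then overlap (c i) (c (i + 1)) (c' j) (c' (j + 1)) else 0) (by fun_prop)]
  refine add_le_add (add_le_add (sum_le_sum (by fun_prop) (by fun_prop) fun j hj => ?_) ?_) ?_
  · split_ifs
    · rw [sum_overlap hc, overlap_comm]
      exact overlap_le (hmono' j hj) hcle
    · simp
  · rw [overlap_comm]
    exact overlap_le hα hcle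
  · rw [overlap_comm]
    exact overlap_le hβ hcle

end Model
end HOA

namespace HOA
namespace Model

variable {M : Model}

/-! ### From integrals to weak compactness -/

/-- Without fine partitions for `δ` and `η`, every real is vacuously an L-integral of the zero
function. -/
theorem UniqueIntegral.exists_fine (h : UniqueIntegral M) {δ : M.R → M.R} (hδ : Internal M δ)
    (hpos : ∀ r, 0 < δ r) {η : M.R} (hη : 0 < η) : ∃ (k : M.N) (t x : M.N → M.R), Internal M t ∧ Internal M x ∧
      IsTP k t x ∧ 1 - η ≤ fineLength δ k t x := by
  by_contra! h'
  have hL (A : M.R) : LInt (fun _ => (0 : M.R)) A := ⟨⟨0, by simp⟩, fun ε hε =>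
    ⟨η, hη, δ, hδ, hpos, fun k t x ht hx hP hf => ((h' k t x ht hx hP).not_ge hf).elim⟩⟩
  exact zero_ne_one (h _ (by fun_prop) 0 1 (hL 0) (hL 1))

/-- As before, `1` would be an L-integral of the zero function, whose Riemann integral is `0`. -/
theorem ConsistentIntegral.exists_fine (h : ConsistentIntegral M) {δ : M.R → M.R}
    (hδ : Internal M δ) (hpos : ∀ r, 0 < δ r) {η : M.R} (hη : 0 < η) :
    ∃ (k : M.N) (t x : M.N → M.R), Internal M t ∧ Internal M x ∧ IsTP k t x ∧ 1 - η ≤ fineLength δ k t x := by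
  by_contra! h'
  have hL (A : M.R) : LInt (fun _ => (0 : M.R)) A := ⟨⟨0, by simp⟩, fun ε hε =>
    ⟨η, hη, δ, hδ, hpos, fun k t x ht hx hP hf => ((h' k t x ht hx hP).not_ge hf).elim⟩⟩
  have hR : RInt (fun _ => (0 : M.R)) 0 := fun ε hε =>
    ⟨1, one_pos, fun k t x _ _ _ _ => by simpa [riemannSum] using hε⟩
  exact one_ne_zero ((h _ (by fun_prop) 0 hR).2 1 (hL 1))

/-- The length does not depend on the subdivision. Hence the lengths supplied by weak compactness
may be replaced by those of `exists_lengths`. -/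
theorem IsLength.le {Ψ : M.R → M.R} {y : M.N → M.R} {i : M.N} {l l' : M.R}
    (h : IsLength Ψ y i l) (h' : IsLength Ψ y i l') : l ≤ l' := by
  classical
  obtain ⟨m, c, B, hc, hB, hmono, hmem, hcell, rfl⟩ := h
  obtain ⟨m', c', B', hc', hB', hmono', hmem', hcell', rfl⟩ := h'
  refine (sum_length_le hc hc' hB hB' hmono hmono' le_rfl le_rfl
    fun i hi hBi z hz hz' => ?_).trans (by simp)
  have hJ := (hcell i hi).1 hBi z hz hz'
  refine ⟨(hmem' z hJ).1, (hmem' z hJ).2, fun j hj h₁ h₂ => ?_⟩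
  by_contra hBj
  exact (hcell' j hj).2 hBj z h₁ h₂ hJ

theorem IsLength.eq {Ψ : M.R → M.R} {y : M.N → M.R} {i : M.N} {l l' : M.R}
    (h : IsLength Ψ y i l) (h' : IsLength Ψ y i l') : l = l' :=
  le_antisymm (h.le h') (h'.le h)

theorem le_or_le_of_strictMono {c : M.N → M.R} (hc : Internal M c) {m : M.N}
    (h : ∀ j < m, c j < c (j + 1)) {p j : M.N} (hp : p ≤ m) (hj : j < m) :
    c p ≤ c j ∨ c (j + 1) ≤ c p := by
  rcases le_or_gt p j with h' | h'
  · exact .inl (mono_of_le_succ hc (fun j hj => (h j hj).le) h' hj.le)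
  · exact .inr (mono_of_le_succ hc (fun j hj => (h j hj).le) (Order.add_one_le_iff.2 h') hp)

/-- Cut at all endpoints of the intervals `J_i` with `i < n`. No endpoint lies inside a cell, so
each `J_i` contains the interior of a cell or is disjoint from it. -/
theorem exists_decomposition {Ψ : M.R → M.R} (hΨ : Internal M Ψ) {y : M.N → M.R}
    (hy : Internal M y) {n : M.N} (hn : 0 < n) :
    ∃ (m : M.N) (c : M.N → M.R), Internal M c ∧ (∀ j < m, c j < c (j + 1)) ∧
      (∀ i < n, c 0 ≤ y i - Ψ (y i) ∧ y i + Ψ (y i) ≤ c m) ∧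
      ∀ i < n, ∀ j < m, ∀ z w, c j < z → z < c (j + 1) → c j < w → w < c (j + 1) →
        InJ Ψ (y i) z → InJ Ψ (y i) w := by
  obtain ⟨e, he, hea, heb, -⟩ := exists_union (a := fun i => y i - Ψ (y i)) (by fun_prop)
    (b := fun i => y i + Ψ (y i)) (by fun_prop) n n
  obtain ⟨m, c, hc, hmono, -, hce⟩ := exists_sorted he (n := n + n)
    (hn.trans_le le_self_add)
  have hmono' (j : M.N) (hj : j < m) : c j ≤ c (j + 1) := (hmono j hj).le
  have ha (i : M.N) (hi : i < n) : ∃ p ≤ m, c p = y i - Ψ (y i) := by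
    obtain ⟨k, hk, h⟩ := hea i hi
    rw [← h]
    exact hce k hk
  have hb (i : M.N) (hi : i < n) : ∃ p ≤ m, c p = y i + Ψ (y i) := by
    obtain ⟨k, hk, h⟩ := heb i hi
    rw [← h]
    exact hce k hk
  refine ⟨m, c, hc, hmono, fun i hi => ⟨?_, ?_⟩, fun i hi j hj z w hz hz' hw hw' hJ => ?_⟩
  · obtain ⟨p, hp, h⟩ := ha i hi
    rw [← h]
    exact mono_of_le_succ hc hmono' (zero_le' p) hp
  · obtain ⟨p, hp, h⟩ := hb i hi
    rw [← h]
    exact mono_of_le_succ hc hmono' hp le_rfl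
  · obtain ⟨p, hp, h⟩ := ha i hi
    obtain ⟨q, hq, h'⟩ := hb i hi
    rw [InJ, ← h, ← h'] at hJ ⊢
    constructor
    · rcases le_or_le_of_strictMono hc hmono hp hj with h₁ | h₁
      · exact h₁.trans_lt hw
      · exact (h₁.not_gt (hJ.1.trans hz')).elim
    · rcases le_or_le_of_strictMono hc hmono hq hj with h₁ | h₁
      · exact (h₁.not_gt (hz.trans hJ.2)).elim
      · exact hw'.trans_le h₁

-- `Q i` says that `i` is the first index with `P`, so at most one summand is nonzero. For the sets
-- `J_i'` this means that a cell of the union is counted exactly once.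
open Classical in
theorem sum_first {P Q : M.N → Prop} (hP : Internal M P) (hQ : Internal M Q)
    (h : ∀ i, Q i ↔ P i ∧ ∀ j, j < i → ¬P j) (n : M.N) (d : M.R) :
    (sum n fun i => if Q i then d else 0) = if ∃ i, i < n ∧ P i then d else 0 := by
  refine induction (P := fun n => (sum n fun i => if Q i then d else 0) =
      if ∃ i, i < n ∧ P i then d else 0) (by fun_prop)
    (by simp [(zero_le' _).not_gt]) (fun n ih => ?_) n
  rw [sum_succ (by fun_prop), ih]
  have h₁ : (∃ i, i < n + 1 ∧ P i) ↔ (∃ i, i < n ∧ P i) ∨ P n := by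
    constructor
    · rintro ⟨i, hi, h⟩
      rcases (Order.lt_add_one_iff.1 hi).lt_or_eq with h' | rfl
      · exact .inl ⟨i, h', h⟩
      · exact .inr h
    · rintro (⟨i, hi, h⟩ | h)
      · exact ⟨i, hi.trans (lt_add_one n), h⟩
      · exact ⟨n, lt_add_one n, h⟩
  have h₂ : (∀ j, j < n → ¬P j) ↔ ¬ ∃ i, i < n ∧ P i := by
    push Not
    rfl
  simp only [h, h₂, h₁]
  by_cases h₃ : ∃ i, i < n ∧ P i <;> simp [h₃]

@[fun_prop] theorem Internal.inJ {X : Type} [Dfl M X] {Ψ : M.R → M.R} (hΨ : Internal M Ψ)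
    {u v : X → M.R} (hu : Internal M u) (hv : Internal M v) :
    Internal M fun x => InJ Ψ (u x) (v x) := by
  unfold InJ
  fun_prop

open Classical in
/-- The lengths of the sets `J_i'` exist and add up to the length of the union of the `J_i`. -/
theorem exists_lengths {Ψ : M.R → M.R} (hΨ : Internal M Ψ) {y : M.N → M.R}
    (hy : Internal M y) {n : M.N} (hn : 0 < n) :
    ∃ (m : M.N) (c : M.N → M.R) (B : M.N → Prop) (l : M.N → M.R), Internal M c ∧ Internal M B ∧
      Internal M l ∧ (∀ j < m, c j ≤ c (j + 1)) ∧
      (∀ i < n, c 0 ≤ y i - Ψ (y i) ∧ y i + Ψ (y i) ≤ c m) ∧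
      (∀ j < m, ∀ z, c j < z → z < c (j + 1) → (B j ↔ ∃ i < n, InJ Ψ (y i) z)) ∧
      (∀ i < n, IsLength Ψ y i (l i)) ∧
      sum n l = sum m fun j => if B j then c (j + 1) - c j else 0 := by
  obtain ⟨m, c, hc, hmono, hmem, hcell⟩ := exists_decomposition hΨ hy hn
  -- Membership of a whole cell in `J_i` is tested at its midpoint, which avoids a quantifier over
  -- reals and is internal.
  let mid (j : M.N) : M.R := (c j + c (j + 1)) / 2
  have hmid (j : M.N) (hj : j < m) : c j < mid j ∧ mid j < c (j + 1) := by
    have := hmono j hj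
    constructor <;> dsimp only [mid] <;> linarith
  have hmidI : Internal M mid := by
    dsimp only [mid]
    fun_prop
  clear_value mid
  have hiff (i : M.N) (hi : i < n) (j : M.N) (hj : j < m) (z : M.R) (h : c j < z)
      (h' : z < c (j + 1)) : InJ Ψ (y i) (mid j) ↔ InJ Ψ (y i) z :=
    ⟨hcell i hi j hj _ _ (hmid j hj).1 (hmid j hj).2 h h',
      hcell i hi j hj _ _ h h' (hmid j hj).1 (hmid j hj).2⟩
  have hiff' (i : M.N) (hi : i < n) (j : M.N) (hj : j < m) (z : M.R) (h : c j < z)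
      (h' : z < c (j + 1)) : InJ' Ψ y i (mid j) ↔ InJ' Ψ y i z :=
    and_congr (hiff i hi j hj z h h') (forall₂_congr fun i' hi' =>
      not_congr (hiff i' (hi'.trans hi) j hj z h h'))
  obtain ⟨Q, hQ, hQ'⟩ : ∃ Q : M.N → M.N → Prop, Internal M (fun p : M.N × M.N => Q p.1 p.2) ∧
      ∀ i j, Q i j ↔ InJ' Ψ y i (mid j) :=
    ⟨fun i j => InJ Ψ (y i) (mid j) ∧ ∀ i', i' < i → ¬InJ Ψ (y i') (mid j), by fun_prop,
      fun i j => Iff.rfl⟩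
  refine ⟨m, c, fun j => ∃ i, i < n ∧ InJ Ψ (y i) (mid j),
    fun i => sum m fun j => if Q i j then c (j + 1) - c j else 0, hc, by fun_prop, by fun_prop,
    fun j hj => (hmono j hj).le, hmem, fun j hj z h h' => ?_, fun i hi => ?_, ?_⟩
  · exact exists_congr fun i => and_congr_right fun hi => hiff i hi j hj z h h'
  · refine ⟨m, c, fun j => Q i j, hc, by fun_prop, fun j hj => (hmono j hj).le,
      fun z hz => ⟨?_, ?_⟩, fun j hj => ⟨fun h z hz hz' => ?_, fun h z hz hz' h' => ?_⟩, rfl⟩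
    · exact (hmem i hi).1.trans hz.1.1.le
    · exact hz.1.2.le.trans (hmem i hi).2
    · exact (hiff' i hi j hj z hz hz').1 ((hQ' i j).1 h)
    · exact h ((hQ' i j).2 ((hiff' i hi j hj z hz hz').2 h'))
  · rw [sum_comm (a := fun i j => if Q i j then c (j + 1) - c j else 0) (by fun_prop)]
    refine sum_congr (by fun_prop) (by fun_prop) fun j _ => ?_
    exact sum_first (P := fun i => InJ Ψ (y i) (mid j)) (by fun_prop) (by fun_prop)
      (fun i => hQ' i j) n _

open Classical in
theorem exists_fineLength_eq {δ : M.R → M.R} (hδ : Internal M δ) {t x : M.N → M.R}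
    (ht : Internal M t) (hx : Internal M x) : ∃ B : M.N → Prop, Internal M B ∧
      (∀ i, B i ↔ t i - δ (t i) ≤ x i ∧ x (i + 1) ≤ t i + δ (t i)) ∧
      ∀ k, fineLength δ k t x = sum (k + 1) fun i => if B i then x (i + 1) - x i else 0 := by
  obtain ⟨B, hB, hB'⟩ : ∃ B : M.N → Prop, Internal M B ∧
      ∀ i, B i ↔ t i - δ (t i) ≤ x i ∧ x (i + 1) ≤ t i + δ (t i) :=
    ⟨fun i => t i - δ (t i) ≤ x i ∧ x (i + 1) ≤ t i + δ (t i), by fun_prop, fun i => Iff.rfl⟩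
  refine ⟨B, hB, hB', fun k => ?_⟩
  rw [fineLength]
  simp only [hB']

/-- Take the tags of a fine partition as centres. The interior of a fine interval lies in `J` around
its tag, so the fine length is at most the length of the union, which is the sum of the lengths of
the `J_i'`. Composing `Ψ` with `clamp` gives a gauge on all reals. -/
theorem weakCompactness_of_exists_fine (h : ∀ δ : M.R → M.R, Internal M δ → (∀ r, 0 < δ r) →
    ∀ η > 0, ∃ (k : M.N) (t x : M.N → M.R), Internal M t ∧ Internal M x ∧ IsTP k t x ∧ 1 - η ≤ fineLength δ k t x) :
    WeakCompactness M := by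
  classical
  intro Ψ hΨ hpos ε hε
  obtain ⟨k, t, x, ht, hx, hP, hfine⟩ := h (fun r => Ψ (clamp r)) (by fun_prop)
    (fun r => hpos _ ⟨clamp_nonneg r, clamp_le_one r⟩) ε hε
  have htag (i : M.N) (hi : i ≤ k) := hP.tag_mem hx hi
  obtain ⟨m, c, B, l, hc, hB, hl, hmono, hmem, hcell, hlen, hsum⟩ :=
    exists_lengths hΨ ht (n := k + 1) (Order.lt_add_one_iff.2 (zero_le' k))
  refine ⟨k, t, l, ht, hl, htag, fun i hi => hlen i (Order.lt_add_one_iff.2 hi), hfine.trans ?_⟩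
  obtain ⟨B', hB₁, hB₂, hB₃⟩ :=
    exists_fineLength_eq (δ := fun r => Ψ (clamp r)) (by fun_prop) ht hx
  rw [hsum, hB₃]
  -- The cells of `c` span all the intervals `J_i`, so both margins are empty.
  refine (sum_length_le hx hc hB₁ hB (fun i hi =>
    (hP.2.2 i (Order.lt_add_one_iff.1 hi)).1.le) hmono le_rfl le_rfl
    fun i hi hBi z hz hz' => ?_).trans (by simp)
  have hti := htag i (Order.lt_add_one_iff.1 hi)
  rw [hB₂, clamp_eq hti.1 hti.2] at hBi
  have hJ : InJ Ψ (t i) z := ⟨hBi.1.trans_lt hz, hz'.trans_le hBi.2⟩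
  exact ⟨(hmem i hi).1.trans hJ.1.le, hJ.2.le.trans (hmem i hi).2,
    fun j hj h₁ h₂ => (hcell j hj z h₁ h₂).2 ⟨i, hi, hJ⟩⟩

end Model
end HOA

namespace HOA
namespace Model

variable {M : Model}

/-! ### From weak compactness to the existence of fine partitions -/

/-- `F` is a finite set of reals, in the sense of the model. -/
def IsFinite (F : M.R → Prop) : Prop :=
  ∃ (n : M.N) (e : M.N → M.R), Internal M e ∧ ∀ z, F z ↔ ∃ i < n, e i = z

theorem IsFinite.range {a : M.N → M.R} (ha : Internal M a) (n : M.N) :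
    IsFinite fun z => ∃ i < n, a i = z := ⟨n, a, ha, fun _ => Iff.rfl⟩

theorem IsFinite.singleton (a : M.R) : IsFinite fun z => z = a :=
  ⟨1, fun _ => a, by fun_prop, fun _ => ⟨fun h => ⟨0, by simp, h.symm⟩, fun ⟨_, _, h⟩ => h.symm⟩⟩

theorem IsFinite.union {F G : M.R → Prop} (hF : IsFinite F) (hG : IsFinite G) :
    IsFinite fun z => F z ∨ G z := by
  obtain ⟨m, a, ha, hF⟩ := hF
  obtain ⟨n, b, hb, hG⟩ := hG
  obtain ⟨c, hc, h₁, h₂, h₃⟩ := exists_union ha hb m n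
  refine ⟨m + n, c, hc, fun z => ?_⟩
  simp only [hF, hG]
  constructor
  · rintro (⟨i, hi, rfl⟩ | ⟨i, hi, rfl⟩)
    · exact h₁ i hi
    · exact h₂ i hi
  · rintro ⟨k, hk, rfl⟩
    exact (h₃ k hk).imp (fun ⟨i, hi, h⟩ => ⟨i, hi, h.symm⟩) fun ⟨i, hi, h⟩ => ⟨i, hi, h.symm⟩

/-- Sort `F`. The last clause says that no element of `F` lies inside a cell; it identifies the cell
of a given point in `exists_partition_of_chain`. -/
theorem IsFinite.exists_partition {F : M.R → Prop} (hF : IsFinite F) (h₀ : F 0) (h₁ : F 1)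
    (hmem : ∀ z, F z → 0 ≤ z ∧ z ≤ 1) : ∃ (k : M.N) (x : M.N → M.R), Internal M x ∧ x 0 = 0 ∧
      x (k + 1) = 1 ∧ (∀ i ≤ k, x i < x (i + 1)) ∧ (∀ i ≤ k + 1, F (x i)) ∧
      ∀ z, F z → ∀ i ≤ k, z ≤ x i ∨ x (i + 1) ≤ z := by
  obtain ⟨n, e, he, hF⟩ := hF
  have hn : 0 < n := by
    obtain ⟨i, hi, -⟩ := (hF 0).1 h₀
    exact (zero_le' i).trans_lt hi
  obtain ⟨m, c, hc, hmono, hce, hec⟩ := exists_sorted he hn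
  have hmono' (j : M.N) (hj : j < m) : c j ≤ c (j + 1) := (hmono j hj).le
  have hFc (j : M.N) (hj : j ≤ m) : F (c j) := by
    obtain ⟨i, hi, h⟩ := hce j hj
    exact (hF _).2 ⟨i, hi, h.symm⟩
  have hcF (z : M.R) (hz : F z) : ∃ j ≤ m, c j = z := by
    obtain ⟨i, hi, rfl⟩ := (hF z).1 hz
    exact hec i hi
  have hc₀ : c 0 = 0 := by
    obtain ⟨j, hj, h⟩ := hcF 0 h₀
    exact le_antisymm (by rw [← h]; exact mono_of_le_succ hc hmono' (zero_le' j) hj)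
      (hmem _ (hFc 0 (zero_le' m))).1
  have hc₁ : c m = 1 := by
    obtain ⟨j, hj, h⟩ := hcF 1 h₁
    exact le_antisymm (hmem _ (hFc m le_rfl)).2
      (by rw [← h]; exact mono_of_le_succ hc hmono' hj le_rfl)
  rcases eq_zero_or_eq_add_one m with rfl | ⟨k, rfl⟩
  · exact (zero_ne_one (hc₀.symm.trans hc₁)).elim
  · refine ⟨k, c, hc, hc₀, hc₁, fun i hi => hmono i (Order.lt_add_one_iff.2 hi), hFc,
      fun z hz i hi => ?_⟩
    obtain ⟨p, hp, rfl⟩ := hcF z hz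
    exact le_or_le_of_strictMono hc hmono hp (Order.lt_add_one_iff.2 hi)

/-- Discarding the intervals contained in others, and sorting the remaining ones. -/
theorem exists_chain {Ψ : M.R → M.R} (hΨ : Internal M Ψ) {y : M.N → M.R} (hy : Internal M y)
    {n : M.N} (hn : 0 < n) : ∃ (r : M.N) (v : M.N → M.R), Internal M v ∧
      (∀ s < r, v s < v (s + 1)) ∧ (∀ s ≤ r, ∃ i < n, v s = y i) ∧
      (∀ s s', s ≤ s' → s' ≤ r → v s - Ψ (v s) ≤ v s' - Ψ (v s') ∧
        v s + Ψ (v s) ≤ v s' + Ψ (v s')) ∧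
      ∀ i < n, ∃ s ≤ r, v s - Ψ (v s) ≤ y i - Ψ (y i) ∧ y i + Ψ (y i) ≤ v s + Ψ (v s) := by
  -- `Q i k` is the inclusion of `J_i` in `J_k`, and `P i k` moreover requires the radius of `J_k`
  -- to be maximal. Every `J_i` is replaced by such a maximal interval.
  let Q (i k : M.N) : Prop := y k - Ψ (y k) ≤ y i - Ψ (y i) ∧ y i + Ψ (y i) ≤ y k + Ψ (y k)
  let P (i k : M.N) : Prop := k < n ∧ Q i k ∧ ∀ j, j < n → Q i j → Ψ (y j) ≤ Ψ (y k)
  have hQ : Internal M (fun p : M.N × M.N => Q p.1 p.2) := by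
    dsimp only [Q]
    fun_prop
  have hP : Internal M (fun p : M.N × M.N => P p.1 p.2) := by
    dsimp only [P, Q]
    fun_prop
  have htop (i : M.N) (hi : i < n) : P i (least (P i)) :=
    (least_spec (hP.right i) (exists_max (P := Q i) (a := fun k => Ψ (y k)) (hQ.right i)
      (by fun_prop) ⟨i, hi, le_rfl, le_rfl⟩)).1
  have htopI : Internal M fun i => y (least (P i)) := by
    dsimp only [P, Q]
    fun_prop
  obtain ⟨r, v, hv, hmono, hvw, hwv⟩ := exists_sorted htopI hn
  refine ⟨r, v, hv, hmono, fun s hs => ?_, fun s s' hss hs' => ?_, fun i hi => ?_⟩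
  · obtain ⟨i, hi, h⟩ := hvw s hs
    exact ⟨_, (htop i hi).1, h⟩
  · have hle : v s ≤ v s' := mono_of_le_succ hv (fun j hj => (hmono j hj).le) hss hs'
    obtain ⟨i, hi, h⟩ := hvw s (hss.trans hs')
    obtain ⟨i', hi', h'⟩ := hvw s' hs'
    obtain ⟨-, hQ₁, hmax⟩ := htop i hi
    obtain ⟨-, hQ₁', hmax'⟩ := htop i' hi'
    have h₁ := hmax _ (htop i' hi').1
    have h₁' := hmax' _ (htop i hi).1
    simp only [Q] at hQ₁ hQ₁' h₁ h₁'
    rw [← h] at hQ₁ h₁ h₁'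
    rw [← h'] at hQ₁' h₁ h₁'
    constructor
    -- As `v s ≤ v s'`, left ends in the wrong order would make `J` around `v s'` a larger interval
    -- containing the one around `v s`, against maximality. The right ends are treated
    -- symmetrically.
    · by_contra! hlt
      have := h₁ ⟨by linarith, by linarith⟩
      linarith
    · by_contra! hlt
      have := h₁' ⟨by linarith, by linarith⟩
      linarith
  · obtain ⟨s, hs, h⟩ := hwv i hi
    exact ⟨s, hs, by rw [h]; exact (htop i hi).2.1⟩

/-- Both ends of the intervals increase with the centre. Between successive centres `v s` and `v (s
+ 1)`, the interval around `v s` reaches up to `q s`, the one around `v (s + 1)` covers what lies to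
the right of `q' s`, and nothing between `q s` and `q' s` is covered at all. With these points, the
centres, `0`, `1` and the left end `p` of the first interval as cut points, each cell that meets the
union is covered from one of its own ends. -/
theorem exists_partition_of_chain {Ψ : M.R → M.R} (hΨ : Internal M Ψ) (hpos : ∀ r, 0 < Ψ r)
    {v : M.N → M.R} (hv : Internal M v) {r : M.N} (hmono : ∀ s < r, v s < v (s + 1))
    (hmem : ∀ s ≤ r, 0 ≤ v s ∧ v s ≤ 1)
    (hend : ∀ s s', s ≤ s' → s' ≤ r → v s - Ψ (v s) ≤ v s' - Ψ (v s') ∧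
      v s + Ψ (v s) ≤ v s' + Ψ (v s')) :
    ∃ (k : M.N) (x : M.N → M.R), Internal M x ∧ x 0 = 0 ∧ x (k + 1) = 1 ∧
      (∀ i ≤ k, x i < x (i + 1)) ∧ ∀ i ≤ k, ∀ z, x i < z → z < x (i + 1) →
        (∃ s ≤ r, InJ Ψ (v s) z) →
          x (i + 1) ≤ x i + Ψ (x i) ∨ x (i + 1) - Ψ (x (i + 1)) ≤ x i := by
  classical
  -- Next centre `nv` and left end `na` of the next interval; after the last centre, `1` stands for
  -- both, so that the rest of `[0,1]` beyond the last interval is left uncovered.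
  let nv (s : M.N) : M.R := if s < r then v (s + 1) else 1
  let na (s : M.N) : M.R := if s < r then v (s + 1) - Ψ (v (s + 1)) else 1
  let q (s : M.N) : M.R := min (v s + Ψ (v s)) (nv s)
  let q' (s : M.N) : M.R := max (q s) (na s)
  let p : M.R := max (v 0 - Ψ (v 0)) 0
  have hqI : Internal M q := by
    dsimp only [q, nv]
    fun_prop
  have hqI' : Internal M q' := by
    dsimp only [q', q, nv, na]
    fun_prop
  have hmono' (s s' : M.N) (h : s ≤ s') (h' : s' ≤ r) : v s ≤ v s' :=
    mono_of_le_succ hv (fun j hj => (hmono j hj).le) h h'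
  have hsucc {s : M.N} (hs : s < r) : s + 1 ≤ r := Order.add_one_le_iff.2 hs
  have hnv (s : M.N) (hs : s ≤ r) : v s ≤ nv s ∧ nv s ≤ 1 := by
    dsimp only [nv]
    split_ifs with h
    · exact ⟨(hmono s h).le, (hmem _ (hsucc h)).2⟩
    · exact ⟨(hmem s hs).2, le_rfl⟩
  have hna (s : M.N) : na s ≤ nv s := by
    dsimp only [na, nv]
    split_ifs with h
    · linarith [hpos (v (s + 1))]
    · exact le_rfl
  have hnv_le (s k : M.N) (h : s < k) (hk : k ≤ r) : nv s ≤ v k := by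
    have hs : s < r := h.trans_le hk
    dsimp only [nv]
    rw [if_pos hs]
    exact hmono' _ _ (Order.add_one_le_iff.2 h) hk
  have hq (s : M.N) (hs : s ≤ r) : v s ≤ q s :=
    le_min (by linarith [hpos (v s)]) (hnv s hs).1
  have hqq' (s : M.N) : q s ≤ q' s := le_max_left _ _
  have hq' (s : M.N) : q' s ≤ nv s := max_le (min_le_right _ _) (hna s)
  have hp : p ≤ v 0 := max_le (by linarith [hpos (v 0)]) (hmem 0 (zero_le' r)).1
  have hp₀ : 0 ≤ p := le_max_right _ _
  let F (z : M.R) : Prop := (z = 0 ∨ z = 1) ∨ z = p ∨ (∃ s < r + 1, v s = z) ∨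
    (∃ s < r + 1, q s = z) ∨ ∃ s < r + 1, q' s = z
  have hF : IsFinite F := ((IsFinite.singleton 0).union (.singleton 1)).union
    ((IsFinite.singleton p).union ((IsFinite.range hv _).union
      ((IsFinite.range hqI _).union (.range hqI' _))))
  have hFcases {z : M.R} (hz : F z) : z = 0 ∨ z = 1 ∨ z = p ∨
      ∃ s ≤ r, (z = v s ∨ z = q s ∨ z = q' s) := by
    rcases hz with (h | h) | h | ⟨s, hs, h⟩ | ⟨s, hs, h⟩ | ⟨s, hs, h⟩
    · exact .inl h
    · exact .inr (.inl h)
    · exact .inr (.inr (.inl h))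
    · exact .inr (.inr (.inr ⟨s, Order.lt_add_one_iff.1 hs, .inl h.symm⟩))
    · exact .inr (.inr (.inr ⟨s, Order.lt_add_one_iff.1 hs, .inr (.inl h.symm)⟩))
    · exact .inr (.inr (.inr ⟨s, Order.lt_add_one_iff.1 hs, .inr (.inr h.symm)⟩))
  have hFbd {s : M.N} (hs : s ≤ r) {z : M.R} (hz : z = v s ∨ z = q s ∨ z = q' s) :
      v s ≤ z ∧ z ≤ nv s := by
    have h₁ := hq s hs
    have h₂ := hqq' s
    have h₃ := hq' s
    rcases hz with rfl | rfl | rfl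
    · exact ⟨le_rfl, (hnv s hs).1⟩
    · exact ⟨h₁, h₂.trans h₃⟩
    · exact ⟨h₁.trans h₂, h₃⟩
  -- By this and the next two facts, no cut point lies strictly between `p` and `v 0`, between `v s`
  -- and `q s`, or between `q' s` and `v (s + 1)`.
  have hFp {z : M.R} (hz : F z) : z ≤ p ∨ v 0 ≤ z := by
    rcases hFcases hz with rfl | rfl | rfl | ⟨s, hs, h⟩
    · exact .inl hp₀
    · exact .inr (hmem 0 (zero_le' r)).2
    · exact .inl le_rfl
    · exact .inr ((hmono' _ _ (zero_le' s) hs).trans (hFbd hs h).1)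
  have hFq {s : M.N} (hs : s ≤ r) {z : M.R} (hz : F z) : z ≤ v s ∨ q s ≤ z := by
    rcases hFcases hz with rfl | rfl | rfl | ⟨k, hk, h⟩
    · exact .inl (hmem s hs).1
    · exact .inr (((hqq' s).trans (hq' s)).trans (hnv s hs).2)
    · exact .inl (hp.trans (hmono' _ _ (zero_le' s) hs))
    · rcases lt_trichotomy k s with h' | rfl | h'
      · exact .inl ((hFbd hk h).2.trans (hnv_le k s h' hs))
      · rcases h with rfl | rfl | rfl
        · exact .inl le_rfl
        · exact .inr le_rfl
        · exact .inr (hqq' k)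
      · exact .inr ((((hqq' s).trans (hq' s)).trans (hnv_le s k h' hk)).trans (hFbd hk h).1)
  have hFq' {s : M.N} (hs : s < r) {z : M.R} (hz : F z) : z ≤ q' s ∨ v (s + 1) ≤ z := by
    have hvq : v s ≤ q' s := (hq s hs.le).trans (hqq' s)
    rcases hFcases hz with rfl | rfl | rfl | ⟨k, hk, h⟩
    · exact .inl ((hmem s hs.le).1.trans hvq)
    · exact .inr (hmem _ (hsucc hs)).2
    · exact .inl ((hp.trans (hmono' _ _ (zero_le' s) hs.le)).trans hvq)
    · rcases lt_trichotomy k s with h' | rfl | h'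
      · exact .inl (((hFbd hk h).2.trans (hnv_le k s h' hs.le)).trans hvq)
      · rcases h with rfl | rfl | rfl
        · exact .inl hvq
        · exact .inl (hqq' k)
        · exact .inl le_rfl
      · exact .inr ((hmono' _ _ (Order.add_one_le_iff.2 h') hk).trans (hFbd hk h).1)
  have hFmem (z : M.R) (hz : F z) : 0 ≤ z ∧ z ≤ 1 := by
    rcases hFcases hz with rfl | rfl | rfl | ⟨s, hs, h⟩
    · exact ⟨le_rfl, zero_le_one⟩
    · exact ⟨zero_le_one, le_rfl⟩
    · exact ⟨hp₀, hp.trans (hmem 0 (zero_le' r)).2⟩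
    · exact ⟨(hmem s hs).1.trans (hFbd hs h).1, (hFbd hs h).2.trans (hnv s hs).2⟩
  have hvF (s : M.N) (hs : s ≤ r) : F (v s) :=
    .inr (.inr (.inl ⟨s, Order.lt_add_one_iff.2 hs, rfl⟩))
  have hqF (s : M.N) (hs : s ≤ r) : F (q s) :=
    .inr (.inr (.inr (.inl ⟨s, Order.lt_add_one_iff.2 hs, rfl⟩)))
  have hqF' (s : M.N) (hs : s ≤ r) : F (q' s) :=
    .inr (.inr (.inr (.inr ⟨s, Order.lt_add_one_iff.2 hs, rfl⟩)))
  obtain ⟨k, x, hx, hx₀, hx₁, hxmono, hxF, hcell⟩ := hF.exists_partition (.inl (.inl rfl))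
    (.inl (.inr rfl)) hFmem
  refine ⟨k, x, hx, hx₀, hx₁, hxmono, fun i hi z hz hz' ⟨s', hs', hJ⟩ => ?_⟩
  have hFi : F (x i) := hxF i (hi.trans le_self_add)
  have hFi' : F (x (i + 1)) := hxF (i + 1) (add_le_add_left hi 1)
  have hleft {w : M.R} (hw : F w) (h : w ≤ z) : w ≤ x i :=
    (hcell w hw i hi).resolve_right fun h' => (h.trans_lt hz').not_ge h'
  have hright {w : M.R} (hw : F w) (h : z ≤ w) : x (i + 1) ≤ w :=
    (hcell w hw i hi).resolve_left fun h' => (hz.trans_le h).not_ge h'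
  have hz₀ : 0 < z := (hFmem _ hFi).1.trans_lt hz
  have hz₁ : z < 1 := hz'.trans_le (hFmem _ hFi').2
  -- To the left of all centres: the interval that contains `z` does not extend beyond the left end
  -- of the first one, so `z` lies between `p` and `v 0`, and the right end of its cell is `v 0`.
  rcases lt_or_ge z (v 0) with hv₀ | hv₀
  · have hpz : p ≤ z := max_le ((hend 0 s' (zero_le' s') hs').1.trans hJ.1.le) hz₀.le
    have h₁ : x (i + 1) ≤ v 0 := hright (hvF 0 (zero_le' r)) hv₀.le
    have h₂ : p ≤ x i := hleft (.inr (.inl rfl)) hpz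
    have h₃ : v 0 ≤ x (i + 1) := (hFp hFi').resolve_left fun h => (hpz.trans_lt hz').not_ge h
    rw [le_antisymm h₁ h₃]
    exact .inr ((le_max_left _ _).trans h₂)
  obtain ⟨s, hs, hvs, hnvs⟩ : ∃ s ≤ r, v s ≤ z ∧ z < nv s := by
    rcases lt_or_ge z (v r) with h | h
    · obtain ⟨s, hs, h₁, h₂⟩ := exists_cell hv hv₀ h
      exact ⟨s, hs.le, h₁, by dsimp only [nv]; rwa [if_pos hs]⟩
    · exact ⟨r, le_rfl, h, by dsimp only [nv]; rwa [if_neg (lt_irrefl r)]⟩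
  have hvx : v s ≤ x i := hleft (hvF s hs) hvs
  -- If the interval around `v s` contains `z`, then the cell starts at `v s` and ends at `q s` or
  -- before.
  rcases lt_or_ge z (v s + Ψ (v s)) with hb | hb
  · have hzq : z < q s := lt_min hb hnvs
    have h₁ : x i ≤ v s := (hFq hs hFi).resolve_right fun h => (hz.trans hzq).not_ge h
    rw [le_antisymm h₁ hvx]
    exact .inl ((hright (hqF s hs) hzq.le).trans (min_le_left _ _))
  -- Otherwise the interval that contains `z` has a later centre, so `z` is not to the left of `q'
  -- s`, and the cell ends at `v (s + 1)`.
  · have hss' : s < s' := by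
      by_contra! h
      exact ((hJ.2.trans_le (hend s' s h hs).2).not_ge hb)
    have hsr : s < r := hss'.trans_le hs'
    have hza : v (s + 1) - Ψ (v (s + 1)) ≤ z :=
      (hend _ _ (Order.add_one_le_iff.2 hss') hs').1.trans hJ.1.le
    have hna' : na s = v (s + 1) - Ψ (v (s + 1)) := if_pos hsr
    have hnv' : nv s = v (s + 1) := if_pos hsr
    have hqz : q' s ≤ z := max_le ((min_le_left _ _).trans hb) (by rwa [hna'])
    have h₁ : q' s ≤ x i := hleft (hqF' s hs) hqz
    have h₂ : x (i + 1) ≤ v (s + 1) := hright (hvF _ (hsucc hsr)) (by rw [← hnv']; exact hnvs.le)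
    have h₃ : v (s + 1) ≤ x (i + 1) :=
      (hFq' hsr hFi').resolve_left fun h => (hqz.trans_lt hz').not_ge h
    rw [le_antisymm h₂ h₃, ← hna']
    exact .inr ((le_max_right _ _).trans h₁)

theorem fineLength_le {δ δ' : M.R → M.R} (hδ : Internal M δ) (hδ' : Internal M δ')
    (h : ∀ r, δ r ≤ δ' r) {k : M.N} {t x : M.N → M.R} (ht : Internal M t) (hx : Internal M x)
    (hP : IsTP k t x) : fineLength δ k t x ≤ fineLength δ' k t x := by
  refine sum_le_sum (by fun_prop) (by fun_prop) fun i hi => ?_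
  have h₁ := (hP.2.2 i (Order.lt_add_one_iff.1 hi)).1
  have h₂ := h (t i)
  by_cases h₃ : t i - δ (t i) ≤ x i ∧ x (i + 1) ≤ t i + δ (t i)
  · rw [if_pos h₃, if_pos ⟨by linarith [h₃.1], by linarith [h₃.2]⟩]
  · rw [if_neg h₃]
    split_ifs <;> linarith

/-- The radii are bounded by `η / 4`, so the union protrudes from `[0,1]` by at most `η / 4` on each
side. A union of length at least `1 - η / 2` thus leaves a fine length of at least `1 - η`. -/
theorem WeakCompactness.exists_fine (h : WeakCompactness M) {δ : M.R → M.R} (hδ : Internal M δ)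
    (hpos : ∀ r, 0 < δ r) {η : M.R} (hη : 0 < η) : ∃ (k : M.N) (t x : M.N → M.R),
      Internal M t ∧ Internal M x ∧ IsTP k t x ∧ 1 - η ≤ fineLength δ k t x := by
  classical
  let Ψ (r : M.R) : M.R := min (δ r) (η / 4)
  have hΨ : Internal M Ψ := by
    dsimp only [Ψ]
    fun_prop
  have hΨδ (r : M.R) : Ψ r ≤ δ r := min_le_left _ _
  have hΨη (r : M.R) : Ψ r ≤ η / 4 := min_le_right _ _
  have hΨpos (r : M.R) : 0 < Ψ r := lt_min (hpos r) (by linarith)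
  clear_value Ψ
  obtain ⟨n, y, l, hy, hl, hymem, hlen, hle⟩ := h Ψ hΨ (fun r _ => hΨpos r) (η / 2) (by linarith)
  have hn : 0 < n + 1 := Order.lt_add_one_iff.2 (zero_le' n)
  obtain ⟨m, c, B, l', hc, hB, hl', hmono, -, hcell, hlen', hsum⟩ := exists_lengths hΨ hy hn
  -- The lengths supplied by weak compactness agree with those of `exists_lengths`, whose sum is the
  -- length of the union.
  rw [sum_congr hl hl' fun i hi => (hlen i (Order.lt_add_one_iff.1 hi)).eq (hlen' i hi), hsum] at hle
  obtain ⟨r, v, hv, hvmono, hvy, hend, hyv⟩ := exists_chain hΨ hy hn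
  obtain ⟨k, x, hx, hx₀, hx₁, hxmono, hfine⟩ := exists_partition_of_chain hΨ hΨpos hv hvmono
    (fun s hs => by
      obtain ⟨i, hi, h⟩ := hvy s hs
      rw [h]
      exact hymem i (Order.lt_add_one_iff.1 hi)) hend
  -- The tag is the left end if its interval covers the cell, and the right end otherwise; cells
  -- that do not meet the union may get any tag.
  let t (i : M.N) : M.R := if x (i + 1) ≤ x i + Ψ (x i) then x i else x (i + 1)
  have ht : Internal M t := by
    dsimp only [t]
    fun_prop
  have hP : IsTP k t x := ⟨hx₀, hx₁, fun i hi => by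
    have := hxmono i hi
    dsimp only [t]
    split_ifs
    · exact ⟨this, le_rfl, this.le⟩
    · exact ⟨this, this.le, le_rfl⟩⟩
  refine ⟨k, t, x, ht, hx, hP, le_trans ?_ (fineLength_le hΨ hδ hΨδ ht hx hP)⟩
  obtain ⟨B', hB₁, hB₂, hB₃⟩ := exists_fineLength_eq hΨ ht hx
  -- The margins are the protruding parts, between `-(η / 4)` and `0` and between `1` and `1 + η /
  -- 4`. A cell that meets the union is fine by the choice of its tag.
  have key := sum_length_le hc hx hB hB₁ hmono (m' := k + 1)
    (fun i hi => (hxmono i (Order.lt_add_one_iff.1 hi)).le)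
    (α := -(η / 4)) (β := 1 + η / 4) (by rw [hx₀]; linarith) (by rw [hx₁]; linarith)
    (fun j hj hBj z hz hz' => by
      obtain ⟨i, hi, hJ⟩ := (hcell j hj z hz hz').1 hBj
      have hyi := hymem i (Order.lt_add_one_iff.1 hi)
      have hη' := hΨη (y i)
      refine ⟨by linarith [hJ.1], by linarith [hJ.2], fun i' hi' h₁ h₂ => (hB₂ i').2 ?_⟩
      obtain ⟨s, hs, hs'⟩ := hyv i hi
      have hlt := h₁.trans h₂
      have := hfine i' (Order.lt_add_one_iff.1 hi') z h₁ h₂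
        ⟨s, hs, hs'.1.trans_lt hJ.1, hJ.2.trans_le hs'.2⟩
      dsimp only [t]
      split_ifs with h
      · exact ⟨by linarith [hΨpos (x i')], h⟩
      · exact ⟨this.resolve_left h, by linarith [hΨpos (x (i' + 1))]⟩)
  rw [← hB₃, hx₀, hx₁] at key
  linarith

/-- With the minimum of the two gauges and of the two tolerances, one partition is fine for both
integrals, and its Riemann sum is close to both `A` and `B`. -/
theorem WeakCompactness.uniqueIntegral (h : WeakCompactness M) : UniqueIntegral M := by
  intro f hf A B hA hB
  by_contra hAB
  have hε : 0 < |A - B| / 2 := half_pos (abs_pos.2 (sub_ne_zero.2 hAB))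
  obtain ⟨η, hη, δ, hδ, hpos, h₁⟩ := hA.2 _ hε
  obtain ⟨η', hη', δ', hδ', hpos', h₂⟩ := hB.2 _ hε
  obtain ⟨k, t, x, ht, hx, hP, hfine⟩ := h.exists_fine (δ := fun r => min (δ r) (δ' r))
    (by fun_prop) (fun r => lt_min (hpos r) (hpos' r)) (lt_min hη hη')
  have h₃ := h₁ k t x ht hx hP ((sub_le_sub_left (min_le_left _ _) 1).trans (hfine.trans
    (fineLength_le (by fun_prop) hδ (fun r => min_le_left _ _) ht hx hP)))
  have h₄ := h₂ k t x ht hx hP ((sub_le_sub_left (min_le_right _ _) 1).trans (hfine.trans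
    (fineLength_le (by fun_prop) hδ' (fun r => min_le_right _ _) ht hx hP)))
  have := abs_sub_le A (riemannSum f k t x) B
  rw [abs_sub_comm A (riemannSum f k t x)] at this
  linarith

end Model
end HOA

namespace HOA
namespace Model

variable {M : Model}

/-! ### Consistency -/

/-- Take the uniform partition into `2 ^ N` cells, of mesh below `d`. Moving one tag from `x j` to
`r` changes the Riemann sum by `(f r - f (x j)) * 2 ^ (-N)`. Both sums are within `1` of `A`, so `|f
r - f (x j)|` is at most `2 * 2 ^ N`, and `|f (x j)|` is bounded by a maximum over the grid. -/
theorem RInt.bddI {f : M.R → M.R} (hf : Internal M f) {A : M.R} (h : RInt f A) : BddI f := by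
  classical
  obtain ⟨d, hd, h⟩ := h 1 one_pos
  obtain ⟨N, hN⟩ := exists_hp_lt hd
  have hpN := ofN_pw_mul_hp (M := M) N
  obtain ⟨k, hk⟩ : ∃ k, pw N = k + 1 := by
    rcases eq_zero_or_eq_add_one (pw N) with h | h
    · rw [h, map_zero, zero_mul] at hpN
      exact (zero_ne_one hpN).elim
    · exact h
  rw [hk] at hpN
  have hpos : (0 : M.R) < hp N := hp_pos N
  let x (i : M.N) : M.R := ofN M i * hp N
  have hx : Internal M x := by
    dsimp only [x]
    fun_prop
  have hstep (i : M.N) : x (i + 1) = x i + hp N := by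
    dsimp only [x]
    rw [map_add, map_one, add_mul, one_mul]
  have hx₀ : x 0 = 0 := by simp [x]
  have hx₁ : x (k + 1) = 1 := hpN
  clear_value x
  obtain ⟨i₀, -, -, hmax⟩ := exists_max (P := fun _ => True) (by fun_prop) (a := fun i => |f (x i)|)
    (by fun_prop) (n := k + 1) ⟨0, Order.lt_add_one_iff.2 (zero_le' k), trivial⟩
  obtain ⟨b, hb⟩ := exists_lt_ofN (|f (x i₀)| + 2 * ofN M (k + 1))
  refine ⟨b, fun r hr => le_trans ?_ hb.le⟩
  obtain ⟨j, hj, h₁, h₂⟩ : ∃ j < k + 1, x j ≤ r ∧ r ≤ x (j + 1) := by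
    rcases hr.2.lt_or_eq with h' | rfl
    · obtain ⟨j, hj, h₁, h₂⟩ := exists_cell hx (m := k + 1) (z := r) (by rw [hx₀]; exact hr.1)
        (by rwa [hx₁])
      exact ⟨j, hj, h₁, h₂.le⟩
    · refine ⟨k, lt_add_one k, ?_, hx₁.ge⟩
      rw [← hx₁, hstep]
      linarith
  -- Left ends as tags, except for `r` in its own cell.
  let t (i : M.N) : M.R := if i = j then r else x i
  have ht : Internal M t := by
    dsimp only [t]
    fun_prop
  have hP : IsTP k x x := ⟨hx₀, hx₁, fun i _ => by
    rw [hstep]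
    exact ⟨by linarith, le_rfl, by linarith⟩⟩
  have hP' : IsTP k t x := ⟨hx₀, hx₁, fun i hi => by
    refine ⟨(hP.2.2 i hi).1, ?_⟩
    dsimp only [t]
    split_ifs with h'
    · rw [h']
      exact ⟨h₁, h₂⟩
    · exact (hP.2.2 i hi).2⟩
  have hmesh (i : M.N) (_ : i ≤ k) : x (i + 1) - x i ≤ d := by
    rw [hstep]
    linarith
  have h₃ := abs_lt.1 (h k x x hx hx hP hmesh)
  have h₄ := abs_lt.1 (h k t x ht hx hP' hmesh)
  have h₅ : riemannSum f k t x - riemannSum f k x x = (f r - f (x j)) * hp N := by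
    rw [riemannSum, riemannSum, ← sum_sub (by fun_prop) (by fun_prop),
      sum_single (by fun_prop) hj fun i _ hi => ?_]
    · dsimp only [t]
      rw [if_pos rfl, hstep]
      ring
    · dsimp only [t]
      rw [if_neg hi, sub_self]
  have h₆ : |f r - f (x j)| * hp N < 2 := by
    rw [← abs_of_pos hpos, ← abs_mul, ← h₅, abs_lt]
    constructor <;> linarith
  have h₇ : |f r - f (x j)| ≤ 2 * ofN M (k + 1) := by
    have : (0 : M.R) ≤ ofN M (k + 1) := ofN_nonneg _
    calc |f r - f (x j)| = |f r - f (x j)| * hp N * ofN M (k + 1) := by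
          rw [mul_assoc, mul_comm (hp N), hpN, mul_one]
      _ ≤ 2 * ofN M (k + 1) := mul_le_mul_of_nonneg_right h₆.le this
  have h₈ := abs_sub_abs_le_abs_sub (f r) (f (x j))
  linarith [hmax j hj trivial]

/-- With the constant gauge `d / 2`, a fine interval has length at most `d`. With `η = d`, the other
intervals have total length at most `d`, and so has each of them. Hence the mesh is at most `d`. -/
theorem RInt.lInt {f : M.R → M.R} (hf : Internal M f) {A : M.R} (h : RInt f A) : LInt f A := by
  classical
  refine ⟨h.bddI hf, fun ε hε => ?_⟩
  obtain ⟨d, hd, h⟩ := h ε hε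
  refine ⟨d, hd, fun _ => d / 2, by fun_prop, fun _ => half_pos hd,
    fun k t x ht hx hP hfine => h k t x ht hx hP fun i hi => ?_⟩
  obtain ⟨B, hB, hB', hfl⟩ := exists_fineLength_eq (δ := fun _ => d / 2) (by fun_prop) ht hx
  rw [hfl] at hfine
  have h₁ : sum (k + 1) (fun i => if B i then 0 else x (i + 1) - x i) =
      1 - sum (k + 1) (fun i => if B i then x (i + 1) - x i else 0) := by
    have h₂ := sum_telescope hx (k + 1)
    rw [hP.1, hP.2.1, sub_zero] at h₂
    rw [← h₂, ← sum_sub (by fun_prop) (by fun_prop)]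
    refine sum_congr (by fun_prop) (by fun_prop) fun j _ => ?_
    split_ifs <;> simp
  by_cases hBi : B i
  · have := (hB' i).1 hBi
    linarith
  · have h₂ := single_le_sum (a := fun i => if B i then 0 else x (i + 1) - x i) (by fun_prop)
      (n := k + 1) (fun j hj => ?_) (Order.lt_add_one_iff.2 hi)
    · rw [if_neg hBi, h₁] at h₂
      linarith
    · have := (hP.2.2 j (Order.lt_add_one_iff.1 hj)).1
      split_ifs <;> linarith

theorem WeakCompactness.consistentIntegral (h : WeakCompactness M) : ConsistentIntegral M :=
  fun f hf A hA => ⟨⟨A, hA.lInt hf⟩, fun B hB => h.uniqueIntegral f hf B A hB (hA.lInt hf)⟩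

theorem uniqueIntegral_iff : UniqueIntegral M ↔ WeakCompactness M :=
  ⟨fun h => weakCompactness_of_exists_fine fun _ hδ hpos _ hη => h.exists_fine hδ hpos hη,
    fun h => h.uniqueIntegral⟩

theorem consistentIntegral_iff : ConsistentIntegral M ↔ WeakCompactness M :=
  ⟨fun h => weakCompactness_of_exists_fine fun _ hδ hpos _ hη => h.exists_fine hδ hpos hη,
    fun h => h.consistentIntegral⟩

end Model
end HOA

/-! ### From models back to provability. -/

namespace HOA

theorem proves_iff_of_model {φ ψ : Sentence}
    (h : ∀ M : Model, Holds M.T φ ↔ Holds M.T ψ) : Proves ACA₀ω (Fm.iff φ ψ) :=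
  proves_of_holds (fun ρ τ => .inr (.ext ρ τ)) fun T _ hT =>
    (sat_iff _ φ ψ).2 (h ⟨T, inferInstance, hT⟩)

end HOA

theorem mainTheorem5 :
    HOA.Proves HOA.ACA₀ω (HOA.Fm.iff HOA.WHBU₀ HOA.Uniqueness) ∧
    HOA.Proves HOA.ACA₀ω (HOA.Fm.iff HOA.WHBU₀ HOA.Consistency) :=
  ⟨HOA.proves_iff_of_model fun _ => HOA.Model.holds_WHBU₀.trans
      (HOA.Model.uniqueIntegral_iff.symm.trans HOA.Model.holds_uniqueness.symm),
    HOA.proves_iff_of_model fun _ => HOA.Model.holds_WHBU₀.trans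
      (HOA.Model.consistentIntegral_iff.symm.trans HOA.Model.holds_consistency.symm)⟩
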